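/- **Setting.** Let $p$ be a prime, $g\ge 1$, $\mathbf f=(f_1,\dots,f_g)$ a tuple of positive integers, $n=\sum_i f_i$, $C_i=f_1+\dots+f_i$, and $[m]=\{1,\dots,m\}$. *Dyck words.* Write a Dyck word $w\in\mathcal D_{2n}$ of length $2n$ uniquely as $w=\prod_{i=1}^r \mathbf 0^{L_i-L_{i-1}}\mathbf 1^{M_i-M_{i-1}}$ with $0=L_0<L_1<\dots<L_r=n$, $0=M_0<M_1<\dots<M_r=n$, $M_i\le L_i$. For partitions $\mu\le\lambda$ with $n$ non-negative parts, $w(\mu,\lambda)=w$ means $\lambda_1\ge\dots\ge\lambda_{L_1}\ge\mu_1\ge\dots\ge\mu_{M_1}>\lambda_{L_1+1}\ge\dots\ge\lambda_{L_2}\ge\mu_{M_1+1}\ge\dots\ge\mu_{M_2}>\cdots>\lambda_{L_{r-1}+1}\ge\dots\ge\lambda_n\ge\mu_{M_{r-1}+1}\ge\dots\ge\mu_n$. *Set partitions.* $\mathcal P_w$ is the set of ordered set partitions $\mathcal A=(\mathcal A_1,\dots,\mathcal A_r)$ of $[g]$ into $r$ non-empty pairwise disjoint blocks with $\sum_{j\in\mathcal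 A_i}f_j=L_i-L_{i-1}$ for all $i$ (those compatible with $w$). *Weak orderings.* $\mathrm{WO}_g$ is the set of pairs $(\sigma,J)$ with $\sigma\in S_g$ and $\mathrm{Des}(\sigma)=\{i\in[g-1]:\sigma(i)>\sigma(i+1)\}\subseteq J\subseteq[g-1]$. For $v=(\sigma,J)$ and $\mathcal A\in\mathcal P_w$, write $\mathcal A(w,v)=\mathcal A$ if there are $0=t_0<t_1<\dots<t_r=g$ with $t_1,\dots,t_{r-1}\in J$ and $\mathcal A_k=\{\sigma(t_{k-1}+1),\dots,\sigma(t_k)\}$ for all $k$. *Admissible tuples.* $\mathrm{Adm}_{\mathbf 1,\mathbf f}$ is the set of $\ell\in\mathbb N_0^n$ that are constant on each block $\{C_{i-1}+1,\dots,C_i\}$; $\lambda(\ell)$ is $\ell$ rearranged in non-ascending order. The weak ordering $v_\ell=(\sigma,J)$ arranges $(\ell_{C_1},\dots,\ell_{C_g})$ in non-ascending order, ties by increasing index, with $J$ the set of positions at which the value strictly drops. *The functions $D$.* Let $\alpha(\lambda,\mu;p)$ be the number of subgroups of type $\mu$ of a finite abelian $p$-group of type $\lambda$. For $t\in\mathbb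 C$ put $$D^{\mathbf f}_{w,v}(p,t)=\sum_{\substack{\ell\in\mathrm{Adm}_{\mathbf 1,\mathbf f}\\ v_\ell=v}}\ \sum_{\substack{\mu\le\lambda(\ell)\\ w(\mu,\lambda(\ell))=w}}\alpha(\lambda(\ell),\mu;p)\,(p^{2n}t)^{\sum_i\mu_i}\,t^{2\sum_i\ell_i},\qquad D^{\mathbf f}_{w,\mathcal A}=\sum_{v\in\mathrm{WO}_g,\ \mathcal A(w,v)=\mathcal A}D^{\mathbf f}_{w,v}.$$ *Igusa functions.* Let $\binom ab_Y$ be the Gaussian binomial and, for $I=\{i_1<\dots<i_m\}\subseteq[h-1]$, let $\binom hI_Y=\binom h{i_m}_Y\binom{i_m}{i_{m-1}}_Y\cdots\binom{i_2}{i_1}_Y$. Put $$I_h(Y;\mathbf X)=\tfrac1{1-X_h}\sum_{I\subseteq[h-1]}\tbinom hI_Y\prod_{i\in I}\tfrac{X_i}{1-X_i},\quad I_h^\circ(Y;\mathbf X)=\tfrac{X_h}{1-X_h}\sum_{I\subseteq[h-1]}\tbinom hI_Y\prod_{i\in I}\tfrac{X_i}{1-X_i},\quad I^{\mathrm{wo}}_h(\mathbf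 X)=\tfrac1{1-X_{[h]}}\sum_{y}\prod_{\mathcal I\in y}\tfrac{X_{\mathcal I}}{1-X_{\mathcal I}},$$ where $y$ runs over all chains (including the empty one) of non-empty proper subsets of $[h]$. **Theorem.** (1) Let $w\in\mathcal D_{2n}$ and $\mathcal A\in\mathcal P_w$. For all $t\in\mathbb C$ with $p^{2n}|t|^3<1$, each series $D^{\mathbf f}_{w,v}(p,t)$ with $\mathcal A(w,v)=\mathcal A$ converges absolutely, and $$D^{\mathbf f}_{w,\mathcal A}(p,t)=\prod_{i=1}^r\binom{L_i-M_{i-1}}{L_i-M_i}_{p^{-1}}\prod_{i=1}^r I^{\mathrm{wo}}_{|\mathcal A_i|}(\mathbf y^{(i)})\cdot\prod_{i=1}^{r-1}I^\circ_{M_i-M_{i-1}}(p^{-1};x_{M_{i-1}+1},\dots,x_{M_i})\cdot I_{n-M_{r-1}}(p^{-1};x_{M_{r-1}+1},\dots,x_n),$$ with numerical data $x_j=p^{j(2n+L_i-j)}t^{2L_i+j}$ for $M_{i-1}<j\le M_i$ and, for $\varnothing\ne\mathcal I\subseteq[|\mathcal A_i|]$, $y^{(i)}_{\mathcal I}=p^{(2n-M_{i-1}+\varepsilon^{(i)}(\mathcal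 I))M_{i-1}}t^{2\varepsilon^{(i)}(\mathcal I)+M_{i-1}}$. Here $\varepsilon^{(i)}(\mathcal I)=L_{i-1}+\sum_{j\in\mathcal I}f_{a^{(i)}_j}$, where $a^{(i)}_1<a^{(i)}_2<\cdots$ are the elements of $\mathcal A_i$. (2) Let $K$ be a number field with ring of integers $\mathcal O_K$ such that $p\mathcal O_K=\mathfrak p_1\cdots\mathfrak p_g$ with distinct primes $\mathfrak p_i$ of inertia degrees $f_i$. Let $L_p$ be the Heisenberg Lie algebra of strictly upper triangular $3\times3$ matrices over $\mathcal O_K\otimes_{\mathbb Z}\mathbb Z_p$, let $\zeta^{\triangleleft}_{L_p}(s)=\sum_{m\ge1}a_m m^{-s}$, where $a_m$ is the number of $\mathbb Z_p$-ideals of index $m$ in $L_p$, and let $\zeta^{\triangleleft}_{\mathbb Z_p^{2n}}(s)=\sum_{m\ge 1}b_m m^{-s}$, where $b_m$ is the number of $\mathbb Z_p$-submodules of index $m$ in $\mathbb Z_p^{2n}$. Then all $a_m$ and $b_m$ are finite, and for $\operatorname{Re}(s)>2n-1$ both series converge absolutely and, with $t=p^{-s}$, $$\zeta^{\triangleleft}_{L_p}(s)=\prod_{i=1}^g(1-t^{2f_i})\cdot\zeta^{\triangleleft}_{\mathbb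 Z_p^{2n}}(s)\sum_{w\in\mathcal D_{2n}}\ \sum_{\mathcal A\in\mathcal P_w}D^{\mathbf f}_{w,\mathcal A}(p,t).$$ -/

import Mathlib

namespace HeisenbergZeta

/-! ### Zeta functions of Lie lattices -/

attribute [local instance 100] LieRing.ofAssociativeRing

/-- The Heisenberg Lie algebra over a commutative `A`-algebra `R`: strictly upper triangular
`3 × 3` matrices over `R` with the commutator bracket, as a Lie algebra over `A`. -/
def heisenberg (A R : Type*) [CommRing A] [CommRing R] [Algebra A R] :
    LieSubalgebra A (Matrix (Fin 3) (Fin 3) R) where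
  carrier := {X | ∀ i j, j ≤ i → X i j = 0}
  zero_mem' := fun i j _ => by simp
  add_mem' := fun {X Y} hX hY i j h => by simp [hX i j h, hY i j h]
  smul_mem' := fun c X hX i j h => by simp [hX i j h]
  lie_mem' := fun {X Y} hX hY i j h => by
    have key : ∀ U V : Matrix (Fin 3) (Fin 3) R, (∀ i j, j ≤ i → U i j = 0) →
        (∀ i j, j ≤ i → V i j = 0) → (U * V) i j = 0 := by
      intro U V hU hV
      rw [Matrix.mul_apply]
      refine Finset.sum_eq_zero fun k _ => ?_
      by_cases hk : k ≤ i
      · rw [hU i k hk, zero_mul]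
      · rw [hV k j (h.trans (le_of_lt (not_le.mp hk))), mul_zero]
    rw [Ring.lie_def, Matrix.sub_apply, key X Y hX hY, key Y X hY hX, sub_zero]

/-- The number of `A`-ideals of additive index `m` in the Lie algebra `Lie`. -/
noncomputable def numIdeals (A Lie : Type*) [CommRing A] [LieRing Lie] [LieAlgebra A Lie]
    (m : ℕ) : ℕ :=
  Nat.card {I : LieIdeal A Lie // I.toSubmodule.toAddSubgroup.index = m}

/-- The number of `A`-submodules of additive index `m` in the module `V`. -/
noncomputable def numSubmodules (A V : Type*) [CommRing A] [AddCommGroup V] [Module A V]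
    (m : ℕ) : ℕ :=
  Nat.card {N : Submodule A V // N.toAddSubgroup.index = m}

/-- The ideal zeta function `∑_{m ≥ 1} a_m m^{-s}`, where `a_m` is the number of ideals of
index `m`. -/
noncomputable def idealZeta (A Lie : Type*) [CommRing A] [LieRing Lie] [LieAlgebra A Lie]
    (s : ℂ) : ℂ :=
  LSeries (fun m => (numIdeals A Lie m : ℂ)) s

/-- The zeta function `∑_{m ≥ 1} b_m m^{-s}`, where `b_m` is the number of submodules of index
`m`; for an abelian Lie lattice, all submodules are ideals. -/
noncomputable def submoduleZeta (A V : Type*) [CommRing A] [AddCommGroup V] [Module A V]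
    (s : ℂ) : ℂ :=
  LSeries (fun m => (numSubmodules A V m : ℂ)) s

/-! ### Gaussian coefficients and Igusa functions -/

/-- The Gaussian binomial coefficient `(a choose b)_Y`, for `b ≤ a`, evaluated at an element `Y`
of a field such that `Y, Y ^ 2, …, Y ^ b` differ from `1`. -/
def gaussBinom {F : Type*} [Field F] (a b : ℕ) (Y : F) : F :=
  (∏ i ∈ Finset.Ioc (a - b) a, (1 - Y ^ i)) / ∏ i ∈ Finset.Icc 1 b, (1 - Y ^ i)

/-- The Gaussian multinomial `(h choose I)_Y` for `I = {i₁ < ⋯ < iₘ} ⊆ {1, …, h - 1}`: the product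
of the Gaussian binomials `(i' choose i)_Y` over `i ∈ I`, where `i'` is the next larger element of
`I ∪ {h}`. -/
noncomputable def gaussMultinom {F : Type*} [Field F] (h : ℕ) (I : Finset ℕ) (Y : F) : F :=
  ∏ i ∈ I, gaussBinom (sInf {j : ℕ | j ∈ insert h I ∧ i < j}) i Y

/-- The sum over `I ⊆ {1, …, h - 1}` common to the two Igusa functions. -/
noncomputable def igusaSum {F : Type*} [Field F] (h : ℕ) (Y : F) (X : ℕ → F) : F :=
  ∑ I ∈ (Finset.Ico 1 h).powerset, gaussMultinom h I Y * ∏ i ∈ I, X i / (1 - X i)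

/-- The Igusa function `I_h(Y; X₁, …, X_h)`. -/
noncomputable def igusa {F : Type*} [Field F] (h : ℕ) (Y : F) (X : ℕ → F) : F :=
  1 / (1 - X h) * igusaSum h Y X

/-- The Igusa function `I_h^∘(Y; X₁, …, X_h)`. -/
noncomputable def igusaCirc {F : Type*} [Field F] (h : ℕ) (Y : F) (X : ℕ → F) : F :=
  X h / (1 - X h) * igusaSum h Y X

open scoped Classical in
/-- The set `P_h` of chains (possibly empty) of nonempty proper subsets of an `h`-element set. -/
noncomputable def flags (h : ℕ) : Finset (Finset (Finset (Fin h))) :=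
  Finset.univ.filter fun y =>
    (∀ I ∈ y, I.Nonempty ∧ I ≠ Finset.univ) ∧ ∀ I ∈ y, ∀ I' ∈ y, I ⊆ I' ∨ I' ⊆ I

/-- The generalized Igusa function `I_h^wo` in variables indexed by the nonempty subsets of an
`h`-element set. -/
noncomputable def igusaWO {F : Type*} [Field F] (h : ℕ) (X : Finset (Fin h) → F) : F :=
  1 / (1 - X Finset.univ) * ∑ y ∈ flags h, ∏ I ∈ y, X I / (1 - X I)

/-! ### Dyck words

A Dyck word is written uniquely as `0^{L₁} 1^{M₁} 0^{L₂ - L₁} 1^{M₂ - M₁} ⋯` with `r` maximal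
runs of zeros (`DyckStep.U`) and `r` maximal runs of ones (`DyckStep.D`), where
`0 = L₀ < L₁ < ⋯ < L_r` and `0 = M₀ < M₁ < ⋯ < M_r`. -/

/-- The lengths of the maximal runs of equal letters of a Dyck word. -/
def runLengths (w : DyckWord) : List ℕ :=
  (w.toList.splitBy (fun a b => decide (a = b))).map List.length

/-- The number `r` of runs of zeros. -/
def numRuns (w : DyckWord) : ℕ := (runLengths w).length / 2

/-- `L_i`: the number of zeros in the first `i` runs of zeros. -/
def dyckL (w : DyckWord) (i : ℕ) : ℕ :=
  ∑ k ∈ Finset.range i, (runLengths w).getD (2 * k) 0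

/-- `M_i`: the number of ones in the first `i` runs of ones. -/
def dyckM (w : DyckWord) (i : ℕ) : ℕ :=
  ∑ k ∈ Finset.range i, (runLengths w).getD (2 * k + 1) 0

/-! ### Partitions -/

/-- The `j`-th component `a_j` (`1 ≤ j ≤ n`) of an `n`-tuple, counted from `1`. -/
def part {n : ℕ} (a : Fin n → ℕ) (j : ℕ) : ℕ :=
  if h : 1 ≤ j ∧ j - 1 < n then a ⟨j - 1, h.2⟩ else 0

/-- The partition `λ(ℓ)`: the components of `ℓ` in non-ascending order. -/
def sortDesc {n : ℕ} (l : Fin n → ℕ) : Fin n → ℕ :=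
  l ∘ Tuple.sort (OrderDual.toDual ∘ l)

/-- `w(μ, λ) = w`, that is
`λ₁ ≥ ⋯ ≥ λ_{L₁} ≥ μ₁ ≥ ⋯ ≥ μ_{M₁} > λ_{L₁+1} ≥ ⋯ ≥ λ_{L₂} ≥ μ_{M₁+1} ≥ ⋯ ≥ μ_{M₂} > ⋯`
(for `λ` and `μ` already non-ascending). -/
def HasOverlapType (w : DyckWord) {n : ℕ} (lam mu : Fin n → ℕ) : Prop :=
  (∀ i < numRuns w, part mu (dyckM w i + 1) ≤ part lam (dyckL w (i + 1))) ∧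
  ∀ i, 1 ≤ i → i < numRuns w → part lam (dyckL w i + 1) < part mu (dyckM w i)

/-- `α(λ, μ; p)`: the number of subgroups of type `μ` of the finite abelian `p`-group
`∏_j ℤ / p ^ λ_j` of type `λ`. -/
noncomputable def alpha (p : ℕ) {n : ℕ} (lam mu : Fin n → ℕ) : ℕ :=
  Nat.card {H : AddSubgroup (∀ j, ZMod (p ^ lam j)) // Nonempty (H ≃+ ∀ j, ZMod (p ^ mu j))}

/-! ### Admissible tuples, weak orderings and set partitions -/

/-- `C_i = f₁ + ⋯ + f_i`. -/
def blockEnd {g : ℕ} (f : Fin g → ℕ) (i : ℕ) : ℕ :=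
  ∑ j ∈ Finset.univ.filter (fun j : Fin g => (j : ℕ) < i), f j

/-- The `n`-tuples that are constant on each of the blocks `C_{i-1} < j ≤ C_i`. -/
def admissible {g : ℕ} (n : ℕ) (f : Fin g → ℕ) : Set (Fin n → ℕ) :=
  {l | ∀ i < g, ∀ j, blockEnd f i < j → j ≤ blockEnd f (i + 1) →
    part l j = part l (blockEnd f (i + 1))}

/-- `ψ(ℓ) = (ℓ_{C₁}, …, ℓ_{C_g})`. -/
def psi {g n : ℕ} (f : Fin g → ℕ) (l : Fin n → ℕ) : Fin g → ℕ :=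
  fun i => part l (blockEnd f (i + 1))

/-- The descent set `{1 ≤ i < g : σ(i) > σ(i + 1)}` (positions counted from `1`). -/
def descents {g : ℕ} (σ : Equiv.Perm (Fin g)) : Finset ℕ :=
  (Finset.Ico 1 g).filter fun i => part (fun k => (σ k : ℕ)) (i + 1) < part (fun k => (σ k : ℕ)) i

/-- The set `WO_g` of weak orderings `(σ, J)`, `Des(σ) ⊆ J ⊆ {1, …, g - 1}`. -/
def weakOrderings (g : ℕ) : Finset (Equiv.Perm (Fin g) × Finset ℕ) :=
  (Finset.univ ×ˢ (Finset.Ico 1 g).powerset).filter fun v => descents v.1 ⊆ v.2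

/-- The weak ordering obtained by arranging the components of `m` in non-ascending order: the
permutation lists the indices by decreasing value of `m` (ties in increasing order), and `J` is
the set of positions at which the value drops. -/
def weakOrderOf {g : ℕ} (m : Fin g → ℕ) : Equiv.Perm (Fin g) × Finset ℕ :=
  (Tuple.sort (OrderDual.toDual ∘ m),
    (Finset.Ico 1 g).filter fun j => part (sortDesc m) (j + 1) < part (sortDesc m) j)

open scoped Classical in
/-- The ordered set partitions `(A_1, …, A_r)` of the `g` indices that are compatible with `w`:
`∑_{j ∈ A_i} f_j = L_i - L_{i-1}` for all `i`. -/
noncomputable def compatible {g : ℕ} (f : Fin g → ℕ) (w : DyckWord) :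
    Finset (Fin (numRuns w) → Finset (Fin g)) :=
  Finset.univ.filter fun A =>
    (∀ k, (A k).Nonempty) ∧ (∀ k k', k ≠ k' → Disjoint (A k) (A k')) ∧ (∀ j, ∃ k, j ∈ A k) ∧
    ∀ k, ∑ j ∈ A k, f j = dyckL w (k + 1) - dyckL w k

/-- The weak ordering `v = (σ, J)` is compatible with `w` and `A(w, v) = A`: there are
`0 = t₀ < t₁ < ⋯ < t_r = g` with `t₁, …, t_{r-1} ∈ J` such that `A_k = {σ(t_{k-1}+1), …, σ(t_k)}`
and `A` is compatible with `w`. -/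
def Induces {g : ℕ} (f : Fin g → ℕ) (w : DyckWord) (v : Equiv.Perm (Fin g) × Finset ℕ)
    (A : Fin (numRuns w) → Finset (Fin g)) : Prop :=
  A ∈ compatible f w ∧ ∃ t : ℕ → ℕ, t 0 = 0 ∧ t (numRuns w) = g ∧
    (∀ k < numRuns w, t k < t (k + 1)) ∧ (∀ k, 1 ≤ k → k < numRuns w → t k ∈ v.2) ∧
    ∀ k : Fin (numRuns w),
      A k = (Finset.univ.filter fun j : Fin g => t k ≤ j ∧ (j : ℕ) < t (k + 1)).image v.1

/-! ### The functions `D` -/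

/-- The pairs `(ℓ, μ)` with `ℓ` admissible, `v_ℓ = v`, `μ ≤ λ(ℓ)` a partition and
`w(μ, λ(ℓ)) = w`. -/
def pairs {g : ℕ} (n : ℕ) (f : Fin g → ℕ) (w : DyckWord) (v : Equiv.Perm (Fin g) × Finset ℕ) :
    Set ((Fin n → ℕ) × (Fin n → ℕ)) :=
  {x | x.1 ∈ admissible n f ∧ weakOrderOf (psi f x.1) = v ∧
    Antitone x.2 ∧ x.2 ≤ sortDesc x.1 ∧ HasOverlapType w (sortDesc x.1) x.2}

/-- The summand `α(λ(ℓ), μ; p) (p^{2n} t)^{∑ μ_i} t^{2 ∑ ℓ_i}`. -/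
noncomputable def term (p : ℕ) {n : ℕ} (t : ℂ) (x : (Fin n → ℕ) × (Fin n → ℕ)) : ℂ :=
  (alpha p (sortDesc x.1) x.2 : ℂ) * ((p : ℂ) ^ (2 * n) * t) ^ (∑ i, x.2 i) *
    t ^ (2 * ∑ i, x.1 i)

/-- `D_{w,v}^f(p, t)`. -/
noncomputable def Dwv {g : ℕ} (p n : ℕ) (f : Fin g → ℕ) (w : DyckWord)
    (v : Equiv.Perm (Fin g) × Finset ℕ) (t : ℂ) : ℂ :=
  ∑' x : pairs n f w v, term p t x.1

open scoped Classical in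
/-- `D_{w,A}^f(p, t)`: the sum of `D_{w,v}^f(p, t)` over the weak orderings `v` with
`A(w, v) = A`. -/
noncomputable def DwA {g : ℕ} (p n : ℕ) (f : Fin g → ℕ) (w : DyckWord)
    (A : Fin (numRuns w) → Finset (Fin g)) (t : ℂ) : ℂ :=
  ∑ v ∈ (weakOrderings g).filter (fun v => Induces f w v A), Dwv p n f w v t

/-! ### Numerical data -/

/-- `x_j = p^{j(2n + L_i - j)} t^{2 L_i + j}` for `M_{i-1} < j ≤ M_i`. -/
noncomputable def xData (p n : ℕ) (w : DyckWord) (i : ℕ) (t : ℂ) (j : ℕ) : ℂ :=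
  (p : ℂ) ^ (j * (2 * n + dyckL w i - j)) * t ^ (2 * dyckL w i + j)

/-- `ε^{(i)}(I) = L_{i-1} + ∑_{j ∈ I} f_{a_j}`, where `a₁ < a₂ < ⋯` are the elements of `A_i`.
Here the block `A_i` is given by the index `k = i - 1` counted from zero. -/
def epsData {g : ℕ} (f : Fin g → ℕ) (w : DyckWord) (A : Fin (numRuns w) → Finset (Fin g))
    (k : Fin (numRuns w)) (I : Finset (Fin (A k).card)) : ℕ :=
  dyckL w k + ∑ j ∈ I, f ((A k).orderEmbOfFin rfl j)

/-- `y^{(i)}_I = p^{(2n - M_{i-1} + ε^{(i)}(I)) M_{i-1}} t^{2 ε^{(i)}(I) + M_{i-1}}`,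
with `k = i - 1`. -/
noncomputable def yData {g : ℕ} (p n : ℕ) (f : Fin g → ℕ) (w : DyckWord)
    (A : Fin (numRuns w) → Finset (Fin g)) (k : Fin (numRuns w)) (t : ℂ)
    (I : Finset (Fin (A k).card)) : ℂ :=
  (p : ℂ) ^ ((2 * n - dyckM w k + epsData f w A k I) * dyckM w k) *
    t ^ (2 * epsData f w A k I + dyckM w k)

end HeisenbergZeta

/-!
# The local ideal zeta functions of the Heisenberg Lie algebra at unramified primes

**The functions `D`.** For an admissible `ℓ`, given by its values `m` on the `g` blocks, and a
partition `μ`, consider the level sets `{ℓ ≥ x}` and `{μ ≥ x}` for `x ≥ 1`; together they form a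
chain of subsets of `Fin g ⊕ Fin n`. By Birkhoff's formula (`alpha_mul_eq`) the number of subgroups
of type `μ` of a group of type `λ(ℓ)` is a power of `p`, which is multiplicative in the level sets,
times a factor that depends only on *which* level sets occur and not on their multiplicities. The
formula is proved by counting injective homomorphisms, choosing the images of the generators one
after the other. Hence the summand belonging to `(ℓ, μ)` is a coefficient of the chain of its level
sets times the product of the weights of these level sets (`term_eq`), and the sum over all
multiplicities is a product of geometric series, whatever the chain (`hasSum_coeff_levelWeight`).

Next, one determines the chains that belong to a Dyck word `w` and a set partition `A`. The pairs
in question are those for which the values of `ℓ` on the block `A_k` lie between two consecutive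
parts of `μ`, at the beginning of the `k`-th run of ones of `w` (`Interlaced`). In terms of level
sets this says that the chain runs through part of the block `A_1`, then through part of the first
run of ones, then through part of `A_2`, and so on, stopping at the end of every run but the last
(`FitsStates`). Such a chain is an independent choice of a chain of subsets for each block and of a
subset of each run, so that the sum over all chains factors (`sum_pairCoeff`): the blocks yield the
functions `I^wo` and the runs the functions `I^∘` and `I`, because a Gaussian multinomial is the
quotient of products over the places of a run which occurs in Birkhoff's formula
(`gaussMultinom_mul`). This is the explicit formula `DwA_eq`.

**The zeta function.** Let `R = ℤ_p ⊗ 𝓞_K`. An ideal of finite index of the Heisenberg Lie algebra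
over `R` is given by its image `N₁` in `R × R`, its intersection `N₂` with the centre `R`, and a
homomorphism `N₁ → R / N₂`, the only condition being that `N₂` contains the ideal of `R` generated
by the coordinates of the elements of `N₁` (`lie_mem_iff`). As `N₁` is free of rank `2n`, there are
`|R / N₂| ^ {2n}` homomorphisms. The ideals of finite index of `R` are the `(∏ π_i ^ l_i)` for a
system of uniformizers `π` (`IsUniformizing`), and every `N₁` is uniquely `∏ π_i ^ l_i` times a
submodule `N₀` whose coordinates generate `R` (`IsUniformizing.bijective_ofPrimitive`). Without `N₂`
the sum over `N₀` and `l` is the zeta function of `R × R`, so that the sum over the `N₀` is this zeta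
function times `∏ (1 - t ^ {2 f_i})`. The remaining sum, over `l` and the `N₂` containing
`(∏ π_i ^ l_i)`, is a sum over the subgroups of the finite groups `R / (∏ π_i ^ l_i)` of type `λ(ℓ)`.
By duality these may be sorted by the type `μ` of a subgroup whose *order* is the index of `N₂`
(`exists_dualType`), which turns the sum into that of the terms of the functions `D`; every pair
`(ℓ, μ)` occurs in exactly one of them (`hasSum_sum_DwA`).

The structure of `R` is obtained without decomposing it into a product of local rings: `𝓞_K` is
dense in `R`, so that ideals of finite index of `R` are those of `𝓞_K` containing a power of `p`, and
primes above `p` become principal by Nakayama's lemma.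
-/

namespace HeisenbergZeta

/-! ### Generating functions over level sets -/

section LevelSets

variable {V : Type*} [Fintype V] [DecidableEq V]

/-- The set of points at which `a` takes a value `≥ x`. -/
def levelSet (a : V → ℕ) (x : ℕ) : Finset V := Finset.univ.filter fun v => x ≤ a v

/-- The set of the nonempty level sets `{a ≥ x}`, `x ≥ 1`, of `a`. -/
def levelSets (a : V → ℕ) : Finset (Finset V) :=
  (Finset.Icc 1 (Finset.univ.sup a)).image (levelSet a)

/-- The product of `X S` over the nonempty level sets `S = {a ≥ x}`, `x ≥ 1`, with multiplicity. -/
def levelWeight {F : Type*} [CommMonoid F] (X : Finset V → F) (a : V → ℕ) : F :=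
  ∏ x ∈ Finset.Icc 1 (Finset.univ.sup a), X (levelSet a x)

/-- A chain of nonempty subsets. -/
def IsFlag (y : Finset (Finset V)) : Prop :=
  (∀ S ∈ y, S.Nonempty) ∧ ∀ S ∈ y, ∀ S' ∈ y, S ⊆ S' ∨ S' ⊆ S

omit [DecidableEq V] in
@[simp] lemma mem_levelSet {a : V → ℕ} {x : ℕ} {v : V} : v ∈ levelSet a x ↔ x ≤ a v := by
  simp [levelSet]

lemma mem_levelSets {a : V → ℕ} {S : Finset V} :
    S ∈ levelSets a ↔ ∃ x, 1 ≤ x ∧ S.Nonempty ∧ S = levelSet a x := by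
  simp only [levelSets, Finset.mem_image, Finset.mem_Icc]
  constructor
  · rintro ⟨x, ⟨h1, h2⟩, rfl⟩
    refine ⟨x, h1, ?_, rfl⟩
    by_contra h
    rw [Finset.not_nonempty_iff_eq_empty] at h
    have : Finset.univ.sup a ≤ x - 1 := Finset.sup_le fun v _ => by
      have : v ∉ levelSet a x := by simp [h]
      rw [mem_levelSet] at this
      omega
    omega
  · rintro ⟨x, h1, ⟨v, hv⟩, rfl⟩
    exact ⟨x, ⟨h1, (mem_levelSet.1 hv).trans (Finset.le_sup (f := a) (Finset.mem_univ v))⟩, rfl⟩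

lemma isFlag_levelSets (a : V → ℕ) : IsFlag (levelSets a) := by
  refine ⟨fun S hS => ?_, fun S hS S' hS' => ?_⟩
  · obtain ⟨x, -, h, -⟩ := mem_levelSets.1 hS
    exact h
  · obtain ⟨x, -, -, rfl⟩ := mem_levelSets.1 hS
    obtain ⟨x', -, -, rfl⟩ := mem_levelSets.1 hS'
    rcases le_total x x' with h | h
    · exact Or.inr fun v hv => mem_levelSet.2 (h.trans (mem_levelSet.1 hv))
    · exact Or.inl fun v hv => mem_levelSet.2 (h.trans (mem_levelSet.1 hv))

/-- The function `a` raised by `c + 1` on `S`. -/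
def raise (S : Finset V) (c : ℕ) (a : V → ℕ) : V → ℕ := fun v => a v + if v ∈ S then c + 1 else 0

lemma sup_raise {S : Finset V} (hS : S.Nonempty) (c : ℕ) {a : V → ℕ}
    (ha : ∀ v, v ∉ S → a v = 0) : Finset.univ.sup (raise S c a) = c + 1 + Finset.univ.sup a := by
  apply le_antisymm
  · refine Finset.sup_le fun v _ => ?_
    have := Finset.le_sup (f := a) (Finset.mem_univ v)
    unfold raise
    split_ifs <;> omega
  · obtain ⟨u, hu⟩ := hS
    obtain ⟨v, -, hv⟩ := Finset.exists_mem_eq_sup Finset.univ ⟨u, Finset.mem_univ u⟩ a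
    have key : ∀ w ∈ S, c + 1 + a w ≤ Finset.univ.sup (raise S c a) := fun w hw => by
      refine le_trans ?_ (Finset.le_sup (f := raise S c a) (Finset.mem_univ w))
      simp [raise, hw, add_comm]
    by_cases h : v ∈ S
    · rw [hv]; exact key v h
    · rw [hv, ha v h]
      have := key u hu
      omega

lemma levelSet_raise_le (S : Finset V) (c : ℕ) {a : V → ℕ} (ha : ∀ v, v ∉ S → a v = 0) {x : ℕ}
    (h1 : 1 ≤ x) (hx : x ≤ c + 1) : levelSet (raise S c a) x = S := by
  ext v
  rw [mem_levelSet, raise]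
  by_cases h : v ∈ S
  · simp [h]; omega
  · simp [h, ha v h]; omega

lemma levelSet_raise_add (S : Finset V) (c : ℕ) {a : V → ℕ} (ha : ∀ v, v ∉ S → a v = 0) {x : ℕ}
    (h1 : 1 ≤ x) : levelSet (raise S c a) (c + 1 + x) = levelSet a x := by
  ext v
  rw [mem_levelSet, mem_levelSet, raise]
  by_cases h : v ∈ S
  · simp [h]; omega
  · simp [h, ha v h]; omega

lemma levelWeight_raise {F : Type*} [CommMonoid F] (X : Finset V → F) {S : Finset V}
    (hS : S.Nonempty) (c : ℕ) {a : V → ℕ} (ha : ∀ v, v ∉ S → a v = 0) :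
    levelWeight X (raise S c a) = X S ^ (c + 1) * levelWeight X a := by
  have h0 : ∀ (N : ℕ) (G : ℕ → F), ∏ x ∈ Finset.Icc 1 N, G x = ∏ x ∈ Finset.range N, G (x + 1) :=
    fun N G => by
      rw [Finset.range_eq_Ico, Finset.prod_Ico_add' G 0 N 1]
      rfl
  rw [levelWeight, levelWeight, sup_raise hS c ha, h0, h0, Finset.prod_range_add]
  congr 1
  · rw [Finset.prod_congr rfl (g := fun _ => X S), Finset.prod_const, Finset.card_range]
    intro x hx
    rw [Finset.mem_range] at hx
    rw [levelSet_raise_le S c ha (by omega) (by omega)]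
  · refine Finset.prod_congr rfl fun x _ => ?_
    rw [add_assoc, levelSet_raise_add S c ha (by omega)]

lemma levelSets_raise {S : Finset V} (hS : S.Nonempty) (c : ℕ) {a : V → ℕ}
    (ha : ∀ v, v ∉ S → a v = 0) : levelSets (raise S c a) = insert S (levelSets a) := by
  ext T
  rw [Finset.mem_insert, mem_levelSets, mem_levelSets]
  constructor
  · rintro ⟨x, h1, hT, rfl⟩
    by_cases hx : x ≤ c + 1
    · exact Or.inl (levelSet_raise_le S c ha h1 hx)
    · obtain ⟨z, rfl⟩ : ∃ z, x = c + 1 + z := ⟨x - (c + 1), by omega⟩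
      rw [levelSet_raise_add S c ha (by omega)] at hT ⊢
      exact Or.inr ⟨z, by omega, hT, rfl⟩
  · rintro (rfl | ⟨x, h1, hT, rfl⟩)
    · exact ⟨1, le_rfl, hS, (levelSet_raise_le T c ha le_rfl (by omega)).symm⟩
    · exact ⟨c + 1 + x, by omega, hT, (levelSet_raise_add S c ha h1).symm⟩

/-- A function whose level sets are `S` and proper subsets of `S` arises uniquely by raising, on
`S`, a function whose level sets are those proper subsets. -/
lemma exists_raise_eq {S : Finset V} (hS : S.Nonempty) {y : Finset (Finset V)}
    (hy : ∀ T ∈ y, T ⊂ S) {a : V → ℕ} (ha : levelSets a = insert S y) :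
    ∃ (c : ℕ) (b : V → ℕ), levelSets b = y ∧ raise S c b = a := by
  have hsub : ∀ x, 1 ≤ x → levelSet a x ⊆ S := by
    intro x hx
    rcases (levelSet a x).eq_empty_or_nonempty with h | h
    · simp [h]
    have : levelSet a x ∈ levelSets a := mem_levelSets.2 ⟨x, hx, h, rfl⟩
    rw [ha, Finset.mem_insert] at this
    rcases this with h' | h'
    · exact h'.subset
    · exact (hy _ h').subset
  have hout : ∀ v, v ∉ S → a v = 0 := by
    intro v hv
    by_contra h
    exact hv (hsub 1 le_rfl (mem_levelSet.2 (by omega)))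
  obtain ⟨x, hx, -, hSx⟩ := mem_levelSets.1 (show S ∈ levelSets a by simp [ha])
  have hpos : ∀ v ∈ S, 1 ≤ a v := fun v hv => by
    rw [hSx, mem_levelSet] at hv
    omega
  obtain ⟨u, hu, hmin⟩ := Finset.exists_min_image S a hS
  set b : V → ℕ := fun v => if v ∈ S then a v - a u else 0 with hb
  have hb0 : ∀ v, v ∉ S → b v = 0 := fun v hv => by simp [hb, hv]
  have hr : raise S (a u - 1) b = a := by
    funext v
    by_cases hv : v ∈ S
    · have := hmin v hv
      have := hpos u hu
      simp only [raise, hb, hv, if_true]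
      omega
    · simp [raise, hb, hv, hout v hv]
  refine ⟨a u - 1, b, ?_, hr⟩
  have h1 : insert S (levelSets b) = insert S y := by rw [← levelSets_raise hS _ hb0, hr, ha]
  have h2 : S ∉ levelSets b := fun h => by
    obtain ⟨x, hx, -, h⟩ := mem_levelSets.1 h
    rw [h, mem_levelSet] at hu
    simp only [hb] at hu
    split_ifs at hu <;> omega
  have h3 : S ∉ y := fun h => (hy S h).ne rfl
  rw [← Finset.erase_insert h2, h1, Finset.erase_insert h3]

omit [Fintype V] in
/-- The value by which a function vanishing somewhere on `S` has been raised on `S` is the minimum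
on `S`. -/
lemma raise_injective {S : Finset V} {c c' : ℕ} {b b' : V → ℕ}
    (hS : ∃ u ∈ S, b u = 0) (hS' : ∃ u ∈ S, b' u = 0) (h : raise S c b = raise S c' b') :
    c = c' ∧ b = b' := by
  obtain ⟨u, hu, h0⟩ := hS
  obtain ⟨u', hu', h0'⟩ := hS'
  have h1 := congrFun h u
  have h2 := congrFun h u'
  simp only [raise, hu, hu', if_true, h0, h0'] at h1 h2
  have hc : c = c' := by omega
  refine ⟨hc, funext fun v => ?_⟩
  have := congrFun h v
  simp only [raise, hc] at this
  omega

variable {𝕜 : Type*} [NormedField 𝕜] [CompleteSpace 𝕜]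

/-- Summing the level weights of all functions with the prescribed set `y` of level sets: the
multiplicities of the members of `y` range independently over the positive integers. -/
theorem hasSum_levelWeight (X : Finset V → 𝕜) (y : Finset (Finset V)) (hy : IsFlag y)
    (hX : ∀ S ∈ y, ‖X S‖ < 1) :
    HasSum (fun a : {a : V → ℕ // levelSets a = y} => levelWeight X a.1)
        (∏ S ∈ y, X S / (1 - X S)) ∧
      Summable fun a : {a : V → ℕ // levelSets a = y} => ‖levelWeight X a.1‖ := by
  induction hc : y.card generalizing y with
  | zero =>
    rw [Finset.card_eq_zero] at hc
    subst hc
    have huniq : ∀ a : V → ℕ, levelSets a = ∅ ↔ a = 0 := by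
      intro a
      constructor
      · intro h
        funext v
        by_contra hv
        have : levelSet a 1 ∈ levelSets a :=
          mem_levelSets.2 ⟨1, le_rfl, ⟨v, mem_levelSet.2 (Nat.pos_of_ne_zero hv)⟩, rfl⟩
        simp [h] at this
      · rintro rfl
        have h0 : Finset.univ.sup (0 : V → ℕ) = 0 := by
          exact Nat.le_zero.1 (Finset.sup_le fun v _ => le_rfl)
        simp [levelSets, h0]
    have : Unique {a : V → ℕ // levelSets a = ∅} :=
      { default := ⟨0, (huniq 0).2 rfl⟩
        uniq := fun a => Subtype.ext ((huniq a.1).1 a.2) }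
    have hw : levelWeight X (default : {a : V → ℕ // levelSets a = ∅}).1 = 1 := by
      rw [(huniq _).1 (default : {a : V → ℕ // levelSets a = ∅}).2, levelWeight]
      have h0 : Finset.univ.sup (0 : V → ℕ) = 0 := by
        exact Nat.le_zero.1 (Finset.sup_le fun v _ => le_rfl)
      simp [h0]
    refine ⟨?_, ?_⟩
    · have := hasSum_fintype (fun a : {a : V → ℕ // levelSets a = ∅} => levelWeight X a.1)
      simpa [hw] using this
    · exact (hasSum_fintype _).summable
  | succ m ih =>
    have hne : y.Nonempty := by rw [← Finset.card_pos]; omega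
    obtain ⟨S, hSy, hmax⟩ := Finset.exists_max_image y Finset.card hne
    set z := y.erase S with hz
    have hins : insert S z = y := Finset.insert_erase hSy
    have hlt : ∀ T ∈ z, T ⊂ S := by
      intro T hT
      have hT' := Finset.mem_of_mem_erase hT
      have hTS : T ≠ S := Finset.ne_of_mem_erase hT
      rcases hy.2 T hT' S hSy with h | h
      · exact lt_of_le_of_ne h hTS
      · exact absurd (Finset.eq_of_subset_of_card_le h (hmax T hT')).symm hTS
    obtain ⟨ih1, ih2⟩ := ih z ⟨fun T hT => hy.1 T (Finset.mem_of_mem_erase hT),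
      fun T hT T' hT' => hy.2 T (Finset.mem_of_mem_erase hT) T' (Finset.mem_of_mem_erase hT')⟩
      (fun T hT => hX T (Finset.mem_of_mem_erase hT)) (by rw [Finset.card_erase_of_mem hSy]; omega)
    have hSne := hy.1 S hSy
    -- functions with level sets in `z` vanish outside `S` and somewhere on `S`
    have hzero : ∀ b : V → ℕ, levelSets b = z → (∀ v, v ∉ S → b v = 0) ∧ ∃ u ∈ S, b u = 0 := by
      intro b hb
      by_cases h1 : (levelSet b 1).Nonempty
      · have hT : levelSet b 1 ∈ z := hb ▸ mem_levelSets.2 ⟨1, le_rfl, h1, rfl⟩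
        have hT' := hlt _ hT
        obtain ⟨u, hu, hu'⟩ := Finset.exists_of_ssubset hT'
        refine ⟨fun v hv => ?_, u, hu, ?_⟩
        · have : v ∉ levelSet b 1 := fun h => hv (hT'.subset h)
          rw [mem_levelSet] at this
          omega
        · rw [mem_levelSet] at hu'
          omega
      · have h0 : ∀ v, b v = 0 := fun v => by
          by_contra h
          exact h1 ⟨v, mem_levelSet.2 (by omega)⟩
        exact ⟨fun v _ => h0 v, hSne.choose, hSne.choose_spec, h0 _⟩
    let e : ℕ × {b : V → ℕ // levelSets b = z} ≃ {a : V → ℕ // levelSets a = y} :=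
      Equiv.ofBijective
        (fun q => ⟨raise S q.1 q.2.1, by
          rw [levelSets_raise hSne _ (hzero _ q.2.2).1, q.2.2, hins]⟩) (by
        constructor
        · rintro ⟨c, b, hb⟩ ⟨c', b', hb'⟩ h
          obtain ⟨rfl, rfl⟩ := raise_injective (hzero b hb).2 (hzero b' hb').2
            (Subtype.ext_iff.1 h)
          rfl
        · rintro ⟨a, ha⟩
          obtain ⟨c, b, hb, rfl⟩ := exists_raise_eq hSne hlt (ha.trans hins.symm)
          exact ⟨⟨c, b, hb⟩, rfl⟩)
    have he : ∀ q, levelWeight X (e q).1 = X S ^ (q.1 + 1) * levelWeight X q.2.1 := fun q =>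
      levelWeight_raise X hSne q.1 (hzero _ q.2.2).1
    have hXS := hX S hSy
    have hg : HasSum (fun c : ℕ => X S ^ (c + 1)) (X S / (1 - X S)) := by
      simpa [pow_succ', div_eq_mul_inv] using (hasSum_geometric_of_norm_lt_one hXS).mul_left (X S)
    have hg2 : Summable fun c : ℕ => ‖X S ^ (c + 1)‖ := by
      simp_rw [norm_pow]
      exact (summable_geometric_of_lt_one (norm_nonneg _) hXS).comp_injective
        (add_left_injective 1)
    have hn : Summable fun q : ℕ × {b : V → ℕ // levelSets b = z} =>
        ‖X S ^ (q.1 + 1) * levelWeight X q.2.1‖ := 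
      Summable.mul_norm (f := fun c : ℕ => X S ^ (c + 1))
        (g := fun b : {b : V → ℕ // levelSets b = z} => levelWeight X b.1) hg2 ih2
    constructor
    · rw [← e.hasSum_iff, ← Finset.mul_prod_erase y (fun S => X S / (1 - X S)) hSy]
      simp only [Function.comp_def, he]
      exact HasSum.mul (f := fun c : ℕ => X S ^ (c + 1))
        (g := fun b : {b : V → ℕ // levelSets b = z} => levelWeight X b.1) hg ih1 hn.of_norm
    · rw [← e.summable_iff]
      simpa only [Function.comp_def, he] using hn

/-- The sum over all functions `V → ℕ` of a level weight, with a coefficient depending only on the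
set of the level sets, is a finite sum over chains of nonempty subsets of `V`. -/
theorem hasSum_coeff_levelWeight (X : Finset V → 𝕜) (F : Finset (Finset V) → 𝕜)
    (hX : ∀ y, F y ≠ 0 → IsFlag y → ∀ S ∈ y, ‖X S‖ < 1)
    (hF : ∀ y, ¬ IsFlag y → F y = 0) :
    HasSum (fun a : V → ℕ => F (levelSets a) * levelWeight X a)
        (∑ y, F y * ∏ S ∈ y, X S / (1 - X S)) ∧
      Summable fun a : V → ℕ => ‖F (levelSets a) * levelWeight X a‖ := by
  have key : ∀ y, HasSum (({a : V → ℕ | levelSets a = y}).indicator fun a =>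
      F y * levelWeight X a) (F y * ∏ S ∈ y, X S / (1 - X S)) ∧
      Summable (({a : V → ℕ | levelSets a = y}).indicator fun a =>
        ‖F y * levelWeight X a‖) := by
    intro y
    by_cases h : F y = 0
    · simp only [h, zero_mul, norm_zero]
      simp
    · have hy : IsFlag y := by
        by_contra h'
        exact h (hF y h')
      obtain ⟨h1, h2⟩ := hasSum_levelWeight X y hy (hX y h hy)
      rw [← hasSum_subtype_iff_indicator, ← summable_subtype_iff_indicator]
      refine ⟨h1.mul_left (F y), ?_⟩
      simp only [Function.comp_def, norm_mul]
      exact h2.mul_left ‖F y‖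
  have e1 : (fun a : V → ℕ => F (levelSets a) * levelWeight X a) = fun a => ∑ y,
      ({a : V → ℕ | levelSets a = y}).indicator (fun a => F y * levelWeight X a) a := by
    funext a
    simp [Set.indicator_apply]
  have e2 : (fun a : V → ℕ => ‖F (levelSets a) * levelWeight X a‖) = fun a => ∑ y,
      ({a : V → ℕ | levelSets a = y}).indicator (fun a => ‖F y * levelWeight X a‖) a := by
    funext a
    simp [Set.indicator_apply]
  rw [e1, e2]
  exact ⟨hasSum_sum fun y _ => (key y).1, summable_sum fun y _ => (key y).2⟩

end LevelSets

/-! ### Counting subgroups of a given type -/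

section Subgroups

variable {G : Type*} [AddCommGroup G]

/-- The tuples `x` in `G` for which `y ↦ ∑ y_j x_j` defines an injective homomorphism from
`∏_j ℤ / p ^ μ_j` to `G`. -/
def indepTuples (p : ℕ) {n : ℕ} (mu : Fin n → ℕ) (G : Type*) [AddCommGroup G] : Set (Fin n → G) :=
  {x | (∀ j, p ^ mu j • x j = 0) ∧
    ∀ c : Fin n → ℤ, ∑ j, c j • x j = 0 → ∀ j, ((p ^ mu j : ℕ) : ℤ) ∣ c j}

/-- The order of the subgroup of the elements killed by `p ^ m`. -/
noncomputable def torsionCard (p m : ℕ) (G : Type*) [AddCommGroup G] : ℕ :=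
  Nat.card {a : G // p ^ m • a = 0}

/-- A tuple extended by `a` is independent if and only if the given tuple is and, for `m` the last
part, `a` is killed by `p ^ m` while `p ^ (m - 1) • a` lies outside the span of the tuple. -/
lemma snoc_mem_indepTuples {p : ℕ} (hp : p.Prime) {n : ℕ} {mu : Fin (n + 1) → ℕ}
    {x : Fin n → G} {a : G} :
    (Fin.snoc x a : Fin (n + 1) → G) ∈ indepTuples p mu G ↔
      x ∈ indepTuples p (fun j => mu j.castSucc) G ∧ p ^ mu (Fin.last n) • a = 0 ∧
        (mu (Fin.last n) ≠ 0 → ∀ c : Fin n → ℤ,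
          p ^ (mu (Fin.last n) - 1) • a ≠ ∑ j, c j • x j) := by
  simp only [indepTuples, Set.mem_ofPred_eq, Fin.forall_fin_succ', Fin.snoc_castSucc, Fin.snoc_last,
    Fin.sum_univ_castSucc]
  set m := mu (Fin.last n)
  constructor
  · rintro ⟨⟨h1, h2⟩, h3⟩
    refine ⟨⟨h1, fun c hc j => ?_⟩, h2, fun hm c hc => ?_⟩
    · simpa using (h3 (Fin.snoc c 0) (by simpa using hc)).1 j
    · have := (h3 (Fin.snoc (fun j => - c j) ((p ^ (m - 1) : ℕ) : ℤ)) (by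
        simp only [Fin.snoc_castSucc, Fin.snoc_last, neg_smul, Finset.sum_neg_distrib, ← hc,
          natCast_zsmul]
        exact neg_add_cancel _)).2
      simp only [Fin.snoc_last, Int.natCast_dvd_natCast] at this
      have h := (Nat.pow_dvd_pow_iff_le_right hp.one_lt).1 this
      omega
  · rintro ⟨⟨h1, h3⟩, h2, h4⟩
    refine ⟨⟨h1, h2⟩, fun c hc => ?_⟩
    set d := c (Fin.last n) with hd
    have hdvd : ((p ^ m : ℕ) : ℤ) ∣ d := by
      -- otherwise `p ^ (m - 1)` is a combination of `d` and `p ^ m`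
      by_contra hnd
      have hm : m ≠ 0 := by
        rintro hm
        simp [hm] at hnd
      obtain ⟨e, he, hge⟩ := (Nat.dvd_prime_pow hp).1
        (Int.natCast_dvd_natCast.1 (Int.gcd_dvd_right d ((p ^ m : ℕ) : ℤ)))
      have hem : e ≠ m := by
        rintro rfl
        exact hnd (hge ▸ Int.gcd_dvd_left d ((p ^ m : ℕ) : ℤ))
      obtain ⟨z, hz⟩ : ((p ^ e : ℕ) : ℤ) ∣ ((p ^ (m - 1) : ℕ) : ℤ) :=
        Int.natCast_dvd_natCast.2 (pow_dvd_pow p (by omega))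
      have hb := Int.gcd_eq_gcd_ab d ((p ^ m : ℕ) : ℤ)
      rw [hge] at hb
      refine h4 hm (fun j => -(z * Int.gcdA d ((p ^ m : ℕ) : ℤ)) * c j.castSucc) ?_
      have h5 : d • a = -∑ j : Fin n, c j.castSucc • x j := by
        rw [eq_neg_iff_add_eq_zero, add_comm]; exact hc
      have h6 : ((p ^ m : ℕ) : ℤ) • a = 0 := by rw [natCast_zsmul]; exact h2
      have h7 : ((p ^ (m - 1) : ℕ) : ℤ) • a = (z * Int.gcdA d ((p ^ m : ℕ) : ℤ)) • d • a +
          (z * Int.gcdB d ((p ^ m : ℕ) : ℤ)) • ((p ^ m : ℕ) : ℤ) • a := by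
        rw [hz, hb, ← mul_smul, ← mul_smul, ← add_smul]
        congr 1
        ring
      rw [← natCast_zsmul, h7, h6, h5, smul_zero, add_zero, smul_neg, Finset.smul_sum]
      simp only [mul_smul, neg_smul, Finset.sum_neg_distrib]
    obtain ⟨k, hk⟩ := hdvd
    have h6 : d • a = 0 := by rw [hk, mul_comm, mul_smul, natCast_zsmul, h2, smul_zero]
    exact ⟨h3 (fun j => c j.castSucc) (by rw [h6, add_zero] at hc; exact hc), ⟨k, hk⟩⟩

/-- Among the elements killed by `p ^ m`, those whose multiple by `p ^ (m - 1)` lies in the span of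
an independent tuple. -/
lemma card_dependent {p : ℕ} (hp : p.Prime) {n m : ℕ} (hm : m ≠ 0) {mu : Fin n → ℕ}
    (hmu : ∀ j, m ≤ mu j) {x : Fin n → G} (hx : x ∈ indepTuples p mu G) :
    Nat.card {a : G // p ^ m • a = 0 ∧ ∃ c : Fin n → ℤ, p ^ (m - 1) • a = ∑ j, c j • x j} =
      p ^ n * torsionCard p (m - 1) G := by
  have hpos : p ≠ 0 := hp.ne_zero
  have hx1 : ∀ j, (p : ℤ) ^ mu j • x j = 0 := fun j => by
    have := hx.1 j
    rw [← natCast_zsmul] at this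
    exact_mod_cast this
  have hfac : ∀ j, (p : ℤ) ^ (m - 1) * (p : ℤ) ^ (mu j - m) = (p : ℤ) ^ (mu j - 1) := fun j => by
    rw [← pow_add]
    congr 1
    have := hmu j
    omega
  have hfac' : ∀ j, (p : ℤ) * (p : ℤ) ^ (mu j - 1) = (p : ℤ) ^ mu j := fun j => by
    rw [← pow_succ']
    congr 1
    have := hmu j
    omega
  have hpm : (p : ℤ) * (p : ℤ) ^ (m - 1) = (p : ℤ) ^ m := by
    rw [← pow_succ']
    congr 1
    omega
  have hz : ∀ (k : ℕ) (a : G), p ^ k • a = ((p : ℤ) ^ k) • a := fun k a => by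
    rw [← natCast_zsmul]
    push_cast
    rfl
  let s : (Fin n → Fin p) → G := fun d => ∑ j, (((d j : ℕ) : ℤ) * (p : ℤ) ^ (mu j - m)) • x j
  have hs : ∀ d, (p : ℤ) ^ (m - 1) • s d = ∑ j, (((d j : ℕ) : ℤ) * (p : ℤ) ^ (mu j - 1)) • x j := by
    intro d
    rw [Finset.smul_sum]
    refine Finset.sum_congr rfl fun j _ => ?_
    rw [← mul_smul, ← hfac]
    ring_nf
  have hs' : ∀ d, (p : ℤ) ^ m • s d = 0 := by
    intro d
    rw [← hpm, mul_smul, hs, Finset.smul_sum]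
    refine Finset.sum_eq_zero fun j _ => ?_
    rw [← mul_smul, show (p : ℤ) * (((d j : ℕ) : ℤ) * (p : ℤ) ^ (mu j - 1)) =
      ((d j : ℕ) : ℤ) * ((p : ℤ) * (p : ℤ) ^ (mu j - 1)) by ring, hfac', mul_smul, hx1, smul_zero]
  let φ : (Fin n → Fin p) × {b : G // p ^ (m - 1) • b = 0} →
      {a : G // p ^ m • a = 0 ∧ ∃ c : Fin n → ℤ, p ^ (m - 1) • a = ∑ j, c j • x j} := fun q =>
    ⟨s q.1 + q.2.1, by
      have hb := q.2.2
      rw [hz] at hb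
      constructor
      · rw [hz, smul_add, hs', ← hpm, mul_smul, hb, smul_zero, add_zero]
      · exact ⟨_, by rw [hz, smul_add, hs, hb, add_zero]⟩⟩
  have hφ : Function.Bijective φ := by
    constructor
    · rintro ⟨d, b, hb⟩ ⟨d', b', hb'⟩ h
      have h1 : s d + b = s d' + b' := congrArg Subtype.val h
      have h2 := congrArg (fun a => (p : ℤ) ^ (m - 1) • a) h1
      rw [hz] at hb hb'
      simp only [smul_add, hs, hb, hb', add_zero] at h2
      rw [← sub_eq_zero, ← Finset.sum_sub_distrib] at h2
      simp only [← sub_smul, ← sub_mul] at h2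
      have h3 := hx.2 _ h2
      have hd : d = d' := by
        funext j
        have h4 := h3 j
        push_cast at h4
        rw [← hfac'] at h4
        have h5 := Int.dvd_of_mul_dvd_mul_right (pow_ne_zero _ (by exact_mod_cast hpos)) h4
        have h6 := (Nat.modEq_iff_dvd.2 h5).symm
        exact Fin.ext (by simpa [Nat.ModEq, Nat.mod_eq_of_lt (d j).2, Nat.mod_eq_of_lt (d' j).2]
          using h6)
      subst hd
      simpa using h1
    · rintro ⟨a, ha, c, hc⟩
      rw [hz] at ha hc
      have h1 : ∑ j, ((p : ℤ) * c j) • x j = 0 := by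
        simp only [mul_smul]
        rw [← Finset.smul_sum, ← hc, ← mul_smul, hpm, ha]
      have h2 : ∀ j, ∃ e : ℤ, c j = (p : ℤ) ^ (mu j - 1) * e := fun j => by
        have h3 := hx.2 _ h1 j
        push_cast at h3
        rw [← hfac'] at h3
        exact Int.dvd_of_mul_dvd_mul_left (by exact_mod_cast hpos) h3
      choose e he using h2
      have hlt : ∀ j, (e j % p).toNat < p := fun j => by
        have h1 := Int.emod_lt_of_pos (e j) (show (0 : ℤ) < p by exact_mod_cast hp.pos)
        have h2 := Int.emod_nonneg (e j) (show (p : ℤ) ≠ 0 by exact_mod_cast hpos)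
        omega
      let d : Fin n → Fin p := fun j => ⟨(e j % p).toNat, hlt j⟩
      have hdj : ∀ j, ((d j : ℕ) : ℤ) = e j % p := fun j =>
        Int.toNat_of_nonneg (Int.emod_nonneg (e j) (by exact_mod_cast hpos))
      refine ⟨⟨d, a - s d, ?_⟩, Subtype.ext (by simp [φ])⟩
      rw [hz, smul_sub, hs, hc, ← Finset.sum_sub_distrib]
      refine Finset.sum_eq_zero fun j _ => ?_
      rw [← sub_smul, he, hdj, show (p : ℤ) ^ (mu j - 1) * e j - e j % p * (p : ℤ) ^ (mu j - 1) =
        (e j / p) * (p * (p : ℤ) ^ (mu j - 1)) by rw [Int.emod_def]; ring, hfac', mul_smul, hx1,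
        smul_zero]
  rw [← Nat.card_congr (Equiv.ofBijective φ hφ), Nat.card_prod, torsionCard]
  simp

/-- The number of ways of extending an independent tuple by a generator of order `p ^ m` for the
last, smallest, part `m`. -/
lemma card_extensions [Finite G] {p : ℕ} (hp : p.Prime) {n : ℕ} {mu : Fin (n + 1) → ℕ}
    (hmu : Antitone mu) {x : Fin n → G} (hx : x ∈ indepTuples p (fun j => mu j.castSucc) G) :
    (Nat.card {a : G // (Fin.snoc x a : Fin (n + 1) → G) ∈ indepTuples p mu G} : ℤ) =
      if mu (Fin.last n) = 0 then 1 else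
        (torsionCard p (mu (Fin.last n)) G : ℤ) -
          (p : ℤ) ^ n * torsionCard p (mu (Fin.last n) - 1) G := by
  classical
  simp only [snoc_mem_indepTuples hp, hx, true_and]
  set m := mu (Fin.last n) with hm
  split_ifs with h0
  · simp [h0]
  · have hd := card_dependent hp h0 (fun j => hmu (Fin.le_last j.castSucc)) hx
    have key : torsionCard p m G = Nat.card {a : G // p ^ m • a = 0 ∧ ∃ c : Fin n → ℤ,
        p ^ (m - 1) • a = ∑ j, c j • x j} + Nat.card {a : G // p ^ m • a = 0 ∧
          (m ≠ 0 → ∀ c : Fin n → ℤ, p ^ (m - 1) • a ≠ ∑ j, c j • x j)} := by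
      have := Fintype.ofFinite G
      simp only [torsionCard, Nat.card_eq_fintype_card, Fintype.card_subtype]
      rw [← Finset.card_filter_add_card_filter_not
        (p := fun a => ∃ c : Fin n → ℤ, p ^ (m - 1) • a = ∑ j, c j • x j), Finset.filter_filter,
        Finset.filter_filter]
      simp [h0]
    rw [key, hd]
    push_cast
    ring

/-- The number of independent tuples of type `μ`: the generators are chosen by descending order, and
the multiple by `p ^ (μ_j - 1)` of the `j`-th one has to avoid the span of the previous ones. -/
theorem card_indepTuples [Finite G] {p : ℕ} (hp : p.Prime) {n : ℕ} {mu : Fin n → ℕ}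
    (hmu : Antitone mu) :
    (Nat.card (indepTuples p mu G) : ℤ) = ∏ j, if mu j = 0 then 1 else
      (torsionCard p (mu j) G : ℤ) - (p : ℤ) ^ (j : ℕ) * torsionCard p (mu j - 1) G := by
  induction n with
  | zero =>
    have : indepTuples p mu G = Set.univ := by
      ext x
      simp [indepTuples]
    simp [this]
  | succ n ih =>
    let mu' : Fin n → ℕ := fun j => mu j.castSucc
    have hmu' : Antitone mu' := fun i j h => hmu (Fin.castSucc_le_castSucc_iff.2 h)
    let e : indepTuples p mu G ≃ Σ x : indepTuples p mu' G,
        {a : G // (Fin.snoc x.1 a : Fin (n + 1) → G) ∈ indepTuples p mu G} :=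
      { toFun := fun y => ⟨⟨Fin.init y.1, by
          have h := y.2
          rw [← Fin.snoc_init_self y.1, snoc_mem_indepTuples hp] at h
          exact h.1⟩, ⟨y.1 (Fin.last n), by rw [Fin.snoc_init_self]; exact y.2⟩⟩
        invFun := fun q => ⟨Fin.snoc q.1.1 q.2.1, q.2.2⟩
        left_inv := fun y => Subtype.ext (Fin.snoc_init_self y.1)
        right_inv := by
          rintro ⟨⟨x, hx⟩, ⟨a, ha⟩⟩
          simp only [Fin.snoc_last, Sigma.mk.injEq, Fin.init_snoc, true_and]
          congr!
          simp }
    have := Fintype.ofFinite (indepTuples p mu' G)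
    rw [Nat.card_congr e, Nat.card_sigma]
    push_cast
    rw [Finset.sum_congr rfl fun x _ => card_extensions hp hmu x.2, Finset.sum_const,
      Finset.card_univ, ← Nat.card_eq_fintype_card, nsmul_eq_mul, ih hmu', Fin.prod_univ_castSucc]
    rfl

/-- A homomorphism from `∏_j ℤ / p ^ μ_j` is given by the images of the standard generators. -/
lemma card_injective_hom_eq (p : ℕ) {n : ℕ} (mu : Fin n → ℕ) :
    Nat.card {φ : (∀ j, ZMod (p ^ mu j)) →+ G // Function.Injective φ} =
      Nat.card (indepTuples p mu G) := by
  have hval : ∀ (φ : (∀ j, ZMod (p ^ mu j)) →+ G) (c : Fin n → ℤ),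
      φ (fun j => (c j : ZMod (p ^ mu j))) = ∑ j, c j • φ (Pi.single j 1) := by
    intro φ c
    rw [← Finset.univ_sum_single (fun j => (c j : ZMod (p ^ mu j))), map_sum]
    refine Finset.sum_congr rfl fun j _ => ?_
    rw [← map_zsmul, ← Pi.single_smul]
    simp
  have hsurj : ∀ y : ∀ j, ZMod (p ^ mu j), ∃ c : Fin n → ℤ, (fun j => (c j : ZMod (p ^ mu j))) = y :=
    fun y => ⟨fun j => (ZMod.intCast_surjective (y j)).choose,
      funext fun j => (ZMod.intCast_surjective (y j)).choose_spec⟩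
  have hkill : ∀ (φ : (∀ j, ZMod (p ^ mu j)) →+ G) j, p ^ mu j • φ (Pi.single j 1) = 0 := by
    intro φ j
    rw [← map_nsmul, ← Pi.single_smul]
    simp [nsmul_eq_mul, -Nat.cast_pow]
  refine Nat.card_congr (Equiv.ofBijective (fun φ => ⟨fun j => φ.1 (Pi.single j 1), hkill φ.1, ?_⟩)
    ⟨?_, ?_⟩)
  · intro c hc j
    rw [← hval, ← map_zero φ.1] at hc
    have := congrFun (φ.2 hc) j
    exact (ZMod.intCast_zmod_eq_zero_iff_dvd (c j) (p ^ mu j)).1 this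
  · intro φ ψ h
    refine Subtype.ext (AddMonoidHom.ext fun y => ?_)
    obtain ⟨c, rfl⟩ := hsurj y
    rw [hval, hval]
    refine Finset.sum_congr rfl fun j _ => ?_
    have hj : φ.1 (Pi.single j 1) = ψ.1 (Pi.single j 1) := congrFun (Subtype.ext_iff.1 h) j
    rw [hj]
  · rintro ⟨x, hx1, hx2⟩
    let φ : (∀ j, ZMod (p ^ mu j)) →+ G := ∑ j, (ZMod.lift (p ^ mu j)
      ⟨(zmultiplesHom G (x j)), by rw [zmultiplesHom_apply, natCast_zsmul]; exact hx1 j⟩).comp (Pi.evalAddMonoidHom _ j)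
    have hφ : ∀ c : Fin n → ℤ, φ (fun j => (c j : ZMod (p ^ mu j))) = ∑ j, c j • x j := by
      intro c
      simp only [φ, AddMonoidHom.finsetSum_apply, AddMonoidHom.comp_apply,
        Pi.evalAddMonoidHom_apply, ZMod.lift_coe]
      rfl
    refine ⟨⟨φ, ?_⟩, ?_⟩
    · rw [injective_iff_map_eq_zero]
      intro y hy
      obtain ⟨c, rfl⟩ := hsurj y
      rw [hφ] at hy
      funext j
      exact (ZMod.intCast_zmod_eq_zero_iff_dvd (c j) (p ^ mu j)).2 (hx2 c hy j)
    · refine Subtype.ext (funext fun j => ?_)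
      have := hφ (Pi.single j 1)
      have h2 : (fun i => ((Pi.single j 1 : Fin n → ℤ) i : ZMod (p ^ mu i))) =
          Pi.single j (1 : ZMod (p ^ mu j)) := by
        funext i
        by_cases h : i = j
        · subst h; simp
        · simp [h]
      rw [h2] at this
      simp only [this]
      rw [Finset.sum_eq_single j (fun b _ hb => by simp [hb]) (by simp)]
      simp

/-- Injective homomorphisms `A → G` amount to a subgroup of `G` isomorphic to `A`, together with an
automorphism of `A`. -/
lemma card_injective_hom_eq_mul [Finite G] (A : Type*) [AddCommGroup A] [Finite A] :
    Nat.card {φ : A →+ G // Function.Injective φ} =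
      Nat.card {H : AddSubgroup G // Nonempty (H ≃+ A)} *
        Nat.card {φ : A →+ A // Function.Injective φ} := by
  let ε : ∀ H : {H : AddSubgroup G // Nonempty (H ≃+ A)}, H.1 ≃+ A := fun H => H.2.some
  rw [← Nat.card_prod]
  refine (Nat.card_congr (Equiv.ofBijective (fun q : {H : AddSubgroup G // Nonempty (H ≃+ A)} ×
    {φ : A →+ A // Function.Injective φ} => (⟨(q.1.1.subtype.comp (ε q.1).symm.toAddMonoidHom).comp
      q.2.1, Subtype.val_injective.comp ((ε q.1).symm.injective.comp q.2.2)⟩ :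
        {φ : A →+ G // Function.Injective φ})) ⟨?_, ?_⟩)).symm
  · rintro ⟨H, φ, hφ⟩ ⟨H', φ', hφ'⟩ h
    have h1 : ∀ a, ((ε H).symm (φ a) : G) = (ε H').symm (φ' a) := fun a =>
      DFunLike.congr_fun (Subtype.ext_iff.1 h) a
    have hle : ∀ (H H' : {H : AddSubgroup G // Nonempty (H ≃+ A)}) (φ φ' : A →+ A),
        Function.Injective φ → (∀ a, ((ε H).symm (φ a) : G) = (ε H').symm (φ' a)) →
        H.1 ≤ H'.1 := by
      intro H H' φ φ' hφ h z hz
      obtain ⟨a, ha⟩ := (Finite.injective_iff_surjective.1 hφ) (ε H ⟨z, hz⟩)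
      have := h a
      rw [ha, AddEquiv.symm_apply_apply] at this
      simp only at this
      rw [this]
      exact Subtype.mem _
    have hH : H = H' := Subtype.ext (le_antisymm (hle H H' φ φ' hφ h1)
      (hle H' H φ' φ hφ' fun a => (h1 a).symm))
    subst hH
    refine Prod.ext rfl (Subtype.ext (AddMonoidHom.ext fun a => ?_))
    exact (ε H).symm.injective (Subtype.val_injective (h1 a))
  · rintro ⟨φ, hφ⟩
    let δ : φ.range ≃+ A := (AddMonoidHom.ofInjective hφ).symm
    let H : {H : AddSubgroup G // Nonempty (H ≃+ A)} := ⟨φ.range, ⟨δ⟩⟩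
    refine ⟨⟨H, (ε H).toAddMonoidHom.comp δ.symm.toAddMonoidHom,
      (ε H).injective.comp δ.symm.injective⟩, Subtype.ext (AddMonoidHom.ext fun a => ?_)⟩
    simp only [H, δ, AddMonoidHom.comp_apply, AddEquiv.coe_toAddMonoidHom,
      AddEquiv.symm_apply_apply, AddEquiv.symm_symm]
    rfl

lemma torsionCard_pi (p : ℕ) [Fact p.Prime] {n : ℕ} (lam : Fin n → ℕ) (m : ℕ) :
    torsionCard p m (∀ j, ZMod (p ^ lam j)) = p ^ ∑ i, min (lam i) m := by
  have hp : p.Prime := Fact.out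
  have h1 : ∀ l : ℕ, Nat.card {a : ZMod (p ^ l) // p ^ m • a = 0} = p ^ min l m := by
    intro l
    have h := IsAddCyclic.card_nsmulAddMonoidHom_ker (G := ZMod (p ^ l)) (p ^ m)
    rw [Nat.card_zmod] at h
    refine Eq.trans (Nat.card_congr (Equiv.refl _)) (h.trans ?_)
    rcases le_total l m with hlm | hlm
    · rw [min_eq_left hlm, Nat.gcd_eq_left (pow_dvd_pow p hlm)]
    · rw [min_eq_right hlm, Nat.gcd_eq_right (pow_dvd_pow p hlm)]
  have e : {a : ∀ j, ZMod (p ^ lam j) // p ^ m • a = 0} ≃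
      ∀ j, {a : ZMod (p ^ lam j) // p ^ m • a = 0} :=
    { toFun := fun a j => ⟨a.1 j, congrFun a.2 j⟩
      invFun := fun a => ⟨fun j => (a j).1, funext fun j => (a j).2⟩
      left_inv := fun a => rfl
      right_inv := fun a => rfl }
  rw [torsionCard, Nat.card_congr e, Nat.card_pi, Finset.prod_congr rfl fun j _ => h1 (lam j),
    Finset.prod_pow_eq_pow_sum]

end Subgroups

section Formula

variable {n : ℕ}

lemma lt_card_levelSet_iff {a : Fin n → ℕ} (ha : Antitone a) {j : Fin n} {c : ℕ} :
    (j : ℕ) < (levelSet a c).card ↔ c ≤ a j :=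
  Tuple.lt_card_ge_iff_apply_ge_of_antitone ha

lemma sum_min_succ (a : Fin n → ℕ) (c : ℕ) :
    ∑ i, min (a i) (c + 1) = ∑ i, min (a i) c + (levelSet a (c + 1)).card := by
  rw [levelSet, Finset.card_filter, ← Finset.sum_add_distrib]
  refine Finset.sum_congr rfl fun i _ => ?_
  split_ifs <;> omega

lemma card_indepTuples_pi (p : ℕ) [Fact p.Prime] {lam mu : Fin n → ℕ} (hmu : Antitone mu) :
    (Nat.card (indepTuples p mu (∀ j, ZMod (p ^ lam j))) : ℤ) = ∏ j, if mu j = 0 then 1 else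
      (p : ℤ) ^ (∑ i, min (lam i) (mu j)) -
        (p : ℤ) ^ (j : ℕ) * (p : ℤ) ^ (∑ i, min (lam i) (mu j - 1)) := by
  have hp : p.Prime := Fact.out
  have : ∀ j, NeZero (p ^ lam j) := fun j => ⟨pow_ne_zero _ hp.ne_zero⟩
  rw [card_indepTuples hp hmu]
  refine Finset.prod_congr rfl fun j _ => ?_
  rw [torsionCard_pi, torsionCard_pi]
  push_cast
  rfl

lemma alpha_mul_card (p : ℕ) [Fact p.Prime] (lam mu : Fin n → ℕ) :
    Nat.card (indepTuples p mu (∀ j, ZMod (p ^ lam j))) =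
      alpha p lam mu * Nat.card (indepTuples p mu (∀ j, ZMod (p ^ mu j))) := by
  have hp : p.Prime := Fact.out
  have h1 : ∀ j, NeZero (p ^ lam j) := fun j => ⟨pow_ne_zero _ hp.ne_zero⟩
  have h2 : ∀ j, NeZero (p ^ mu j) := fun j => ⟨pow_ne_zero _ hp.ne_zero⟩
  rw [← card_injective_hom_eq p, ← card_injective_hom_eq p, card_injective_hom_eq_mul, alpha]

/-- A subgroup of a group of type `λ` has a type contained in `λ`. -/
lemma le_of_alpha_ne_zero (p : ℕ) [Fact p.Prime] {lam mu : Fin n → ℕ} (hlam : Antitone lam)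
    (hmu : Antitone mu) (h : alpha p lam mu ≠ 0) : mu ≤ lam := by
  by_contra hle
  have hp : p.Prime := Fact.out
  have h2 : ∀ j, NeZero (p ^ mu j) := fun j => ⟨pow_ne_zero _ hp.ne_zero⟩
  -- at the first index violating the inequality, no generator can be chosen
  have hex : ∃ j : Fin n, lam j < mu j := by
    by_contra h'
    exact hle fun j => not_lt.1 fun hj => h' ⟨j, hj⟩
  obtain ⟨j, hj, hmin⟩ : ∃ j : Fin n, lam j < mu j ∧ ∀ i < j, mu i ≤ lam i := by
    classical
    refine ⟨Fin.find _ hex, Fin.find_spec hex, fun i hi => not_lt.1 (Fin.find_min hex hi)⟩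
  have hcard : (levelSet lam (mu j)).card = j := by
    refine le_antisymm ?_ ?_
    · by_contra h'
      have := (lt_card_levelSet_iff hlam (j := j) (c := mu j)).1 (by omega)
      omega
    · by_contra h'
      have hlt : (levelSet lam (mu j)).card < n := by omega
      set i : Fin n := ⟨(levelSet lam (mu j)).card, hlt⟩ with hi
      have hij : i < j := Fin.lt_def.2 (show (levelSet lam (mu j)).card < (j : ℕ) by omega)
      have h3 := (lt_card_levelSet_iff hlam (j := i) (c := mu j)).2
        ((hmu hij.le).trans (hmin i hij))
      simp [hi] at h3
  have hzero : Nat.card (indepTuples p mu (∀ j, ZMod (p ^ lam j))) = 0 := by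
    have h4 := card_indepTuples_pi p (lam := lam) hmu
    rw [Finset.prod_eq_zero (Finset.mem_univ j)] at h4
    · exact_mod_cast h4
    · rw [if_neg (by omega)]
      obtain ⟨c, hc⟩ : ∃ c, mu j = c + 1 := ⟨mu j - 1, by omega⟩
      rw [hc] at hcard ⊢
      rw [sum_min_succ, hcard, pow_add]
      simp only [Nat.add_sub_cancel]
      ring
  rw [alpha_mul_card, mul_eq_zero] at hzero
  refine hzero.elim h fun h5 => ?_
  rw [← card_injective_hom_eq p, Nat.card_eq_zero] at h5
  rcases h5 with h5 | h5
  · exact h5.false ⟨AddMonoidHom.id _, Function.injective_id⟩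
  · have : Finite ((∀ j, ZMod (p ^ mu j)) →+ ∀ j, ZMod (p ^ mu j)) :=
      DFunLike.finite _
    exact h5.not_finite inferInstance

/-- The number of independent tuples in a group of type `λ`. The factors `1 - p^{-(n - j)}` with
`μ_j = 0` cancel those on the right-hand side, where the level set of `0` has `n` elements. -/
lemma card_indepTuples_pi_mul (p : ℕ) [Fact p.Prime] {lam mu : Fin n → ℕ} (hlam : Antitone lam)
    (hmu : Antitone mu) (hle : mu ≤ lam) :
    (Nat.card (indepTuples p mu (∀ j, ZMod (p ^ lam j))) : ℂ) *
        ∏ j : Fin n, (if mu j = 0 then 1 - (p : ℂ)⁻¹ ^ (n - j : ℕ) else 1) =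
      (p : ℂ) ^ (∑ j, ∑ i, min (lam i) (mu j)) *
        ∏ j : Fin n, (1 - (p : ℂ)⁻¹ ^ ((levelSet lam (mu j)).card - j)) := by
  have hp : p.Prime := Fact.out
  have hp0 : (p : ℂ) ≠ 0 := by exact_mod_cast hp.ne_zero
  have h : (Nat.card (indepTuples p mu (∀ j, ZMod (p ^ lam j))) : ℂ) = _ :=
    (Int.cast_natCast _).symm.trans (congrArg _ (card_indepTuples_pi p (lam := lam) hmu))
  rw [h, ← Finset.prod_pow_eq_pow_sum, ← Finset.prod_mul_distrib]
  push_cast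
  rw [← Finset.prod_mul_distrib]
  refine Finset.prod_congr rfl fun j _ => ?_
  by_cases h0 : mu j = 0
  · simp [h0, levelSet]
  · rw [if_neg h0, if_neg h0, mul_one]
    have hj : (j : ℕ) < (levelSet lam (mu j)).card := (lt_card_levelSet_iff hlam).2 (hle j)
    obtain ⟨c, hc⟩ : ∃ c, mu j = c + 1 := ⟨mu j - 1, by omega⟩
    rw [hc] at hj ⊢
    obtain ⟨d, hd⟩ := Nat.exists_eq_add_of_lt hj
    rw [sum_min_succ, hd, Nat.add_sub_cancel, show (j : ℕ) + d + 1 - j = d + 1 by omega, inv_pow]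
    field_simp
    ring

/-- The number of subgroups of type `μ` in a group of type `λ`. The number of `i` with `λ_i ≥ μ_j` is
the part of index `μ_j` of the partition conjugate to `λ`. -/
theorem alpha_mul_eq (p : ℕ) [Fact p.Prime] {lam mu : Fin n → ℕ} (hlam : Antitone lam)
    (hmu : Antitone mu) (hle : mu ≤ lam) :
    (alpha p lam mu : ℂ) * ((p : ℂ) ^ (∑ j, ∑ i, min (mu i) (mu j)) *
        ∏ j : Fin n, (1 - (p : ℂ)⁻¹ ^ ((levelSet mu (mu j)).card - j))) =
      (p : ℂ) ^ (∑ j, ∑ i, min (lam i) (mu j)) *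
        ∏ j : Fin n, (1 - (p : ℂ)⁻¹ ^ ((levelSet lam (mu j)).card - j)) := by
  rw [← card_indepTuples_pi_mul p hlam hmu hle, ← card_indepTuples_pi_mul p hmu hmu le_rfl,
    alpha_mul_card p lam mu]
  push_cast
  ring

end Formula

/-! ### Runs of Dyck words -/

section Words

open DyckStep

/-- The maximal runs of equal letters of a Dyck word. -/
def runs (w : DyckWord) : List (List DyckStep) := w.toList.splitBy fun a b => decide (a = b)

lemma runLengths_eq (w : DyckWord) : runLengths w = (runs w).map List.length := rfl

lemma flatten_runs (w : DyckWord) : (runs w).flatten = w.toList := List.flatten_splitBy _ _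

lemma eq_replicate_head {l : List DyckStep} (hl : l ≠ [])
    (h : l.IsChain fun x y => decide (x = y) = true) : l = List.replicate l.length (l.head hl) := by
  induction l with
  | nil => exact absurd rfl hl
  | cons a l ih =>
    cases l with
    | nil => rfl
    | cons b l =>
      rw [List.isChain_cons_cons] at h
      have hab : a = b := by simpa using h.1
      subst hab
      have h2 := ih (by simp) h.2
      rw [List.length_cons, List.replicate_succ, List.head_cons]
      rw [List.head_cons] at h2
      rw [← h2]

/-- The runs consist alternately of letters `U` and `D`, beginning with `U`. -/
lemma runs_getElem (w : DyckWord) : ∀ (i : ℕ) (h : i < (runs w).length),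
    (runs w)[i] = List.replicate ((runs w)[i].length) (if Even i then U else D) := by
  have hne : ∀ (i : ℕ) (h : i < (runs w).length), (runs w)[i] ≠ [] := fun i h =>
    List.ne_nil_of_mem_splitBy (List.getElem_mem h)
  have hrep : ∀ (i : ℕ) (h : i < (runs w).length),
      (runs w)[i] = List.replicate ((runs w)[i].length) ((runs w)[i].head (hne i h)) := fun i h =>
    eq_replicate_head _ (List.isChain_of_mem_splitBy (List.getElem_mem h))
  have hhead : ∀ (i : ℕ) (h : i < (runs w).length),
      (runs w)[i].head (hne i h) = if Even i then U else D := by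
    intro i
    induction i with
    | zero =>
      intro h
      have hw : w.toList ≠ [] := fun h' => by simp [runs, h'] at h
      have h1 : ((runs w).head (List.splitBy_ne_nil.2 hw)).head
          (List.ne_nil_of_mem_splitBy (List.head_mem _)) = U :=
        (List.head_head_splitBy (fun a b => decide (a = b)) hw).trans (w.head_eq_U hw)
      have h2 : (runs w)[0] = (runs w).head (List.splitBy_ne_nil.2 hw) :=
        (List.head_eq_getElem _).symm
      simpa only [h2, Even.zero, if_true] using h1
    | succ i ih =>
      intro h
      obtain ⟨ha, hb, h1⟩ : ∃ (ha : (runs w)[i] ≠ []) (hb : (runs w)[i + 1] ≠ []),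
          decide ((runs w)[i].getLast ha = (runs w)[i + 1].head hb) = false := List.isChain_iff_getElem.1
        (List.isChain_getLast_head_splitBy (fun a b => decide (a = b)) w.toList) i h
      have h2 : (runs w)[i].getLast ha = (runs w)[i].head ha := by
        have hm : ∀ x ∈ (runs w)[i], x = (runs w)[i].head ha := fun x hx => by
          rw [hrep i (by omega), List.mem_replicate] at hx
          exact hx.2
        exact hm _ (List.getLast_mem ha)
      have h3 := ih (by omega)
      have h4 : (runs w)[i].head ha ≠ (runs w)[i + 1].head hb := by
        rw [← h2]
        exact of_decide_eq_false h1
      rw [h3] at h4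
      simp only [Nat.even_add_one]
      generalize (runs w)[i + 1].head hb = z at h4 ⊢
      by_cases he : Even i <;> cases z <;> simp [he] at h4 ⊢
  intro i h
  conv_lhs => rw [hrep i h, hhead i h]

lemma runLengths_getD_pos (w : DyckWord) {i : ℕ} (h : i < (runs w).length) :
    0 < (runLengths w).getD i 0 := by
  have h' : i < (runLengths w).length := by simpa [runLengths_eq] using h
  rw [List.getD_eq_getElem _ _ h']
  simp only [runLengths_eq, List.getElem_map]
  exact List.length_pos_iff.2 (List.ne_nil_of_mem_splitBy (List.getElem_mem h))

lemma runs_getElem' (w : DyckWord) {i : ℕ} (h : i < (runs w).length) :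
    (runs w)[i] = List.replicate ((runLengths w).getD i 0) (if Even i then U else D) := by
  have h' : i < (runLengths w).length := by simpa [runLengths_eq] using h
  rw [runs_getElem w i h, List.getD_eq_getElem _ _ h']
  simp [runLengths_eq]

lemma take_runs_succ (w : DyckWord) {k : ℕ} (h : 2 * k + 1 < (runs w).length) :
    ((runs w).take (2 * (k + 1))).flatten = ((runs w).take (2 * k)).flatten ++
      (List.replicate ((runLengths w).getD (2 * k) 0) U ++
        List.replicate ((runLengths w).getD (2 * k + 1) 0) D) := by
  rw [show 2 * (k + 1) = 2 * k + 1 + 1 by ring, List.take_succ_eq_append_getElem h,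
    List.take_succ_eq_append_getElem (by omega), runs_getElem' w h, runs_getElem' w (by omega)]
  simp

lemma dyckL_succ (w : DyckWord) (k : ℕ) :
    dyckL w (k + 1) = dyckL w k + (runLengths w).getD (2 * k) 0 := Finset.sum_range_succ _ _

lemma dyckM_succ (w : DyckWord) (k : ℕ) :
    dyckM w (k + 1) = dyckM w k + (runLengths w).getD (2 * k + 1) 0 := Finset.sum_range_succ _ _

lemma count_take_runs (w : DyckWord) {k : ℕ} (h : 2 * k ≤ (runs w).length) :
    ((runs w).take (2 * k)).flatten.count U = dyckL w k ∧
      ((runs w).take (2 * k)).flatten.count D = dyckM w k := by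
  induction k with
  | zero => simp [dyckL, dyckM]
  | succ k ih =>
    obtain ⟨h1, h2⟩ := ih (by omega)
    rw [take_runs_succ w (by omega), dyckL_succ, dyckM_succ]
    simp [List.count_append, h1, h2, List.count_replicate]

lemma dyckM_le_dyckL_aux (w : DyckWord) {k : ℕ} (h : 2 * k ≤ (runs w).length) :
    dyckM w k ≤ dyckL w k := by
  obtain ⟨h1, h2⟩ := count_take_runs w h
  rw [← h1, ← h2]
  have h3 : w.toList.take ((runs w).take (2 * k)).flatten.length =
      ((runs w).take (2 * k)).flatten := by
    conv_lhs => rw [← flatten_runs w, ← List.take_append_drop (2 * k) (runs w), List.flatten_append]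
    rw [List.take_append_drop, List.take_left]
  have := w.count_D_le_count_U ((runs w).take (2 * k)).flatten.length
  rwa [h3] at this

/-- The number of runs is even, as a Dyck word begins with `U` and ends with `D`. -/
lemma length_runs (w : DyckWord) : (runs w).length = 2 * numRuns w := by
  have h0 : numRuns w = (runs w).length / 2 := by simp [numRuns, runLengths_eq]
  rcases Nat.even_or_odd' (runs w).length with ⟨c, hc | hc⟩
  · omega
  · exfalso
    have h1 : w.toList = ((runs w).take (2 * c)).flatten ++
        List.replicate ((runLengths w).getD (2 * c) 0) U := by
      conv_lhs => rw [← flatten_runs w, ← List.take_length (l := runs w), hc,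
        List.take_succ_eq_append_getElem (by omega), runs_getElem' w (by omega)]
      simp
    obtain ⟨h2, h3⟩ := count_take_runs w (k := c) (by omega)
    have h4 := w.count_U_eq_count_D
    rw [h1] at h4
    have h7 : ∀ m, (List.replicate m U).count D = 0 := fun m => by simp [List.count_replicate]
    rw [List.count_append, List.count_append, h2, h3, List.count_replicate_self, h7] at h4
    have h5 := runLengths_getD_pos w (i := 2 * c) (by omega)
    have h6 := dyckM_le_dyckL_aux w (k := c) (by omega)
    omega

lemma dyckM_le_dyckL (w : DyckWord) {k : ℕ} (h : k ≤ numRuns w) : dyckM w k ≤ dyckL w k :=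
  dyckM_le_dyckL_aux w (by rw [length_runs]; omega)

lemma dyckL_lt_succ (w : DyckWord) {k : ℕ} (h : k < numRuns w) : dyckL w k < dyckL w (k + 1) := by
  have := runLengths_getD_pos w (i := 2 * k) (by rw [length_runs]; omega)
  rw [dyckL_succ]
  omega

lemma dyckM_lt_succ (w : DyckWord) {k : ℕ} (h : k < numRuns w) : dyckM w k < dyckM w (k + 1) := by
  have := runLengths_getD_pos w (i := 2 * k + 1) (by rw [length_runs]; omega)
  rw [dyckM_succ]
  omega

@[simp] lemma dyckL_zero (w : DyckWord) : dyckL w 0 = 0 := rfl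

@[simp] lemma dyckM_zero (w : DyckWord) : dyckM w 0 = 0 := rfl

lemma dyckL_mono (w : DyckWord) : Monotone (dyckL w) :=
  monotone_nat_of_le_succ fun k => by rw [dyckL_succ]; omega

lemma dyckM_mono (w : DyckWord) : Monotone (dyckM w) :=
  monotone_nat_of_le_succ fun k => by rw [dyckM_succ]; omega

lemma dyckL_numRuns (w : DyckWord) : dyckL w (numRuns w) = w.semilength := by
  have := (count_take_runs w (k := numRuns w) (by rw [length_runs])).1
  rw [← this, ← length_runs, List.take_length, flatten_runs]
  rfl

lemma dyckM_numRuns (w : DyckWord) : dyckM w (numRuns w) = w.semilength := by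
  have := (count_take_runs w (k := numRuns w) (by rw [length_runs])).2
  rw [← this, ← length_runs, List.take_length, flatten_runs, w.semilength_eq_count_D]

lemma numRuns_pos {w : DyckWord} (h : 0 < w.semilength) : 0 < numRuns w := by
  by_contra h'
  have := dyckL_numRuns w
  rw [show numRuns w = 0 by omega, dyckL_zero] at this
  omega

/-- A Dyck word is determined by its numbers `L_i` and `M_i`. -/
lemma dyckWord_ext {w w' : DyckWord} (hr : numRuns w = numRuns w')
    (hL : ∀ k ≤ numRuns w, dyckL w k = dyckL w' k)
    (hM : ∀ k ≤ numRuns w, dyckM w k = dyckM w' k) : w = w' := by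
  have key : ∀ k ≤ numRuns w,
      ((runs w).take (2 * k)).flatten = ((runs w').take (2 * k)).flatten := by
    intro k hk
    induction k with
    | zero => simp
    | succ k ih =>
      rw [take_runs_succ w (by rw [length_runs]; omega),
        take_runs_succ w' (by rw [length_runs]; omega), ih (by omega)]
      have h1 := hL k (by omega)
      have h2 := hL (k + 1) hk
      have h3 := hM k (by omega)
      have h4 := hM (k + 1) hk
      rw [dyckL_succ, dyckL_succ, h1] at h2
      rw [dyckM_succ, dyckM_succ, h3] at h4
      rw [Nat.add_left_cancel h2, Nat.add_left_cancel h4]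
  have h := key (numRuns w) le_rfl
  rw [← length_runs, List.take_length, length_runs, hr, ← length_runs, List.take_length,
    flatten_runs, flatten_runs] at h
  exact DyckWord.ext h

lemma length_eq_count_add_count (l : List DyckStep) : l.length = l.count U + l.count D := by
  induction l with
  | nil => rfl
  | cons a l ih => cases a <;> simp [ih] <;> omega

/-- The `(k + 1)`-st run of ones occupies the places `L_{k+1} + j`, `M_k ≤ j < M_{k+1}`. -/
lemma toList_getElem_D (w : DyckWord) {k j : ℕ} (hk : k < numRuns w) (hj : dyckM w k ≤ j)
    (hj' : j < dyckM w (k + 1)) :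
    w.toList[dyckL w (k + 1) + j]? = some D ∧
      (w.toList.take (dyckL w (k + 1) + j)).count U = dyckL w (k + 1) ∧
      (w.toList.take (dyckL w (k + 1) + j)).count D = j := by
  obtain ⟨h1, h2⟩ := count_take_runs w (k := k) (by rw [length_runs]; omega)
  have hsplit : w.toList = ((runs w).take (2 * (k + 1))).flatten ++
      ((runs w).drop (2 * (k + 1))).flatten := by
    rw [← List.flatten_append, List.take_append_drop, flatten_runs]
  rw [take_runs_succ w (by rw [length_runs]; omega)] at hsplit
  set X := ((runs w).take (2 * k)).flatten with hX
  set Y := ((runs w).drop (2 * (k + 1))).flatten with hY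
  rw [dyckL_succ, dyckM_succ] at *
  set a := (runLengths w).getD (2 * k) 0
  set b := (runLengths w).getD (2 * k + 1) 0
  obtain ⟨i, rfl⟩ := Nat.exists_eq_add_of_le hj
  have hlen : X.length = dyckL w k + dyckM w k := by rw [length_eq_count_add_count, h1, h2]
  have hsplit' : w.toList = (X ++ List.replicate a U ++ List.replicate i D) ++
      (D :: (List.replicate (b - i - 1) D ++ Y)) := by
    rw [hsplit, show List.replicate b D = List.replicate i D ++ D :: List.replicate (b - i - 1) D by
      rw [← List.replicate_succ, List.replicate_append_replicate]
      congr 1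
      omega]
    simp
  have hl : (X ++ List.replicate a U ++ List.replicate i D).length =
      dyckL w k + a + (dyckM w k + i) := by
    simp only [List.length_append, List.length_replicate, hlen]
    omega
  rw [hsplit', ← hl]
  refine ⟨?_, ?_, ?_⟩
  · rw [List.getElem?_append_right le_rfl]
    simp
  · rw [List.take_left]
    simp [List.count_append, h1, List.count_replicate]
  · rw [List.take_left]
    simp [List.count_append, h2, List.count_replicate]

end Words

/-! ### Overlap types -/

section Overlap

open DyckStep

variable {n : ℕ}

lemma part_succ (a : Fin n → ℕ) {j : ℕ} (h : j < n) : part a (j + 1) = a ⟨j, h⟩ := by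
  simp [part, h]

lemma part_anti {a : Fin n → ℕ} (ha : Antitone a) {i j : ℕ} (hi : 1 ≤ i) (hij : i ≤ j)
    (hj : j ≤ n) : part a j ≤ part a i := by
  obtain ⟨i, rfl⟩ := Nat.exists_eq_add_of_le' hi
  obtain ⟨j, rfl⟩ := Nat.exists_eq_add_of_le' (hi.trans hij)
  rw [part_succ a (by omega), part_succ a (by omega)]
  exact ha (by rw [Fin.mk_le_mk]; omega)

lemma dyckL_le_semilength (w : DyckWord) {k : ℕ} (h : k ≤ numRuns w) :
    dyckL w k ≤ w.semilength := by
  rw [← dyckL_numRuns]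
  exact dyckL_mono w h

lemma dyckM_le_semilength (w : DyckWord) {k : ℕ} (h : k ≤ numRuns w) :
    dyckM w k ≤ w.semilength := by
  rw [← dyckM_numRuns]
  exact dyckM_mono w h

variable {lam mu : Fin n → ℕ}

/-- The next run of zeros in an overlap type cannot be longer than in another one that agrees with
it so far: a longer one would put some `λ_i` both above and below a part of `μ`. -/
lemma HasOverlapType.dyckL_le (hlam : Antitone lam) (hmu : Antitone mu) {w w' : DyckWord}
    (hw : w.semilength = n) (hw' : w'.semilength = n) (h : HasOverlapType w lam mu)
    (h' : HasOverlapType w' lam mu) {k : ℕ} (hk : k < numRuns w) (hk' : k < numRuns w')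
    (hM : dyckM w k = dyckM w' k) : dyckL w' (k + 1) ≤ dyckL w (k + 1) := by
  by_contra hlt
  have e1 := dyckL_le_semilength w' (k := k + 1) hk'
  have e2 := dyckL_numRuns w
  have hr : k + 1 ≠ numRuns w := fun h => by rw [← h] at e2; omega
  have h1 := h.2 (k + 1) (by omega) (by omega)
  have h2 := h'.1 k hk'
  have e3 := dyckM_lt_succ w hk
  have e4 := dyckM_le_semilength w (k := k + 1) hk
  have h3 := part_anti hmu (i := dyckM w k + 1) (j := dyckM w (k + 1)) (by omega) (by omega)
    (by omega)
  have h4 := part_anti hlam (i := dyckL w (k + 1) + 1) (j := dyckL w' (k + 1)) (by omega)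
    (by omega) (by omega)
  rw [hM] at h3
  omega

/-- The analogue of `HasOverlapType.dyckL_le` for runs of ones. -/
lemma HasOverlapType.dyckM_le (hlam : Antitone lam) (hmu : Antitone mu) {w w' : DyckWord}
    (hw : w.semilength = n) (hw' : w'.semilength = n) (h : HasOverlapType w lam mu)
    (h' : HasOverlapType w' lam mu) {k : ℕ} (hk : k < numRuns w) (hk' : k < numRuns w')
    (hL : dyckL w (k + 1) = dyckL w' (k + 1)) : dyckM w' (k + 1) ≤ dyckM w (k + 1) := by
  by_contra hlt
  have e1 := dyckM_le_semilength w' (k := k + 1) hk'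
  have e2 := dyckM_numRuns w
  have hr : k + 1 ≠ numRuns w := fun h => by rw [← h] at e2; omega
  have e3 := dyckL_lt_succ w (k := k + 1) (by omega)
  have e4 := dyckL_le_semilength w (k := k + 1 + 1) (by omega)
  have e5 := dyckL_numRuns w'
  have hr' : k + 1 ≠ numRuns w' := fun h => by rw [← h] at e5; omega
  have h1 := h'.2 (k + 1) (by omega) (by omega)
  have h2 := h.1 (k + 1) (by omega)
  have h3 := part_anti hmu (i := dyckM w (k + 1) + 1) (j := dyckM w' (k + 1)) (by omega) (by omega)
    (by omega)
  have h4 := part_anti hlam (i := dyckL w (k + 1) + 1) (j := dyckL w (k + 1 + 1)) (by omega)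
    (by omega) (by omega)
  rw [hL] at h4
  omega

/-- A pair of partitions has at most one overlap type. -/
lemma HasOverlapType.unique (hlam : Antitone lam) (hmu : Antitone mu) {w w' : DyckWord}
    (hw : w.semilength = n) (hw' : w'.semilength = n) (h : HasOverlapType w lam mu)
    (h' : HasOverlapType w' lam mu) : w = w' := by
  have key : ∀ k, k ≤ numRuns w → k ≤ numRuns w' →
      dyckL w k = dyckL w' k ∧ dyckM w k = dyckM w' k := by
    intro k
    induction k with
    | zero => simp
    | succ k ih =>
      intro hk hk'
      obtain ⟨-, i2⟩ := ih (by omega) (by omega)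
      have hL := le_antisymm (h'.dyckL_le hlam hmu hw' hw h hk' hk i2.symm)
        (h.dyckL_le hlam hmu hw hw' h' hk hk' i2)
      exact ⟨hL, le_antisymm (h'.dyckM_le hlam hmu hw' hw h hk' hk hL.symm)
        (h.dyckM_le hlam hmu hw hw' h' hk hk' hL)⟩
  have hr : numRuns w = numRuns w' := by
    have e1 := dyckL_numRuns w
    have e2 := dyckL_numRuns w'
    rcases lt_trichotomy (numRuns w) (numRuns w') with hlt | heq | hgt
    · have h1 := (key _ le_rfl hlt.le).1
      have h2 := dyckL_lt_succ w' hlt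
      have h3 := dyckL_le_semilength w' (k := numRuns w + 1) hlt
      omega
    · exact heq
    · have h1 := (key _ hgt.le le_rfl).1
      have h2 := dyckL_lt_succ w hgt
      have h3 := dyckL_le_semilength w (k := numRuns w' + 1) hgt
      omega
  exact dyckWord_ext hr (fun k hk => (key k hk (hr ▸ hk)).1) fun k hk => (key k hk (hr ▸ hk)).2

/-- The numbers of letters `U` and `D` among the first `i` letters of the word in which the
`(b + 1)`-st letter `D` follows as soon as there are `h b` letters `U`. -/
def greedyState (n : ℕ) (h : ℕ → ℕ) : ℕ → ℕ × ℕ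
  | 0 => (0, 0)
  | i + 1 =>
    let s := greedyState n h i
    if s.2 < n ∧ h s.2 ≤ s.1 then (s.1, s.2 + 1) else (s.1 + 1, s.2)

/-- The letters of the word described in `greedyState`. -/
def greedyLetter (n : ℕ) (h : ℕ → ℕ) (i : ℕ) : DyckStep :=
  if (greedyState n h i).2 < n ∧ h (greedyState n h i).2 ≤ (greedyState n h i).1 then D else U

/-- The word in `greedyState` is a Dyck word if `h` is monotone with `j < h j ≤ n`. -/
lemma greedyState_spec {h : ℕ → ℕ} (hmono : ∀ i j, i ≤ j → j < n → h i ≤ h j)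
    (hlow : ∀ j < n, j + 1 ≤ h j) (hup : ∀ j < n, h j ≤ n) : ∀ i ≤ 2 * n,
    (greedyState n h i).1 + (greedyState n h i).2 = i ∧
    (greedyState n h i).2 ≤ (greedyState n h i).1 ∧ (greedyState n h i).1 ≤ n ∧
    ((greedyState n h i).2 < n → (greedyState n h i).1 ≤ h (greedyState n h i).2) := by
  intro i
  induction i with
  | zero => intro _; simp [greedyState]
  | succ i ih =>
    intro hi
    obtain ⟨h1, h2, h3, h4⟩ := ih (by omega)
    rw [greedyState]
    set a := (greedyState n h i).1
    set b := (greedyState n h i).2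
    split_ifs with hc
    · have := hlow b hc.1
      refine ⟨by simp only; omega, by simp only; omega, h3, fun hb => ?_⟩
      exact (h4 hc.1).trans (hmono b (b + 1) (by omega) hb)
    · rw [not_and] at hc
      have h5 : b < n := by omega
      have := hc h5
      have := hup b h5
      refine ⟨by simp only; omega, by simp only; omega, by simp only; omega,
        fun _ => by simp only; omega⟩

lemma count_greedyLetter (h : ℕ → ℕ) (i : ℕ) :
    ((List.range i).map (greedyLetter n h)).count U = (greedyState n h i).1 ∧
      ((List.range i).map (greedyLetter n h)).count D = (greedyState n h i).2 := by
  induction i with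
  | zero => simp [greedyState]
  | succ i ih =>
    rw [List.range_succ, List.map_append, List.count_append, List.count_append, ih.1, ih.2,
      greedyState]
    simp only [List.map_cons, List.map_nil, greedyLetter]
    split_ifs <;> simp

/-- A pair of partitions `μ ≤ λ` has an overlap type. -/
lemma exists_hasOverlapType (hlam : Antitone lam) (hmu : Antitone mu) (hle : mu ≤ lam) :
    ∃ w : DyckWord, w.semilength = n ∧ HasOverlapType w lam mu := by
  -- the `j`-th letter `D` comes after as many letters `U` as there are `λ_i ≥ μ_j`
  let h : ℕ → ℕ := fun j => (levelSet lam (part mu (j + 1))).card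
  have hh : ∀ {i j}, i < n → (i < h j ↔ part mu (j + 1) ≤ part lam (i + 1)) := by
    intro i j hi
    rw [part_succ lam hi]
    exact lt_card_levelSet_iff hlam (j := ⟨i, hi⟩)
  have hmono : ∀ i j, i ≤ j → j < n → h i ≤ h j := by
    intro i j hij hj
    refine Finset.card_le_card fun v hv => ?_
    rw [mem_levelSet] at hv ⊢
    exact (part_anti hmu (by omega) (by omega) (by omega)).trans hv
  have hlow : ∀ j < n, j + 1 ≤ h j := by
    intro j hj
    rw [Nat.succ_le_iff, hh hj, part_succ lam hj, part_succ mu hj]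
    exact hle _
  have hup : ∀ j < n, h j ≤ n := fun j _ => (Finset.card_le_univ _).trans (by simp)
  have hspec := greedyState_spec hmono hlow hup
  have htake : ∀ i ≤ 2 * n, ((List.range (2 * n)).map (greedyLetter n h)).take i =
      (List.range i).map (greedyLetter n h) := fun i hi => by
    rw [← List.map_take, List.take_range, min_eq_left hi]
  obtain ⟨s1, s2, s3, -⟩ := hspec (2 * n) le_rfl
  have hend : (greedyState n h (2 * n)).1 = n ∧ (greedyState n h (2 * n)).2 = n := by omega
  let w : DyckWord :=
    { toList := (List.range (2 * n)).map (greedyLetter n h)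
      count_U_eq_count_D := by
        rw [(count_greedyLetter h _).1, (count_greedyLetter h _).2, hend.1, hend.2]
      count_D_le_count_U := fun i => by
        rcases le_total i (2 * n) with hi | hi
        · rw [htake i hi, (count_greedyLetter h _).1, (count_greedyLetter h _).2]
          exact (hspec i hi).2.1
        · rw [List.take_of_length_le (by simpa using hi), (count_greedyLetter h _).1,
            (count_greedyLetter h _).2]
          exact s2 }
  have hw : w.semilength = n := by
    rw [DyckWord.semilength]
    exact (count_greedyLetter h _).1.trans hend.1
  -- at every letter `D`, the number of previous letters `U` is the prescribed one
  have hD : ∀ k j, k < numRuns w → dyckM w k ≤ j → j < dyckM w (k + 1) →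
      h j = dyckL w (k + 1) := by
    intro k j hk hj hj'
    obtain ⟨t1, t2, t3⟩ := toList_getElem_D w hk hj hj'
    set i := dyckL w (k + 1) + j with hi
    have e1 := dyckL_le_semilength w (k := k + 1) hk
    have e2 := dyckM_le_semilength w (k := k + 1) hk
    have hin : i < 2 * n := by omega
    have t1' : greedyLetter n h i = D := by
      have : w.toList = (List.range (2 * n)).map (greedyLetter n h) := rfl
      rw [this, List.getElem?_map, List.getElem?_range hin] at t1
      simpa using t1
    change (((List.range (2 * n)).map (greedyLetter n h)).take i).count U = _ at t2
    change (((List.range (2 * n)).map (greedyLetter n h)).take i).count D = _ at t3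
    rw [htake i hin.le, (count_greedyLetter h _).1] at t2
    rw [htake i hin.le, (count_greedyLetter h _).2] at t3
    obtain ⟨-, -, -, u⟩ := hspec i hin.le
    rw [greedyLetter] at t1'
    split_ifs at t1' with hc
    rw [t2, t3] at u hc
    exact le_antisymm hc.2 (u hc.1)
  refine ⟨w, hw, fun i hi => ?_, fun i hi1 hi => ?_⟩
  · have e1 := dyckL_lt_succ w hi
    have e2 := dyckL_le_semilength w (k := i + 1) hi
    have e3 := hD i (dyckM w i) hi le_rfl (dyckM_lt_succ w hi)
    have := (hh (i := dyckL w (i + 1) - 1) (j := dyckM w i) (by omega)).1 (by omega)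
    rwa [Nat.sub_add_cancel (by omega)] at this
  · obtain ⟨i, rfl⟩ := Nat.exists_eq_add_of_le' hi1
    have e1 := dyckL_lt_succ w hi
    have e2 := dyckL_le_semilength w (k := i + 1 + 1) hi
    have e4 := dyckM_lt_succ w (k := i) (by omega)
    have e3 := hD i (dyckM w (i + 1) - 1) (by omega) (by omega) (by omega)
    have := (hh (i := dyckL w (i + 1)) (j := dyckM w (i + 1) - 1) (by omega)).not.1 (by omega)
    rwa [Nat.sub_add_cancel (by omega), not_le] at this

end Overlap

/-! ### Gaussian multinomials and Igusa functions -/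

section Gauss

variable {F : Type*} [Field F]

/-- The least element of `I` greater than `j`. -/
noncomputable def nextIn (I : Finset ℕ) (j : ℕ) : ℕ := sInf {i : ℕ | i ∈ I ∧ j < i}

lemma nextIn_congr {I I' : Finset ℕ} {j : ℕ} (h : ∀ i, j < i → i ≤ nextIn I j → (i ∈ I ↔ i ∈ I'))
    (hne : ∃ i ∈ I, j < i) : nextIn I j = nextIn I' j := by
  obtain ⟨i, hi, hji⟩ := hne
  have hmem : nextIn I j ∈ I ∧ j < nextIn I j :=
    Nat.sInf_mem (s := {i : ℕ | i ∈ I ∧ j < i}) ⟨i, hi, hji⟩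
  have h1 : nextIn I' j ≤ nextIn I j :=
    Nat.sInf_le ⟨(h _ hmem.2 le_rfl).1 hmem.1, hmem.2⟩
  have hmem' : nextIn I' j ∈ I' ∧ j < nextIn I' j :=
    Nat.sInf_mem (s := {i : ℕ | i ∈ I' ∧ j < i}) ⟨_, (h _ hmem.2 le_rfl).1 hmem.1, hmem.2⟩
  exact le_antisymm (Nat.sInf_le ⟨(h _ hmem'.2 h1).2 hmem'.1, hmem'.2⟩) h1

lemma nextIn_eq_of_forall {I : Finset ℕ} {j h : ℕ} (hh : h ∈ I) (hj : j < h)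
    (hI : ∀ i ∈ I, j < i → h ≤ i) : nextIn I j = h := by
  refine le_antisymm (Nat.sInf_le ⟨hh, hj⟩) ?_
  have := Nat.sInf_mem (s := {i : ℕ | i ∈ I ∧ j < i}) ⟨h, hh, hj⟩
  exact hI _ this.1 this.2

lemma gaussMultinom_eq (h : ℕ) (I : Finset ℕ) (Y : F) :
    gaussMultinom h I Y = ∏ i ∈ I, gaussBinom (nextIn (insert h I) i) i Y := rfl

lemma prod_Ico_one_sub (Y : F) {i h : ℕ} (hih : i ≤ h) :
    ∏ j ∈ Finset.Ico i h, (1 - Y ^ (h - j)) = ∏ l ∈ Finset.Icc 1 (h - i), (1 - Y ^ l) := by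
  refine Finset.prod_nbij' (fun j => h - j) (fun l => h - l) ?_ ?_ ?_ ?_ ?_ <;>
    simp only [Finset.mem_Ico, Finset.mem_Icc] <;> intros <;> first | omega | trivial

/-- The Gaussian binomial in terms of Gaussian factorials. -/
lemma gaussBinom_mul (Y : F) {a b : ℕ} (hba : b ≤ a) (hY : ∀ l, 1 ≤ l → l ≤ a → 1 - Y ^ l ≠ 0) :
    gaussBinom a b Y * ((∏ l ∈ Finset.Icc 1 (a - b), (1 - Y ^ l)) *
      ∏ l ∈ Finset.Icc 1 b, (1 - Y ^ l)) = ∏ l ∈ Finset.Icc 1 a, (1 - Y ^ l) := by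
  have h1 : ∏ l ∈ Finset.Icc 1 b, (1 - Y ^ l) ≠ 0 := Finset.prod_ne_zero_iff.2 fun l hl => by
    rw [Finset.mem_Icc] at hl
    exact hY l hl.1 (by omega)
  have h2 : ∏ l ∈ Finset.Icc 1 a, (1 - Y ^ l) = (∏ l ∈ Finset.Icc 1 (a - b), (1 - Y ^ l)) *
      ∏ l ∈ Finset.Ioc (a - b) a, (1 - Y ^ l) := by
    rw [← Finset.prod_union]
    · refine Finset.prod_congr ?_ fun _ _ => rfl
      ext l
      simp only [Finset.mem_Icc, Finset.mem_union, Finset.mem_Ioc]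
      omega
    · rw [Finset.disjoint_left]
      intro l
      simp only [Finset.mem_Icc, Finset.mem_Ioc]
      omega
  rw [h2, gaussBinom]
  field_simp

/-- The Gaussian multinomial as a quotient of products over all places: the factors between two
consecutive elements of `insert h I` form a Gaussian factorial. -/
lemma gaussMultinom_mul (Y : F) {h : ℕ} {I : Finset ℕ} (hI : I ⊆ Finset.Ico 1 h)
    (hY : ∀ l, 1 ≤ l → l ≤ h → 1 - Y ^ l ≠ 0) :
    gaussMultinom h I Y * ∏ j ∈ Finset.range h, (1 - Y ^ (nextIn (insert h I) j - j)) =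
      ∏ l ∈ Finset.Icc 1 h, (1 - Y ^ l) := by
  induction h using Nat.strong_induction_on generalizing I with
  | _ h ih =>
  rcases I.eq_empty_or_nonempty with rfl | hne
  · have h1 : ∀ j ∈ Finset.range h, (1 - Y ^ (nextIn (insert h ∅) j - j)) = 1 - Y ^ (h - j) := by
      intro j hj
      rw [nextIn_eq_of_forall (h := h) (by simp) (Finset.mem_range.1 hj) (by simp)]
    rw [Finset.prod_congr rfl h1, Finset.range_eq_Ico, prod_Ico_one_sub Y (Nat.zero_le h)]
    simp [gaussMultinom]
  · set i := I.max' hne with hi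
    have hiI : i ∈ I := I.max'_mem hne
    have hih := Finset.mem_Ico.1 (hI hiI)
    set I' := I.erase i with hI'
    have hII' : insert i I' = I := Finset.insert_erase hiI
    have hlt : ∀ j ∈ I', j < i := fun j hj =>
      lt_of_le_of_ne (I.le_max' j (Finset.mem_of_mem_erase hj)) (Finset.ne_of_mem_erase hj)
    have hsub : I' ⊆ Finset.Ico 1 i := fun j hj => Finset.mem_Ico.2
      ⟨(Finset.mem_Ico.1 (hI (Finset.mem_of_mem_erase hj))).1, hlt j hj⟩
    have hnext : ∀ j < i, nextIn (insert h I) j = nextIn I j := by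
      intro j hj
      refine (nextIn_congr (fun l hl hl' => ?_) ⟨i, hiI, hj⟩).symm
      have h2 : nextIn I j ≤ i := Nat.sInf_le ⟨hiI, hj⟩
      rw [Finset.mem_insert, or_iff_right]
      omega
    have hnext' : ∀ j, i ≤ j → j < h → nextIn (insert h I) j = h := by
      intro j hj hjh
      refine nextIn_eq_of_forall (by simp) hjh fun l hl hl' => ?_
      rcases Finset.mem_insert.1 hl with rfl | hl
      · exact le_rfl
      · have := I.le_max' l hl
        omega
    have e1 : gaussMultinom h I Y = gaussBinom h i Y * gaussMultinom i I' Y := by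
      rw [gaussMultinom_eq, gaussMultinom_eq, ← Finset.mul_prod_erase I _ hiI,
        hnext' i le_rfl hih.2, hII']
      congr 1
      exact Finset.prod_congr rfl fun j hj => by rw [hnext j (hlt j hj)]
    have e2 : ∏ j ∈ Finset.range h, (1 - Y ^ (nextIn (insert h I) j - j)) =
        (∏ j ∈ Finset.range i, (1 - Y ^ (nextIn (insert i I') j - j))) *
          ∏ l ∈ Finset.Icc 1 (h - i), (1 - Y ^ l) := by
      rw [← prod_Ico_one_sub Y hih.2.le, ← Finset.prod_range_mul_prod_Ico _ hih.2.le, hII']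
      congr 1
      · exact Finset.prod_congr rfl fun j hj => by rw [hnext j (Finset.mem_range.1 hj)]
      · refine Finset.prod_congr rfl fun j hj => ?_
        rw [Finset.mem_Ico] at hj
        rw [hnext' j hj.1 hj.2]
    have e3 := ih i hih.2 hsub fun l h1 h2 => hY l h1 (by omega)
    rw [e1, e2, ← gaussBinom_mul Y hih.2.le hY, ← e3]
    ring

/-- The coefficient contributed by one run of ones, of length `h`, to the number of subgroups; the
set `z` lists the places of the run at which the values of `μ` drop. -/
noncomputable def runCoeff (Y : F) (a h : ℕ) (z : Finset ℕ) : F :=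
  ∏ j ∈ Finset.range h, (1 - Y ^ (a - j)) / (1 - Y ^ (nextIn (insert h z) j - j))

/-- The numerator of `runCoeff` is a quotient of two Gaussian factorials. -/
lemma runCoeff_eq (Y : F) {a h : ℕ} (hha : h ≤ a) {I : Finset ℕ} (hI : I ⊆ Finset.Ico 1 h)
    (hY : ∀ l, 1 ≤ l → l ≤ a → 1 - Y ^ l ≠ 0) :
    runCoeff Y a h I = gaussBinom a (a - h) Y * gaussMultinom h I Y := by
  have hne : ∀ m ≤ a, ∏ l ∈ Finset.Icc 1 m, (1 - Y ^ l) ≠ 0 := fun m hm =>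
    Finset.prod_ne_zero_iff.2 fun l hl => by
      rw [Finset.mem_Icc] at hl
      exact hY l hl.1 (by omega)
  have h1 := gaussMultinom_mul Y hI fun l h1 h2 => hY l h1 (by omega)
  have h2 := gaussBinom_mul Y (Nat.sub_le a h) hY
  rw [Nat.sub_sub_self hha] at h2
  have h3 : (∏ j ∈ Finset.range h, (1 - Y ^ (a - j))) * ∏ l ∈ Finset.Icc 1 (a - h), (1 - Y ^ l) =
      ∏ l ∈ Finset.Icc 1 a, (1 - Y ^ l) := by
    rw [← prod_Ico_one_sub Y hha, Finset.prod_range_mul_prod_Ico _ hha, Finset.range_eq_Ico,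
      prod_Ico_one_sub Y (Nat.zero_le a), Nat.sub_zero]
  have h4 : ∏ j ∈ Finset.range h, (1 - Y ^ (nextIn (insert h I) j - j)) ≠ 0 := by
    intro h0
    rw [h0, mul_zero] at h1
    exact hne h hha h1.symm
  rw [runCoeff, Finset.prod_div_distrib, div_eq_iff h4, mul_assoc, h1]
  refine mul_right_cancel₀ (hne (a - h) (Nat.sub_le a h)) ?_
  rw [h3, ← h2]
  ring

lemma Icc_eq_insert_Ico {h : ℕ} (hh : 1 ≤ h) : Finset.Icc 1 h = insert h (Finset.Ico 1 h) := by
  ext l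
  simp only [Finset.mem_Icc, Finset.mem_insert, Finset.mem_Ico]
  omega

/-- The contribution of a run which is not the last one: the value of `μ` drops at its end. -/
lemma sum_runCoeff_of_mem (Y : F) (X : ℕ → F) {a h : ℕ} (hh : 1 ≤ h) (hha : h ≤ a)
    (hY : ∀ l, 1 ≤ l → l ≤ a → 1 - Y ^ l ≠ 0) :
    ∑ z ∈ (Finset.Icc 1 h).powerset, (if h ∈ z then runCoeff Y a h z else 0) *
      ∏ i ∈ z, X i / (1 - X i) = gaussBinom a (a - h) Y * igusaCirc h Y X := by
  have hn : h ∉ Finset.Ico 1 h := by simp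
  rw [Icc_eq_insert_Ico hh, Finset.sum_powerset_insert hn, Finset.sum_eq_zero, zero_add, igusaCirc,
    igusaSum, ← mul_assoc, Finset.mul_sum]
  · refine Finset.sum_congr rfl fun I hI => ?_
    rw [Finset.mem_powerset] at hI
    have hhI : h ∉ I := fun h' => hn (hI h')
    rw [if_pos (Finset.mem_insert_self h I), Finset.prod_insert hhI, ← mul_assoc, ← mul_assoc]
    congr 1
    rw [show runCoeff Y a h (insert h I) = runCoeff Y a h I by simp [runCoeff],
      runCoeff_eq Y hha hI hY]
    ring
  · intro I hI
    rw [Finset.mem_powerset] at hI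
    rw [if_neg fun h' => hn (hI h'), zero_mul]

/-- The contribution of the last run. -/
lemma sum_runCoeff_self (Y : F) (X : ℕ → F) {h : ℕ} (hh : 1 ≤ h) (hX : 1 - X h ≠ 0)
    (hY : ∀ l, 1 ≤ l → l ≤ h → 1 - Y ^ l ≠ 0) :
    ∑ z ∈ (Finset.Icc 1 h).powerset, runCoeff Y h h z * ∏ i ∈ z, X i / (1 - X i) =
      igusa h Y X := by
  have hn : h ∉ Finset.Ico 1 h := by simp
  rw [Icc_eq_insert_Ico hh, Finset.sum_powerset_insert hn, igusa, igusaSum,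
    ← Finset.sum_add_distrib, Finset.mul_sum]
  refine Finset.sum_congr rfl fun I hI => ?_
  rw [Finset.mem_powerset] at hI
  have hhI : h ∉ I := fun h' => hn (hI h')
  rw [Finset.prod_insert hhI, show runCoeff Y h h (insert h I) = runCoeff Y h h I by simp [runCoeff],
    runCoeff_eq Y le_rfl hI hY]
  simp only [Nat.sub_self, gaussBinom]
  simp only [Nat.sub_zero, Finset.Ioc_self, Finset.prod_empty]
  rw [show Finset.Icc 1 0 = (∅ : Finset ℕ) from rfl, Finset.prod_empty]
  field_simp
  ring

open scoped Classical in
/-- The function `I_h^wo` as a sum over all chains of nonempty subsets. -/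
lemma sum_isFlag_eq_igusaWO {h : ℕ} (hh : 1 ≤ h) (X : Finset (Fin h) → F)
    (hX : 1 - X Finset.univ ≠ 0) :
    ∑ y ∈ ((Finset.univ : Finset (Finset (Fin h))).filter (·.Nonempty)).powerset,
      (if IsFlag y then 1 else 0) * ∏ S ∈ y, X S / (1 - X S) = igusaWO h X := by
  have : NeZero h := ⟨by omega⟩
  set N := (Finset.univ : Finset (Finset (Fin h))).filter fun S => S.Nonempty ∧ S ≠ Finset.univ
    with hN
  have hins : (Finset.univ : Finset (Finset (Fin h))).filter (·.Nonempty) =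
      insert Finset.univ N := by
    ext S
    simp only [hN, Finset.mem_filter, Finset.mem_univ, true_and, Finset.mem_insert]
    constructor
    · intro h1
      by_cases h2 : S = Finset.univ
      · exact Or.inl h2
      · exact Or.inr ⟨h1, h2⟩
    · rintro (rfl | h1)
      · exact Finset.univ_nonempty
      · exact h1.1
  have hn : Finset.univ ∉ N := by simp [hN]
  have hflags : flags h = N.powerset.filter IsFlag := by
    ext y
    simp only [flags, IsFlag, Finset.mem_filter, Finset.mem_univ, true_and, Finset.mem_powerset,
      Finset.subset_iff, hN]
    constructor
    · rintro ⟨h1, h2⟩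
      exact ⟨fun S hS => h1 S hS, fun S hS => (h1 S hS).1, h2⟩
    · rintro ⟨h1, -, h2⟩
      exact ⟨fun S hS => h1 S hS, h2⟩
  have hflag : ∀ y : Finset (Finset (Fin h)), IsFlag (insert Finset.univ y) ↔ IsFlag y := by
    intro y
    simp only [IsFlag, Finset.forall_mem_insert]
    constructor
    · rintro ⟨⟨-, h1⟩, -, h2⟩
      exact ⟨h1, fun S hS => (h2 S hS).2⟩
    · rintro ⟨h1, h2⟩
      exact ⟨⟨Finset.univ_nonempty, h1⟩, ⟨Or.inl le_rfl, fun S _ => Or.inr (Finset.subset_univ S)⟩,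
        fun S hS => ⟨Or.inl (Finset.subset_univ S), h2 S hS⟩⟩
  rw [hins, Finset.sum_powerset_insert hn, igusaWO, hflags, Finset.sum_filter,
    ← Finset.sum_add_distrib, Finset.mul_sum]
  refine Finset.sum_congr rfl fun y hy => ?_
  rw [Finset.mem_powerset] at hy
  rw [Finset.prod_insert fun h' => hn (hy h')]
  simp only [hflag]
  split_ifs
  · field_simp
    ring
  · simp

end Gauss

section PowersetProducts

variable {F : Type*} [CommSemiring F]

/-- A sum over the subsets of a disjoint union of a family factors. -/
lemma sum_powerset_sigma {r : ℕ} {T : Fin r → Type*} [∀ k, DecidableEq (T k)]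
    (s : ∀ k, Finset (T k)) (G : ∀ k, Finset (T k) → F) :
    ∑ z ∈ (Finset.univ.sigma s).powerset, ∏ k, G k ((s k).filter fun x => ⟨k, x⟩ ∈ z) =
      ∏ k, ∑ u ∈ (s k).powerset, G k u := by
  rw [Finset.prod_univ_sum]
  refine Finset.sum_nbij' (fun z k => (s k).filter fun x => (⟨k, x⟩ : Σ k, T k) ∈ z)
    (fun u => Finset.univ.sigma u) ?_ ?_ ?_ ?_ ?_
  · intro z _
    simp [Fintype.mem_piFinset, Finset.filter_subset]
  · intro u hu
    rw [Fintype.mem_piFinset] at hu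
    exact Finset.mem_powerset.2 (Finset.sigma_mono le_rfl fun k => Finset.mem_powerset.1 (hu k))
  · intro z hz
    rw [Finset.mem_powerset] at hz
    ext ⟨k, x⟩
    simp only [Finset.mem_sigma, Finset.mem_univ, true_and, Finset.mem_filter,
      and_iff_right_iff_imp]
    intro h
    simpa using hz h
  · intro u hu
    rw [Fintype.mem_piFinset] at hu
    funext k
    ext x
    simp only [Finset.mem_sigma, Finset.mem_univ, true_and, Finset.mem_filter,
      and_iff_right_iff_imp]
    exact fun h => Finset.mem_powerset.1 (hu k) h
  · intro z _
    rfl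

lemma sum_powerset_disjSum {α β : Type*} [DecidableEq α] [DecidableEq β] (s : Finset α)
    (t : Finset β) (G : Finset α → F) (H : Finset β → F) :
    ∑ z ∈ (s.disjSum t).powerset, G z.toLeft * H z.toRight =
      (∑ u ∈ s.powerset, G u) * ∑ v ∈ t.powerset, H v := by
  rw [Finset.sum_mul_sum, ← Finset.sum_product']
  refine Finset.sum_nbij' (fun z => (z.toLeft, z.toRight)) (fun q => q.1.disjSum q.2) ?_ ?_ ?_ ?_ ?_
  · intro z hz
    rw [Finset.mem_powerset] at hz
    simp only [Finset.mem_product, Finset.mem_powerset]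
    exact ⟨by simpa using Finset.toLeft_subset_toLeft hz, by simpa using Finset.toRight_subset_toRight hz⟩
  · intro q hq
    simp only [Finset.mem_product, Finset.mem_powerset] at hq ⊢
    exact Finset.disjSum_mono hq.1 hq.2
  · intro z _
    exact Finset.toLeft_disjSum_toRight
  · intro q _
    simp
  · intro z _
    rfl

end PowersetProducts

/-! ### Admissible tuples and weak orderings -/

lemma exists_interval {c : ℕ → ℕ} (h0 : c 0 = 0) {r x : ℕ} (hx : x < c r) :
    ∃ k < r, c k ≤ x ∧ x < c (k + 1) := by
  induction r with
  | zero => omega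
  | succ r ih =>
    by_cases h : x < c r
    · obtain ⟨k, hk, h1⟩ := ih h
      exact ⟨k, by omega, h1⟩
    · exact ⟨r, by omega, by omega, hx⟩

lemma card_filter_interval {n a b : ℕ} (hb : b ≤ n) :
    (Finset.univ.filter fun x : Fin n => a ≤ x ∧ (x : ℕ) < b).card = b - a := by
  rw [← Nat.card_Ico, ← Finset.card_map Fin.valEmbedding]
  congr 1
  ext x
  simp only [Finset.mem_map, Finset.mem_filter, Finset.mem_univ, true_and, Fin.valEmbedding_apply,
    Finset.mem_Ico]
  constructor
  · rintro ⟨y, h, rfl⟩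
    exact h
  · intro h
    exact ⟨⟨x, by omega⟩, h, rfl⟩

section Blocks

variable {g n : ℕ} {f : Fin g → ℕ}

lemma blockEnd_zero (f : Fin g → ℕ) : blockEnd f 0 = 0 := by simp [blockEnd]

lemma blockEnd_succ (f : Fin g → ℕ) (i : Fin g) : blockEnd f (i + 1) = blockEnd f i + f i := by
  have h1 : Finset.univ.filter (fun j : Fin g => (j : ℕ) < i + 1) =
      insert i (Finset.univ.filter fun j : Fin g => (j : ℕ) < i) := by
    ext j
    simp only [Finset.mem_filter, Finset.mem_univ, true_and, Finset.mem_insert, Fin.ext_iff]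
    omega
  rw [blockEnd, h1, Finset.sum_insert (by simp), add_comm]
  rfl

lemma blockEnd_mono (f : Fin g → ℕ) : Monotone (blockEnd f) := fun a b hab =>
  Finset.sum_le_sum_of_subset fun j hj => by
    simp only [Finset.mem_filter, Finset.mem_univ, true_and] at hj ⊢
    omega

lemma blockEnd_self (hn : ∑ i, f i = n) : blockEnd f g = n := by
  rw [← hn, blockEnd]
  congr 1
  ext j
  simp

lemma exists_mem_block (hn : ∑ i, f i = n) (x : Fin n) :
    ∃ i : Fin g, blockEnd f i ≤ x ∧ (x : ℕ) < blockEnd f (i + 1) := by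
  obtain ⟨k, hk, h⟩ := exists_interval (blockEnd_zero f) (r := g) (x := x)
    (by rw [blockEnd_self hn]; exact x.2)
  exact ⟨⟨k, hk⟩, h⟩

/-- The index of the block `C_{i-1} < j ≤ C_i` of a place `j`. -/
noncomputable def block (hn : ∑ i, f i = n) (x : Fin n) : Fin g := (exists_mem_block hn x).choose

/-- The choice made in `block` is unique. -/
lemma block_eq_iff (hn : ∑ i, f i = n) {x : Fin n} {i : Fin g} :
    block hn x = i ↔ blockEnd f i ≤ x ∧ (x : ℕ) < blockEnd f (i + 1) := by
  have h := (exists_mem_block hn x).choose_spec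
  constructor
  · rintro rfl
    exact h
  · intro h'
    change (exists_mem_block hn x).choose = i
    generalize (exists_mem_block hn x).choose = j at h
    by_contra hne
    rcases lt_or_gt_of_ne hne with hlt | hlt
    · have := blockEnd_mono f (show (j : ℕ) + 1 ≤ i from hlt)
      omega
    · have := blockEnd_mono f (show (i : ℕ) + 1 ≤ j from hlt)
      omega

lemma blockEnd_le (hn : ∑ i, f i = n) (i : Fin g) : blockEnd f (i + 1) ≤ n := by
  rw [← blockEnd_self hn]
  exact blockEnd_mono f i.2

lemma card_block (hn : ∑ i, f i = n) (i : Fin g) :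
    (Finset.univ.filter fun x : Fin n => block hn x = i).card = f i := by
  simp only [block_eq_iff]
  rw [card_filter_interval (blockEnd_le hn i), blockEnd_succ]
  omega

lemma psi_comp_block (hf : ∀ i, 0 < f i) (hn : ∑ i, f i = n) (m : Fin g → ℕ) :
    psi f (m ∘ block hn) = m := by
  funext i
  have h1 := blockEnd_succ f i
  have h2 := hf i
  have h3 := blockEnd_le hn i
  rw [psi, show blockEnd f (i + 1) = blockEnd f (i + 1) - 1 + 1 by omega,
    part_succ _ (by omega)]
  simp only [Function.comp_apply]
  rw [(block_eq_iff hn (i := i)).2]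
  simp only
  omega

lemma mem_admissible_iff (hn : ∑ i, f i = n) {l : Fin n → ℕ} :
    l ∈ admissible n f ↔ l = psi f l ∘ block hn := by
  constructor
  · intro h
    funext x
    obtain ⟨h1, h2⟩ := (block_eq_iff hn (x := x) (i := block hn x)).1 rfl
    have := h (block hn x) (block hn x).2 (x + 1) (by omega) (by omega)
    rwa [part_succ l x.2] at this
  · intro h i hi j h1 h2
    rw [h]
    have h3 := blockEnd_le hn ⟨i, hi⟩
    simp only at h3
    have h4 : ∀ z, blockEnd f i < z → z ≤ blockEnd f (i + 1) →
        part (psi f l ∘ block hn) z = psi f l ⟨i, hi⟩ := by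
      intro z hz hz'
      obtain ⟨z, rfl⟩ : ∃ z', z = z' + 1 := ⟨z - 1, by omega⟩
      rw [part_succ _ (by omega), Function.comp_apply, (block_eq_iff hn (i := ⟨i, hi⟩)).2]
      simp only
      omega
    rw [h4 j h1 h2, h4 _ (by omega) le_rfl]

lemma card_levelSet_block (hn : ∑ i, f i = n) (m : Fin g → ℕ) (c : ℕ) :
    (levelSet (m ∘ block hn) c).card = ∑ i ∈ levelSet m c, f i := by
  rw [Finset.card_eq_sum_card_fiberwise (f := block hn) (t := levelSet m c)]
  · refine Finset.sum_congr rfl fun i hi => ?_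
    rw [← card_block hn i]
    congr 1
    ext x
    simp only [Finset.mem_filter, mem_levelSet, Function.comp_apply, Finset.mem_univ, true_and,
      and_iff_right_iff_imp]
    rintro rfl
    exact mem_levelSet.1 hi
  · intro x hx
    simpa using hx

end Blocks

section SortDesc

variable {n : ℕ}

lemma antitone_sortDesc (l : Fin n → ℕ) : Antitone (sortDesc l) := fun _ _ h =>
  Tuple.monotone_sort (OrderDual.toDual ∘ l) h

lemma card_levelSet_sortDesc (l : Fin n → ℕ) (c : ℕ) :
    (levelSet (sortDesc l) c).card = (levelSet l c).card := by
  refine Finset.card_bij (fun x _ => Tuple.sort (OrderDual.toDual ∘ l) x) ?_ ?_ ?_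
  · intro x hx
    rw [mem_levelSet] at hx ⊢
    exact hx
  · intro x _ y _ h
    exact (Tuple.sort _).injective h
  · intro x hx
    refine ⟨(Tuple.sort (OrderDual.toDual ∘ l)).symm x, ?_, by simp⟩
    rw [mem_levelSet] at hx ⊢
    simpa [sortDesc] using hx

/-- A weak ordering obtained from a tuple satisfies the condition on descents, as the sorting
permutation keeps the order of indices with equal values. -/
lemma weakOrderOf_mem {g : ℕ} (m : Fin g → ℕ) : weakOrderOf m ∈ weakOrderings g := by
  rw [weakOrderings, Finset.mem_filter, Finset.mem_product]
  refine ⟨⟨Finset.mem_univ _, Finset.mem_powerset.2 (Finset.filter_subset _ _)⟩, fun i hi => ?_⟩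
  obtain ⟨hi1, h3⟩ := Finset.mem_filter.1 hi
  refine Finset.mem_filter.2 ⟨hi1, ?_⟩
  obtain ⟨h1, h2⟩ := Finset.mem_Ico.1 hi1
  obtain ⟨j, rfl⟩ := Nat.exists_eq_add_of_le' h1
  rw [part_succ _ h2, part_succ _ (by omega)] at h3 ⊢
  have h4 := antitone_sortDesc m (a := ⟨j, by omega⟩) (b := ⟨j + 1, h2⟩) (by simp)
  refine lt_of_le_of_ne h4 fun heq => ?_
  have h5 := (Tuple.eq_sort_iff (f := OrderDual.toDual ∘ m)
    (σ := Tuple.sort (OrderDual.toDual ∘ m))).1 rfl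
  have h6 := h5.2 ⟨j, by omega⟩ ⟨j + 1, h2⟩ (by simp [Fin.lt_def]) heq.symm
  have h7 : ((weakOrderOf m).1 ⟨j, by omega⟩ : ℕ) < (weakOrderOf m).1 ⟨j + 1, h2⟩ := h6
  omega

end SortDesc

/-- An initial segment of `Fin g` is determined by its number of elements. -/
lemma mem_iff_lt_card {g : ℕ} {S : Finset (Fin g)} (hS : ∀ x ∈ S, ∀ y, y ≤ x → y ∈ S)
    (x : Fin g) : x ∈ S ↔ (x : ℕ) < S.card := by
  have h := Fin.lt_card_filter_univ_iff_apply_of_imp (j := x) (fun y => y ∈ S)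
    (fun a b hab ha => hS a ha b (by simpa using hab))
  rw [← h]
  congr!
  ext y
  simp

/-! ### The order pattern of a pair belonging to a Dyck word and a set partition -/

section Interlaced

variable {g n : ℕ} {f : Fin g → ℕ} {w : DyckWord} {A : Fin (numRuns w) → Finset (Fin g)}

/-- The union of the first `k` members of a family of sets. -/
def before {r : ℕ} (A : Fin r → Finset (Fin g)) (k : ℕ) : Finset (Fin g) :=
  Finset.univ.filter fun j => ∃ k' : Fin r, (k' : ℕ) < k ∧ j ∈ A k'

lemma mem_before {r : ℕ} {A : Fin r → Finset (Fin g)} {k : ℕ} {j : Fin g} :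
    j ∈ before A k ↔ ∃ k' : Fin r, (k' : ℕ) < k ∧ j ∈ A k' := by simp [before]

/-- All `m_j` with `j` in the block `A_k` lie between the last part of `μ` in the preceding run of
ones and the first part of `μ` in the following one. -/
def Interlaced (w : DyckWord) (A : Fin (numRuns w) → Finset (Fin g)) (m : Fin g → ℕ)
    (mu : Fin n → ℕ) : Prop :=
  ∀ k, ∀ j ∈ A k, part mu (dyckM w k + 1) ≤ m j ∧ (0 < (k : ℕ) → m j < part mu (dyckM w k))

lemma before_zero {r : ℕ} (A : Fin r → Finset (Fin g)) : before A 0 = ∅ := by simp [before]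

lemma before_succ {r : ℕ} (A : Fin r → Finset (Fin g)) (k : Fin r) :
    before A (k + 1) = before A k ∪ A k := by
  ext j
  rw [Finset.mem_union, mem_before, mem_before]
  constructor
  · rintro ⟨k', h1, h2⟩
    by_cases h : k' = k
    · exact Or.inr (h ▸ h2)
    · have : (k' : ℕ) ≠ k := fun h' => h (Fin.ext h')
      exact Or.inl ⟨k', by omega, h2⟩
  · rintro (⟨k', h1, h2⟩ | h)
    · exact ⟨k', by omega, h2⟩
    · exact ⟨k, by omega, h⟩

lemma mem_compatible : A ∈ compatible f w ↔
    (∀ k, (A k).Nonempty) ∧ (∀ k k', k ≠ k' → Disjoint (A k) (A k')) ∧ (∀ j, ∃ k, j ∈ A k) ∧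
      ∀ k, ∑ j ∈ A k, f j = dyckL w (k + 1) - dyckL w k := by
  simp [compatible]

lemma mem_before_iff (hA : A ∈ compatible f w) {k : Fin (numRuns w)} {j : Fin g} (hj : j ∈ A k)
    {k' : ℕ} : j ∈ before A k' ↔ (k : ℕ) < k' := by
  rw [mem_before]
  constructor
  · rintro ⟨k₁, h1, h2⟩
    by_contra h
    have hne : k₁ ≠ k := fun h' => h (h' ▸ h1)
    exact Finset.disjoint_left.1 ((mem_compatible.1 hA).2.1 k₁ k hne) h2 hj
  · intro h
    exact ⟨k, h, hj⟩

lemma before_numRuns (hA : A ∈ compatible f w) : before A (numRuns w) = Finset.univ := by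
  ext j
  obtain ⟨k, hk⟩ := (mem_compatible.1 hA).2.2.1 j
  simp only [Finset.mem_univ, iff_true]
  exact mem_before.2 ⟨k, k.2, hk⟩

lemma disjoint_before (hA : A ∈ compatible f w) (k : Fin (numRuns w)) :
    Disjoint (before A k) (A k) :=
  Finset.disjoint_left.2 fun _ h1 h2 => lt_irrefl _ ((mem_before_iff hA h2).1 h1)

lemma sum_before (hA : A ∈ compatible f w) {k : ℕ} (hk : k ≤ numRuns w) :
    ∑ j ∈ before A k, f j = dyckL w k := by
  induction k with
  | zero => simp [before_zero]
  | succ k ih =>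
    rw [before_succ A ⟨k, hk⟩, Finset.sum_union (disjoint_before hA ⟨k, hk⟩), ih (by omega),
      (mem_compatible.1 hA).2.2.2 ⟨k, hk⟩]
    have := dyckL_mono w (show k ≤ k + 1 by omega)
    simp only
    omega

lemma before_mono {r : ℕ} (A : Fin r → Finset (Fin g)) : Monotone (before A) := by
  intro a b hab j hj
  obtain ⟨k, h1, h2⟩ := mem_before.1 hj
  exact mem_before.2 ⟨k, by omega, h2⟩

lemma card_before_lt (hA : A ∈ compatible f w) {k : ℕ} (hk : k < numRuns w) :
    (before A k).card < (before A (k + 1)).card := by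
  rw [before_succ A ⟨k, hk⟩, Finset.card_union_of_disjoint (disjoint_before hA ⟨k, hk⟩)]
  exact Nat.lt_add_of_pos_right (Finset.card_pos.2 ((mem_compatible.1 hA).1 ⟨k, hk⟩))

variable {mu : Fin n → ℕ} {m : Fin g → ℕ}

/-- The `(x + 1)`-st part of `λ(ℓ)` is at least `c` if and only if more than `x` entries of `ℓ` are;
those are counted by the blocks, with multiplicities `f_j`. -/
lemma le_part_sortDesc_iff (hn : ∑ i, f i = n) {c x : ℕ} (hx : x < n) :
    c ≤ part (sortDesc (m ∘ block hn)) (x + 1) ↔ x < ∑ j ∈ levelSet m c, f j := by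
  rw [part_succ _ hx, ← card_levelSet_block hn, ← card_levelSet_sortDesc]
  exact (lt_card_levelSet_iff (antitone_sortDesc _)).symm

/-- The elements of earlier blocks have larger values. -/
lemma Interlaced.lt (hw : w.semilength = n) (hA : A ∈ compatible f w) (hmu : Antitone mu)
    (h : Interlaced w A m mu) {k : ℕ} {i j : Fin g} (hi : i ∈ before A k) (hj : j ∉ before A k) :
    m j < m i := by
  obtain ⟨k₁, h1, h2⟩ := mem_before.1 hi
  obtain ⟨k₂, h3⟩ := (mem_compatible.1 hA).2.2.1 j
  have h4 : k ≤ k₂ := not_lt.1 fun h' => hj ((mem_before_iff hA h3).2 h')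
  have h5 := (h k₁ i h2).1
  have h6 := (h k₂ j h3).2 (by omega)
  have h7 := dyckM_mono w (show (k₁ : ℕ) + 1 ≤ k₂ by omega)
  have h8 := dyckM_lt_succ w k₁.2
  have h9 := dyckM_le_semilength w k₂.2.le
  have h10 := part_anti hmu (i := dyckM w k₁ + 1) (j := dyckM w k₂) (by omega) (by omega) (by omega)
  omega

lemma Interlaced.hasOverlapType (hn : ∑ i, f i = n) (hw : w.semilength = n)
    (hA : A ∈ compatible f w) (hmu : Antitone mu) (h : Interlaced w A m mu) :
    HasOverlapType w (sortDesc (m ∘ block hn)) mu := by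
  refine ⟨fun i hi => ?_, fun i hi1 hi => ?_⟩
  · have e1 := dyckL_lt_succ w hi
    have e2 := dyckL_le_semilength w (k := i + 1) hi
    rw [show dyckL w (i + 1) = dyckL w (i + 1) - 1 + 1 by omega, le_part_sortDesc_iff hn (by omega)]
    have h1 : ∑ j ∈ before A (i + 1), f j ≤
        ∑ j ∈ levelSet m (part mu (dyckM w i + 1)), f j := by
      refine Finset.sum_le_sum_of_subset fun j hj => ?_
      obtain ⟨k, h1, h2⟩ := mem_before.1 hj
      have h3 := dyckM_mono w (show (k : ℕ) ≤ i by omega)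
      have h4 := dyckM_lt_succ w hi
      have h5 := dyckM_le_semilength w (k := i + 1) hi
      exact mem_levelSet.2 ((part_anti hmu (by omega) (by omega) (by omega)).trans (h k j h2).1)
    rw [sum_before hA (by omega)] at h1
    omega
  · have e1 := dyckL_lt_succ w hi
    have e2 := dyckL_le_semilength w (k := i + 1) hi
    rw [← not_le, le_part_sortDesc_iff hn (by omega), not_lt, ← sum_before hA hi.le]
    refine Finset.sum_le_sum_of_subset fun j hj => ?_
    obtain ⟨k, hk⟩ := (mem_compatible.1 hA).2.2.1 j
    rw [mem_before_iff hA hk]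
    by_contra hle
    have h3 := dyckM_mono w (show i ≤ (k : ℕ) by omega)
    have h6 := dyckM_mono w hi1
    have h4 : 0 < dyckM w 1 := dyckM_lt_succ w (k := 0) (by omega)
    have h5 := dyckM_le_semilength w k.2.le
    have h7 := (h k j hk).2 (by omega)
    have h8 := part_anti hmu (i := dyckM w i) (j := dyckM w k) (by omega) (by omega) (by omega)
    have h9 := mem_levelSet.1 hj
    omega

/-- A pair of a given overlap type satisfies `μ ≤ λ`. -/
lemma HasOverlapType.le {lam : Fin n → ℕ} (hw : w.semilength = n) (hlam : Antitone lam)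
    (hmu : Antitone mu) (h : HasOverlapType w lam mu) : mu ≤ lam := by
  intro x
  obtain ⟨k, hk, h1, h2⟩ := exists_interval (dyckM_zero w) (r := numRuns w) (x := x)
    (by rw [dyckM_numRuns, hw]; exact x.2)
  have h3 := h.1 k hk
  have h4 := dyckM_le_dyckL w (k := k + 1) hk
  have h5 := dyckL_le_semilength w (k := k + 1) hk
  have h6 := part_anti hmu (i := dyckM w k + 1) (j := x + 1) (by omega) (by omega) (by omega)
  have h7 := part_anti hlam (i := x + 1) (j := dyckL w (k + 1)) (by omega) (by omega) (by omega)
  rw [part_succ _ x.2] at h6 h7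
  exact h6.trans (h3.trans h7)

/-- If `m` is interlaced with `A`, the sorting permutation of `m` lists the blocks of `A` one after
the other, and the value drops between two of them. -/
lemma Interlaced.induces (hw : w.semilength = n) (hA : A ∈ compatible f w)
    (hmu : Antitone mu) (h : Interlaced w A m mu) : Induces f w (weakOrderOf m) A := by
  set σ : Equiv.Perm (Fin g) := (weakOrderOf m).1 with hσ
  have hanti : Antitone fun x => m (σ x) := antitone_sortDesc m
  -- the sorting permutation lists the elements of the earlier blocks first
  have hlt : ∀ (k : ℕ) (x : Fin g), σ x ∈ before A k ↔ (x : ℕ) < (before A k).card := by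
    intro k x
    have h1 := mem_iff_lt_card (S := (before A k).image σ.symm) (fun y hy z hzy => by
      rw [Finset.mem_image] at hy ⊢
      obtain ⟨i, hi, rfl⟩ := hy
      by_contra hz
      have hz' : σ z ∉ before A k := fun h' => hz ⟨σ z, h', by simp⟩
      have h1 := h.lt hw hA hmu hi hz'
      have h2 := hanti hzy
      simp only [Equiv.apply_symm_apply] at h2
      omega) x
    rw [Finset.card_image_of_injective _ σ.symm.injective] at h1
    rw [← h1, Finset.mem_image]
    constructor
    · exact fun h' => ⟨σ x, h', by simp⟩
    · rintro ⟨i, hi, rfl⟩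
      simpa using hi
  refine ⟨hA, fun k => (before A k).card, by simp [before_zero], by simp [before_numRuns hA],
    fun k hk => card_before_lt hA hk, fun k hk1 hk => ?_, fun k => ?_⟩
  · obtain ⟨k, rfl⟩ := Nat.exists_eq_add_of_le' hk1
    have h1 := card_before_lt hA (k := k) (by omega)
    have h2 := card_before_lt hA hk
    have h3 : (before A (k + 1 + 1)).card ≤ g := (Finset.card_le_univ _).trans (by simp)
    refine Finset.mem_filter.2 ⟨Finset.mem_Ico.2 ⟨by simp only; omega, by simp only; omega⟩, ?_⟩
    simp only
    obtain ⟨t, ht⟩ : ∃ t, (before A (k + 1)).card = t + 1 := ⟨(before A (k + 1)).card - 1, by omega⟩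
    rw [ht, part_succ _ (show t + 1 < g by omega), part_succ _ (show t < g by omega)]
    exact h.lt hw hA hmu ((hlt (k + 1) ⟨t, by omega⟩).2 (by simp only; omega))
      (fun h' => by have := (hlt (k + 1) ⟨t + 1, by omega⟩).1 h'; simp only at this; omega)
  · ext j
    obtain ⟨x, rfl⟩ := σ.surjective j
    rw [Finset.mem_image]
    have h1 : σ x ∈ A k ↔ σ x ∈ before A (k + 1) ∧ σ x ∉ before A k := by
      rw [before_succ, Finset.mem_union]
      constructor
      · exact fun h' => ⟨Or.inr h', fun h'' => Finset.disjoint_left.1 (disjoint_before hA k) h'' h'⟩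
      · rintro ⟨h' | h', h''⟩
        · exact absurd h' h''
        · exact h'
    rw [h1, hlt, hlt]
    simp only [Finset.mem_filter, Finset.mem_univ, true_and]
    constructor
    · rintro ⟨h2, h3⟩
      exact ⟨x, ⟨by omega, h2⟩, rfl⟩
    · rintro ⟨y, ⟨h2, h3⟩, h4⟩
      rw [σ.injective h4] at h2 h3
      exact ⟨h3, by omega⟩

/-- Conversely, if the sorting permutation lists the blocks of `A` one after the other, then the
overlap type forces the inequalities of `Interlaced`: if one of them failed for `j` in the `k`-th
block, the number of entries of `ℓ` above a part of `μ` would be wrong by at least `f_j`. -/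
lemma interlaced_of_induces (hf : ∀ i, 0 < f i) (hn : ∑ i, f i = n) (hw : w.semilength = n)
    (hi : Induces f w (weakOrderOf m) A)
    (ho : HasOverlapType w (sortDesc (m ∘ block hn)) mu) : Interlaced w A m mu := by
  obtain ⟨hA, t, ht0, -, ht, -, hAt⟩ := hi
  set σ : Equiv.Perm (Fin g) := (weakOrderOf m).1 with hσ
  have hanti : Antitone fun x => m (σ x) := antitone_sortDesc m
  have hbefore : ∀ k ≤ numRuns w, ∀ x, σ x ∈ before A k ↔ (x : ℕ) < t k := by
    intro k
    induction k with
    | zero => simp [before_zero, ht0]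
    | succ k ih =>
      intro hk x
      have h1 := ht k (by omega)
      rw [before_succ A ⟨k, hk⟩, Finset.mem_union, ih (by omega), hAt ⟨k, hk⟩, Finset.mem_image]
      simp only [Finset.mem_filter, Finset.mem_univ, true_and]
      constructor
      · rintro (h2 | ⟨y, ⟨h2, h3⟩, h4⟩)
        · omega
        · rw [σ.injective h4] at h3
          exact h3
      · intro h2
        by_cases h3 : (x : ℕ) < t k
        · exact Or.inl h3
        · exact Or.inr ⟨x, ⟨by omega, h2⟩, rfl⟩
  intro k j hj
  have hj1 : j ∈ before A (k + 1) := (mem_before_iff hA hj).2 (by omega)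
  have hj0 : j ∉ before A k := fun h => lt_irrefl _ ((mem_before_iff hA hj).1 h)
  obtain ⟨x, rfl⟩ := σ.surjective j
  have hx1 := (hbefore (k + 1) k.2 x).1 hj1
  have hx0 := (hbefore k k.2.le x).not.1 hj0
  have hfx := hf (σ x)
  refine ⟨?_, fun hk0 => ?_⟩
  · by_contra hlt
    have e1 := dyckL_lt_succ w k.2
    have e2 := dyckL_le_semilength w (k := k + 1) k.2
    have h1 := ho.1 k k.2
    rw [show dyckL w (k + 1) = dyckL w (k + 1) - 1 + 1 by omega,
      le_part_sortDesc_iff hn (by omega)] at h1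
    have h2 : levelSet m (part mu (dyckM w k + 1)) ⊆ (before A (k + 1)).erase (σ x) := by
      intro i hi
      rw [mem_levelSet] at hi
      obtain ⟨y, rfl⟩ := σ.surjective i
      have hyx : y < x := by
        by_contra h'
        have := hanti (not_lt.1 h')
        simp only at this
        omega
      refine Finset.mem_erase.2 ⟨fun h' => hyx.ne (σ.injective h'), (hbefore (k + 1) k.2 y).2 ?_⟩
      exact lt_trans hyx hx1
    have h3 := Finset.sum_le_sum_of_subset (f := f) h2
    have h4 := Finset.add_sum_erase _ f hj1
    rw [sum_before hA (by omega)] at h4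
    omega
  · by_contra hle
    have e1 := dyckL_lt_succ w k.2
    have e2 := dyckL_le_semilength w (k := k + 1) k.2
    have h1 := ho.2 k hk0 k.2
    rw [← not_le, le_part_sortDesc_iff hn (by omega)] at h1
    have h2 : insert (σ x) (before A k) ⊆ levelSet m (part mu (dyckM w k)) := by
      intro i hi
      rw [mem_levelSet]
      rcases Finset.mem_insert.1 hi with rfl | hi
      · omega
      · obtain ⟨y, rfl⟩ := σ.surjective i
        have hy := (hbefore k k.2.le y).1 hi
        have := hanti (show y ≤ x from Fin.le_def.2 (by omega))
        simp only at this
        omega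
    have h3 := Finset.sum_le_sum_of_subset (f := f) h2
    rw [Finset.sum_insert hj0, sum_before hA k.2.le] at h3
    omega

/-- Every pair of a given overlap type is interlaced with some set partition: the `k`-th block
consists of the `j` for which `m_j` lies between the two parts of `μ` in question, and the overlap
type determines its size. -/
lemma HasOverlapType.exists_interlaced (hf : ∀ i, 0 < f i) (hn : ∑ i, f i = n)
    (hw : w.semilength = n) (hmu : Antitone mu)
    (h : HasOverlapType w (sortDesc (m ∘ block hn)) mu) :
    ∃ A ∈ compatible f w, Interlaced w A m mu := by
  -- exactly `L_k` entries of `ℓ` are at least `μ_{M_k}`, and exactly `L_{k+1}` are at least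
  -- `μ_{M_k + 1}`; one of the two bounds comes from the overlap type, the other from monotonicity
  have hupper : ∀ k, 1 ≤ k → k < numRuns w →
      ∑ j ∈ levelSet m (part mu (dyckM w k)), f j ≤ dyckL w k := by
    intro k hk1 hk
    have e1 := dyckL_lt_succ w hk
    have e2 := dyckL_le_semilength w (k := k + 1) hk
    have h1 := h.2 k hk1 hk
    rwa [← not_le, le_part_sortDesc_iff hn (by omega), not_lt] at h1
  have hlower : ∀ k, k < numRuns w →
      ∑ j ∈ levelSet m (part mu (dyckM w k + 1)), f j = dyckL w (k + 1) := by
    intro k hk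
    have e1 := dyckL_lt_succ w hk
    have e2 := dyckL_le_semilength w (k := k + 1) hk
    have h1 := h.1 k hk
    rw [show dyckL w (k + 1) = dyckL w (k + 1) - 1 + 1 by omega,
      le_part_sortDesc_iff hn (by omega)] at h1
    refine le_antisymm ?_ (by omega)
    by_cases hk1 : k + 1 < numRuns w
    · have e3 := dyckM_lt_succ w hk
      have e4 := dyckM_le_semilength w (k := k + 1) hk
      have h2 := part_anti hmu (i := dyckM w k + 1) (j := dyckM w (k + 1)) (by omega) (by omega)
        (by omega)
      refine le_trans (Finset.sum_le_sum_of_subset fun j hj => ?_) (hupper (k + 1) (by omega) hk1)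
      exact mem_levelSet.2 (h2.trans (mem_levelSet.1 hj))
    · rw [show k + 1 = numRuns w by omega, dyckL_numRuns, hw]
      exact (Finset.sum_le_sum_of_subset (Finset.subset_univ _)).trans hn.le
  have hupper' : ∀ k, 1 ≤ k → k < numRuns w →
      ∑ j ∈ levelSet m (part mu (dyckM w k)), f j = dyckL w k := by
    intro k hk1 hk
    refine le_antisymm (hupper k hk1 hk) ?_
    obtain ⟨k, rfl⟩ := Nat.exists_eq_add_of_le' hk1
    rw [← hlower k (by omega)]
    have e3 := dyckM_lt_succ w (k := k) (by omega)
    have e4 := dyckM_le_semilength w (k := k + 1) hk.le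
    have h2 := part_anti hmu (i := dyckM w k + 1) (j := dyckM w (k + 1)) (by omega) (by omega)
      (by omega)
    exact Finset.sum_le_sum_of_subset fun j hj => mem_levelSet.2 (h2.trans (mem_levelSet.1 hj))
  let A : Fin (numRuns w) → Finset (Fin g) := fun k => Finset.univ.filter fun j =>
    part mu (dyckM w k + 1) ≤ m j ∧ (0 < (k : ℕ) → m j < part mu (dyckM w k))
  have hmem : ∀ {k j}, j ∈ A k ↔
      part mu (dyckM w k + 1) ≤ m j ∧ (0 < (k : ℕ) → m j < part mu (dyckM w k)) := by
    intro k j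
    simp [A]
  have hsum : ∀ k, ∑ j ∈ A k, f j = dyckL w (k + 1) - dyckL w k := by
    intro k
    rw [← hlower k k.2]
    rcases Nat.eq_zero_or_pos (k : ℕ) with h0 | hpos
    · rw [h0, dyckL_zero, Nat.sub_zero]
      refine Finset.sum_congr ?_ fun _ _ => rfl
      ext j
      rw [hmem, mem_levelSet]
      simp [h0]
    · have h1 : A k = levelSet m (part mu (dyckM w k + 1)) \ levelSet m (part mu (dyckM w k)) := by
        ext j
        rw [hmem, Finset.mem_sdiff, mem_levelSet, mem_levelSet, not_le]
        simp [hpos]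
      have e3 := dyckM_lt_succ w k.2
      have e4 := dyckM_le_semilength w (k := k + 1) k.2
      have e5 : 0 < dyckM w 1 := dyckM_lt_succ w (k := 0) (by omega)
      have e6 : dyckM w 1 ≤ dyckM w k := dyckM_mono w hpos
      have h2 := part_anti hmu (i := dyckM w k) (j := dyckM w k + 1) (by omega) (by omega)
        (by omega)
      have h3 : levelSet m (part mu (dyckM w k)) ⊆ levelSet m (part mu (dyckM w k + 1)) :=
        fun j hj => mem_levelSet.2 (h2.trans (mem_levelSet.1 hj))
      rw [h1, ← hupper' k hpos k.2, ← Finset.sum_sdiff h3]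
      omega
  refine ⟨A, mem_compatible.2 ⟨fun k => ?_, ?_, fun j => ?_, hsum⟩, fun k j hj => hmem.1 hj⟩
  · by_contra h'
    have h1 := hsum k
    rw [Finset.not_nonempty_iff_eq_empty.1 h', Finset.sum_empty] at h1
    have := dyckL_lt_succ w k.2
    omega
  · have key : ∀ k k', k < k' → Disjoint (A k) (A k') := by
      intro k k' hkk
      rw [Finset.disjoint_left]
      intro j hj hj'
      rw [hmem] at hj hj'
      have hkk' : (k : ℕ) < k' := hkk
      have e1 := dyckM_lt_succ w k.2
      have e2 := dyckM_mono w (show (k : ℕ) + 1 ≤ k' from hkk)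
      have e3 := dyckM_le_semilength w k'.2.le
      have h1 := part_anti hmu (i := dyckM w k + 1) (j := dyckM w k') (by omega) (by omega)
        (by omega)
      have h2 := hj'.2 (by omega)
      omega
    intro k k' hne
    rcases lt_or_gt_of_ne hne with hlt | hlt
    · exact key k k' hlt
    · exact (key k' k hlt).symm
  · -- the block of `j` follows the last run whose parts of `μ` all exceed `m j`
    have hr : 0 < numRuns w := numRuns_pos (by
      rw [hw, ← hn]
      exact lt_of_lt_of_le (hf j)
        (Finset.single_le_sum (fun i _ => Nat.zero_le (f i)) (Finset.mem_univ j)))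
    let p : ℕ → Prop := fun k => k < numRuns w ∧ (0 < k → m j < part mu (dyckM w k))
    have : DecidablePred p := Classical.decPred p
    have hp0 : p 0 := ⟨hr, by simp⟩
    have hp := Nat.findGreatest_spec (P := p) (Nat.zero_le (numRuns w)) hp0
    set k := Nat.findGreatest p (numRuns w) with hk
    refine ⟨⟨k, hp.1⟩, hmem.2 ⟨?_, hp.2⟩⟩
    -- otherwise `L_{k+1}` entries of `ℓ` and those of the block of `j` exceed the next part of `μ`
    by_contra hlt
    have h1 : insert j (levelSet m (part mu (dyckM w k + 1))) ⊆ levelSet m (m j) := by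
      intro i hi
      rw [mem_levelSet]
      rcases Finset.mem_insert.1 hi with rfl | hi
      · exact le_rfl
      · have := mem_levelSet.1 hi
        simp only at hlt
        omega
    have h2 := Finset.sum_le_sum_of_subset (f := f) h1
    rw [Finset.sum_insert (fun h' => hlt (mem_levelSet.1 h')), hlower k hp.1] at h2
    have h3 := hf j
    by_cases hk1 : k + 1 < numRuns w
    · have h4 : ¬ p (k + 1) := Nat.findGreatest_is_greatest (P := p) (n := numRuns w) (by omega) hk1.le
      have h5 : part mu (dyckM w (k + 1)) ≤ m j := by
        by_contra h'
        exact h4 ⟨hk1, fun _ => not_le.1 h'⟩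
      have h6 : levelSet m (m j) ⊆ levelSet m (part mu (dyckM w (k + 1))) :=
        fun i hi => mem_levelSet.2 (h5.trans (mem_levelSet.1 hi))
      have h7 := Finset.sum_le_sum_of_subset (f := f) h6
      have h8 := hupper (k + 1) (by omega) hk1
      omega
    · have h6 := Finset.sum_le_sum_of_subset (f := f) (Finset.subset_univ (levelSet m (m j)))
      rw [hn] at h6
      rw [show k + 1 = numRuns w by omega, dyckL_numRuns, hw] at h2
      omega

/-- A pair is interlaced with at most one set partition. -/
lemma Interlaced.unique (hw : w.semilength = n) {A' : Fin (numRuns w) → Finset (Fin g)}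
    (hA : A ∈ compatible f w) (hA' : A' ∈ compatible f w) (hmu : Antitone mu)
    (h : Interlaced w A m mu) (h' : Interlaced w A' m mu) : A = A' := by
  have key : ∀ (k k' : Fin (numRuns w)) (B B' : Fin (numRuns w) → Finset (Fin g)),
      Interlaced w B m mu → Interlaced w B' m mu → ∀ j ∈ B k, j ∈ B' k' → k' ≤ k := by
    intro k k' B B' hB hB' j hj hj'
    by_contra hlt
    have hkk' : (k : ℕ) < k' := not_le.1 hlt
    have e1 := dyckM_lt_succ w k.2
    have e2 := dyckM_mono w (show (k : ℕ) + 1 ≤ k' from hkk')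
    have e3 := dyckM_le_semilength w k'.2.le
    have h1 := part_anti hmu (i := dyckM w k + 1) (j := dyckM w k') (by omega) (by omega)
      (by omega)
    have h2 := (hB' k' j hj').2 (by omega)
    have h3 := (hB k j hj).1
    omega
  have hsub : ∀ (B B' : Fin (numRuns w) → Finset (Fin g)), B' ∈ compatible f w →
      Interlaced w B m mu → Interlaced w B' m mu → ∀ k, B k ⊆ B' k := by
    intro B B' hB hI hI' k j hj
    obtain ⟨k', hk'⟩ := (mem_compatible.1 hB).2.2.1 j
    rwa [le_antisymm (key k' k B' B hI' hI j hk' hj) (key k k' B B' hI hI' j hj hk')]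
  exact funext fun k => Finset.Subset.antisymm (hsub A A' hA' h h' k) (hsub A' A hA h' h k)

end Interlaced

/-! ### Level states -/

section States

variable {g n : ℕ} {f : Fin g → ℕ} {w : DyckWord} {A : Fin (numRuns w) → Finset (Fin g)}

/-- The subset of `Fin g ⊕ Fin n` formed by `S` and the first `M` places of `Fin n`. -/
def state (n : ℕ) (S : Finset (Fin g)) (M : ℕ) : Finset (Fin g ⊕ Fin n) :=
  S.disjSum (Finset.univ.filter fun x : Fin n => (x : ℕ) < M)

@[simp] lemma toLeft_state (S : Finset (Fin g)) (M : ℕ) : (state n S M).toLeft = S := by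
  simp [state]

lemma card_toRight_state (S : Finset (Fin g)) {M : ℕ} (hM : M ≤ n) :
    (state n S M).toRight.card = M := by
  rw [state, Finset.toRight_disjSum]
  simpa using card_filter_interval (a := 0) hM

lemma inl_mem_state {S : Finset (Fin g)} {M : ℕ} {j : Fin g} :
    Sum.inl j ∈ state n S M ↔ j ∈ S := by simp [state]

lemma inr_mem_state {S : Finset (Fin g)} {M : ℕ} {x : Fin n} :
    Sum.inr x ∈ state n S M ↔ (x : ℕ) < M := by simp [state]

lemma state_subset {S S' : Finset (Fin g)} {M M' : ℕ} (hS : S ⊆ S') (hM : M ≤ M') :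
    state n S M ⊆ state n S' M' := by
  refine Finset.disjSum_mono hS fun x hx => ?_
  simp only [Finset.mem_filter, Finset.mem_univ, true_and] at hx ⊢
  omega

/-- The set of the members of `A k` with positions in `I`. -/
def pick (A : Fin (numRuns w) → Finset (Fin g)) (k : Fin (numRuns w))
    (I : Finset (Fin (A k).card)) : Finset (Fin g) :=
  I.map ((A k).orderEmbOfFin rfl).toEmbedding

lemma pick_subset (k : Fin (numRuns w)) (I : Finset (Fin (A k).card)) : pick A k I ⊆ A k := by
  intro j hj
  obtain ⟨i, -, rfl⟩ := Finset.mem_map.1 hj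
  exact Finset.orderEmbOfFin_mem _ rfl i

lemma pick_subset_pick {k : Fin (numRuns w)} {I I' : Finset (Fin (A k).card)} :
    pick A k I ⊆ pick A k I' ↔ I ⊆ I' := Finset.map_subset_map

lemma exists_pick_eq (k : Fin (numRuns w)) {S : Finset (Fin g)} (hS : S ⊆ A k) :
    ∃ I, pick A k I = S := by
  refine ⟨Finset.univ.filter fun i => (A k).orderEmbOfFin rfl i ∈ S, ?_⟩
  ext j
  simp only [pick, Finset.mem_map, Finset.mem_filter, Finset.mem_univ, true_and,
    RelEmbedding.coe_toEmbedding]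
  constructor
  · rintro ⟨i, h, rfl⟩
    exact h
  · intro h
    have h1 : j ∈ Set.range ((A k).orderEmbOfFin rfl) := by
      rw [Finset.range_orderEmbOfFin]
      exact hS h
    obtain ⟨i, rfl⟩ := h1
    exact ⟨i, h, rfl⟩

/-- The states through which the level sets of a pair of given type can pass: for every `k`, first
those in which part of the block `A_k` has been reached, then those in which part of the following
run of ones has been reached. -/
def stateOf (n : ℕ) (A : Fin (numRuns w) → Finset (Fin g)) :
    (Σ k : Fin (numRuns w), Finset (Fin (A k).card) ⊕ ℕ) → Finset (Fin g ⊕ Fin n)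
  | ⟨k, Sum.inl I⟩ => state n (before A k ∪ pick A k I) (dyckM w k)
  | ⟨k, Sum.inr i⟩ => state n (before A (k + 1)) (dyckM w k + i)

/-- The length of the `k`-th run of ones. -/
def runLen (w : DyckWord) (k : ℕ) : ℕ := dyckM w (k + 1) - dyckM w k

/-- The indices, in the `k`-th step, of the states. -/
def stepIndex (A : Fin (numRuns w) → Finset (Fin g)) (k : Fin (numRuns w)) :
    Finset (Finset (Fin (A k).card) ⊕ ℕ) :=
  (Finset.univ.filter Finset.Nonempty).disjSum (Finset.Icc 1 (runLen w k))

/-- The indices of the states. -/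
def stateIndex (A : Fin (numRuns w) → Finset (Fin g)) :
    Finset (Σ k : Fin (numRuns w), Finset (Fin (A k).card) ⊕ ℕ) :=
  Finset.univ.sigma (stepIndex A)

lemma inl_mem_stateIndex {k : Fin (numRuns w)} {I : Finset (Fin (A k).card)} :
    (⟨k, Sum.inl I⟩ : Σ k : Fin (numRuns w), Finset (Fin (A k).card) ⊕ ℕ) ∈ stateIndex A ↔
      I.Nonempty := by
  simp [stateIndex, stepIndex]

lemma inr_mem_stateIndex {k : Fin (numRuns w)} {i : ℕ} :
    (⟨k, Sum.inr i⟩ : Σ k : Fin (numRuns w), Finset (Fin (A k).card) ⊕ ℕ) ∈ stateIndex A ↔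
      1 ≤ i ∧ i ≤ runLen w k := by
  simp [stateIndex, stepIndex]

lemma dyckM_add_runLen (w : DyckWord) (k : ℕ) : dyckM w k + runLen w k = dyckM w (k + 1) := by
  have := dyckM_mono w (show k ≤ k + 1 by omega)
  rw [runLen]
  omega

lemma runLen_pos {k : ℕ} (hk : k < numRuns w) : 1 ≤ runLen w k := by
  have := dyckM_lt_succ w hk
  rw [runLen]
  omega

/-- The number of places of `Fin n` in a state. -/
def stateHeight (A : Fin (numRuns w) → Finset (Fin g)) :
    (Σ k : Fin (numRuns w), Finset (Fin (A k).card) ⊕ ℕ) → ℕ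
  | ⟨k, Sum.inl _⟩ => dyckM w k
  | ⟨k, Sum.inr i⟩ => dyckM w k + i

lemma card_toRight_stateOf (hw : w.semilength = n)
    {q : Σ k : Fin (numRuns w), Finset (Fin (A k).card) ⊕ ℕ} (hq : q ∈ stateIndex A) :
    (stateOf n A q).toRight.card = stateHeight A q := by
  rcases q with ⟨k, I | i⟩
  · exact card_toRight_state _ (hw ▸ dyckM_le_semilength w k.2.le)
  · have h1 := inr_mem_stateIndex.1 hq
    have h2 := dyckM_add_runLen w k
    have h3 := dyckM_le_semilength w (k := k + 1) k.2
    exact card_toRight_state _ (by omega)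

lemma dyckM_strictMono {k k' : ℕ} (h : k < k') (hk' : k' ≤ numRuns w) : dyckM w k < dyckM w k' :=
  (dyckM_lt_succ w (by omega)).trans_le (dyckM_mono w h)

/-- Distinct indices have distinct states. -/
lemma stateOf_injOn (hw : w.semilength = n) (hA : A ∈ compatible f w) :
    Set.InjOn (stateOf n A) (stateIndex A) := by
  -- the number of places in `Fin n` almost determines the index
  have key : ∀ (k k' : Fin (numRuns w)) (I : Finset (Fin (A k).card)) (i : ℕ), I.Nonempty →
      1 ≤ i → i ≤ runLen w k' → dyckM w k = dyckM w k' + i →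
      before A k ∪ pick A k I ≠ before A (k' + 1) := by
    intro k k' I i hI hi1 hi2 hM hS
    have h1 := dyckM_add_runLen w k'
    have hk : (k : ℕ) = k' + 1 := by
      rcases lt_trichotomy (k : ℕ) (k' + 1) with h | h | h
      · have := dyckM_mono w (show (k : ℕ) ≤ k' by omega)
        omega
      · exact h
      · have := dyckM_strictMono h k.2.le
        omega
    obtain ⟨i, hi⟩ := hI
    have h2 : (A k).orderEmbOfFin rfl i ∈ pick A k I := Finset.mem_map_of_mem _ hi
    have h3 : (A k).orderEmbOfFin rfl i ∈ before A k := by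
      rw [hk, ← hS]
      exact Finset.mem_union_right _ h2
    exact Finset.disjoint_left.1 (disjoint_before hA k) h3 (pick_subset k I h2)
  intro q hq q' hq' h
  rw [Finset.mem_coe] at hq hq'
  have hM := congrArg (fun S => S.toRight.card) h
  simp only [card_toRight_stateOf hw hq, card_toRight_stateOf hw hq'] at hM
  have hS := congrArg Finset.toLeft h
  rcases q with ⟨k, I | i⟩ <;> rcases q' with ⟨k', I' | i'⟩ <;>
    simp only [stateHeight, stateOf, toLeft_state] at hM hS
  · have hk : k = k' := by
      rcases lt_trichotomy (k : ℕ) k' with h | h | h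
      · have := dyckM_strictMono h k'.2.le
        omega
      · exact Fin.ext h
      · have := dyckM_strictMono h k.2.le
        omega
    subst hk
    have h1 : ∀ I I' : Finset (Fin (A k).card),
        before A k ∪ pick A k I = before A k ∪ pick A k I' → I ⊆ I' := by
      intro I I' hS
      rw [← pick_subset_pick (A := A) (k := k)]
      intro j hj
      have h2 : j ∈ before A k ∪ pick A k I' := hS ▸ Finset.mem_union_right _ hj
      rcases Finset.mem_union.1 h2 with h3 | h3
      · exact absurd (pick_subset k I hj) (Finset.disjoint_left.1 (disjoint_before hA k) h3)
      · exact h3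
    rw [Finset.Subset.antisymm (h1 I I' hS) (h1 I' I hS.symm)]
  · have h1 := inr_mem_stateIndex.1 hq'
    exact absurd hS (key k k' I i' (inl_mem_stateIndex.1 hq) h1.1 h1.2 hM)
  · have h1 := inr_mem_stateIndex.1 hq
    exact absurd hS.symm (key k' k I' i (inl_mem_stateIndex.1 hq') h1.1 h1.2 hM.symm)
  · have h1 := inr_mem_stateIndex.1 hq
    have h1' := inr_mem_stateIndex.1 hq'
    have h2 := dyckM_add_runLen w k
    have h2' := dyckM_add_runLen w k'
    have hk : k = k' := by
      rcases lt_trichotomy (k : ℕ) k' with h | h | h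
      · have := dyckM_mono w (show (k : ℕ) + 1 ≤ k' from h)
        omega
      · exact Fin.ext h
      · have := dyckM_mono w (show (k' : ℕ) + 1 ≤ k from h)
        omega
    subst hk
    rw [show i = i' by omega]

/-- States of earlier steps are contained in those of later ones. -/
lemma stateOf_subset_of_lt {q q' : Σ k : Fin (numRuns w), Finset (Fin (A k).card) ⊕ ℕ}
    (hq : q ∈ stateIndex A) (h : q.1 < q'.1) : stateOf n A q ⊆ stateOf n A q' := by
  have h0 : (q.1 : ℕ) + 1 ≤ q'.1 := h
  have h1 : stateOf n A q ⊆ state n (before A (q.1 + 1)) (dyckM w (q.1 + 1)) := by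
    rcases q with ⟨k, I | i⟩
    · refine state_subset ?_ (dyckM_mono w (by simp))
      rw [before_succ]
      exact Finset.union_subset_union_right (pick_subset k I)
    · have h1 := inr_mem_stateIndex.1 hq
      have h2 := dyckM_add_runLen w k
      exact state_subset le_rfl (by simp only; omega)
  refine h1.trans ?_
  rcases q' with ⟨k', I' | i'⟩
  · exact state_subset ((before_mono A h0).trans Finset.subset_union_left) (dyckM_mono w h0)
  · exact state_subset (before_mono A (h0.trans (Nat.le_succ _)))
      ((dyckM_mono w h0).trans (Nat.le_add_right _ _))

lemma stateOf_nonempty (hw : w.semilength = n)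
    {q : Σ k : Fin (numRuns w), Finset (Fin (A k).card) ⊕ ℕ} (hq : q ∈ stateIndex A) :
    (stateOf n A q).Nonempty := by
  rcases q with ⟨k, I | i⟩
  · obtain ⟨i, hi⟩ := inl_mem_stateIndex.1 hq
    exact ⟨Sum.inl ((A k).orderEmbOfFin rfl i),
      inl_mem_state.2 (Finset.mem_union_right _ (Finset.mem_map_of_mem _ hi))⟩
  · have h1 := inr_mem_stateIndex.1 hq
    have h2 := dyckM_add_runLen w k
    have h3 := dyckM_le_semilength w (k := k + 1) k.2
    exact ⟨Sum.inr ⟨0, by omega⟩, inr_mem_state.2 (by simp only; omega)⟩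

/-- States belonging to different blocks or runs are comparable, hence the chains of states are
described by chains of subsets of each block and arbitrary subsets of each run. -/
lemma isFlag_image_stateOf (hw : w.semilength = n) (hA : A ∈ compatible f w)
    {z : Finset (Σ k : Fin (numRuns w), Finset (Fin (A k).card) ⊕ ℕ)} (hz : z ⊆ stateIndex A) :
    IsFlag (z.image (stateOf n A)) ↔
      ∀ k, IsFlag ((stepIndex A k).filter fun x => ⟨k, x⟩ ∈ z).toLeft := by
  have hmem : ∀ k I, I ∈ ((stepIndex A k).filter fun x => (⟨k, x⟩ :
      Σ k : Fin (numRuns w), Finset (Fin (A k).card) ⊕ ℕ) ∈ z).toLeft ↔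
      (⟨k, Sum.inl I⟩ : Σ k : Fin (numRuns w), Finset (Fin (A k).card) ⊕ ℕ) ∈ z := by
    intro k I
    rw [Finset.mem_toLeft, Finset.mem_filter, and_iff_right_iff_imp]
    intro h
    simpa [stateIndex] using hz h
  have hsub : ∀ k (I I' : Finset (Fin (A k).card)),
      stateOf n A ⟨k, Sum.inl I⟩ ⊆ stateOf n A ⟨k, Sum.inl I'⟩ ↔ I ⊆ I' := by
    intro k I I'
    constructor
    · intro h
      rw [← pick_subset_pick (A := A) (k := k)]
      intro j hj
      have h2 : j ∈ before A k ∪ pick A k I' := by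
        rw [← inl_mem_state (n := n)]
        exact h (inl_mem_state.2 (Finset.mem_union_right _ hj))
      rcases Finset.mem_union.1 h2 with h3 | h3
      · exact absurd (pick_subset k I hj) (Finset.disjoint_left.1 (disjoint_before hA k) h3)
      · exact h3
    · exact fun h => state_subset (Finset.union_subset_union_right (pick_subset_pick.2 h)) le_rfl
  constructor
  · rintro ⟨-, h2⟩ k
    refine ⟨fun I hI => inl_mem_stateIndex.1 (hz ((hmem k I).1 hI)), fun I hI I' hI' => ?_⟩
    rw [← hsub, ← hsub]
    exact h2 _ (Finset.mem_image_of_mem _ ((hmem k I).1 hI)) _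
      (Finset.mem_image_of_mem _ ((hmem k I').1 hI'))
  · intro h
    refine ⟨fun S hS => ?_, fun S hS S' hS' => ?_⟩
    · obtain ⟨q, hq, rfl⟩ := Finset.mem_image.1 hS
      exact stateOf_nonempty hw (hz hq)
    · obtain ⟨q, hq, rfl⟩ := Finset.mem_image.1 hS
      obtain ⟨q', hq', rfl⟩ := Finset.mem_image.1 hS'
      rcases lt_trichotomy q.1 q'.1 with hlt | heq | hlt
      · exact Or.inl (stateOf_subset_of_lt (hz hq) hlt)
      · obtain ⟨k, x⟩ := q
        obtain ⟨k', x'⟩ := q'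
        simp only at heq
        subst heq
        have hlr : ∀ (I : Finset (Fin (A k).card)) (i : ℕ),
            stateOf n A ⟨k, Sum.inl I⟩ ⊆ stateOf n A ⟨k, Sum.inr i⟩ := fun I i =>
          state_subset (by rw [before_succ]; exact Finset.union_subset_union_right (pick_subset k I))
            (by omega)
        rcases x with I | i <;> rcases x' with I' | i'
        · rw [hsub, hsub]
          exact (h k).2 I ((hmem k I).2 hq) I' ((hmem k I').2 hq')
        · exact Or.inl (hlr I i')
        · exact Or.inr (hlr I' i)
        · rcases le_total i i' with hii | hii
          · exact Or.inl (state_subset le_rfl (by omega))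
          · exact Or.inr (state_subset le_rfl (by omega))
      · exact Or.inr (stateOf_subset_of_lt (hz hq') hlt)

/-- The level sets of a pair all belong to the states of `(w, A)`, and include all those in which a
run of ones, except the last, has been exhausted. -/
def FitsStates (n : ℕ) (A : Fin (numRuns w) → Finset (Fin g))
    (y : Finset (Finset (Fin g ⊕ Fin n))) : Prop :=
  y ⊆ (stateIndex A).image (stateOf n A) ∧
    ∀ k : Fin (numRuns w), (k : ℕ) + 1 < numRuns w → stateOf n A ⟨k, Sum.inr (runLen w k)⟩ ∈ y

lemma levelSet_elim {m : Fin g → ℕ} {mu : Fin n → ℕ} (hmu : Antitone mu) (x : ℕ) :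
    levelSet (Sum.elim m mu) x = state n (levelSet m x) (levelSet mu x).card := by
  ext (j | i)
  · simp [inl_mem_state]
  · rw [inr_mem_state, lt_card_levelSet_iff hmu]
    simp

lemma lt_card_levelSet_iff_part {mu : Fin n → ℕ} (hmu : Antitone mu) {x c : ℕ} (hx : x < n) :
    x < (levelSet mu c).card ↔ c ≤ part mu (x + 1) := by
  rw [part_succ mu hx]
  exact lt_card_levelSet_iff hmu (j := ⟨x, hx⟩)

/-- The level sets of an interlaced pair pass through the states of `(w, A)` in order: the blocks
and the runs of ones are reached and exhausted alternately. -/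
lemma fitsStates_of_interlaced (hw : w.semilength = n) (hr : 0 < numRuns w)
    (hA : A ∈ compatible f w)
    {m : Fin g → ℕ} {mu : Fin n → ℕ} (hmu : Antitone mu) (h : Interlaced w A m mu) :
    FitsStates n A (levelSets (Sum.elim m mu)) := by
  have hcard : ∀ x, (levelSet mu x).card ≤ n := fun x => (Finset.card_le_univ _).trans (by simp)
  -- the blocks before the last one whose run has been reached are exhausted
  have hfull : ∀ x (k : Fin (numRuns w)), dyckM w k < (levelSet mu x).card →
      before A (k + 1) ⊆ levelSet m x := by
    intro x k hk j hj
    obtain ⟨k', h1, h2⟩ := mem_before.1 hj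
    have h3 := dyckM_mono w (show (k' : ℕ) ≤ k by omega)
    have h4 := (lt_card_levelSet_iff_part hmu (x := dyckM w k') (c := x)
      (by have := hcard x; omega)).1 (by omega)
    exact mem_levelSet.2 (h4.trans (h k' j h2).1)
  -- the blocks preceded by a run which is not exhausted have not been reached
  have hnone : ∀ x (k : Fin (numRuns w)), (levelSet mu x).card < dyckM w k →
      ∀ j ∈ A k, j ∉ levelSet m x := by
    intro x k hk j hj hjx
    have h0 : 0 < (k : ℕ) := by
      by_contra h0
      rw [show (k : ℕ) = 0 by omega] at hk
      simp at hk
    have h1 := (h k j hj).2 h0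
    have h2 := mem_levelSet.1 hjx
    have h3 := dyckM_le_semilength w k.2.le
    have h4 := (lt_card_levelSet_iff_part hmu (x := dyckM w k - 1) (c := x) (by omega)).2
      (by rw [Nat.sub_add_cancel (by omega)]; omega)
    omega
  -- between two runs, at most one further block has been reached
  have hstate : ∀ x (k : Fin (numRuns w)), (levelSet mu x).card = dyckM w k →
      before A k ⊆ levelSet m x → levelSet m x ⊆ before A (k + 1) := by
    intro x k hk _ j hj
    obtain ⟨k', hk'⟩ := (mem_compatible.1 hA).2.2.1 j
    rw [mem_before_iff hA hk']
    by_contra hlt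
    have := dyckM_strictMono (show (k : ℕ) < k' by omega) k'.2.le
    exact hnone x k' (by omega) j hk' hj
  refine ⟨fun S hS => ?_, fun k hk => ?_⟩
  · obtain ⟨x, hx, hne, rfl⟩ := mem_levelSets.1 hS
    rw [levelSet_elim hmu] at hne ⊢
    rw [Finset.mem_image]
    -- either the level falls inside a block, or inside a run
    have hblock : ∀ k : Fin (numRuns w), (levelSet mu x).card = dyckM w k →
        before A k ⊆ levelSet m x → levelSet m x ≠ before A k → ∃ q ∈ stateIndex A,
          stateOf n A q = state n (levelSet m x) (levelSet mu x).card := by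
      intro k hk hsub hne'
      obtain ⟨I, hI⟩ := exists_pick_eq (A := A) k (S := levelSet m x \ before A k) (by
        intro j hj
        rw [Finset.mem_sdiff] at hj
        have := hstate x k hk hsub hj.1
        rw [before_succ, Finset.mem_union] at this
        exact this.resolve_left hj.2)
      refine ⟨⟨k, Sum.inl I⟩, inl_mem_stateIndex.2 ?_, ?_⟩
      · by_contra hemp
        rw [Finset.not_nonempty_iff_eq_empty] at hemp
        rw [hemp, pick, Finset.map_empty, eq_comm, Finset.sdiff_eq_empty_iff_subset] at hI
        exact hne' (Finset.Subset.antisymm hI hsub)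
      · rw [stateOf, hI, hk, Finset.union_sdiff_of_subset hsub]
    rcases Nat.eq_zero_or_pos (levelSet mu x).card with h0 | hpos
    · refine hblock ⟨0, hr⟩ h0 (by simp [before_zero]) ?_
      simp only [before_zero]
      intro hemp
      rw [h0, hemp] at hne
      obtain ⟨v, hv⟩ := hne
      simp [state] at hv
    · obtain ⟨k, hk, h1, h2⟩ := exists_interval (dyckM_zero w) (r := numRuns w)
        (x := (levelSet mu x).card - 1) (by
          rw [dyckM_numRuns, hw]
          have := hcard x
          omega)
      have hlen := dyckM_add_runLen w k
      have hsub := hfull x ⟨k, hk⟩ (by simp only; omega)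
      by_cases heq : levelSet m x = before A (k + 1)
      · refine ⟨⟨⟨k, hk⟩, Sum.inr ((levelSet mu x).card - dyckM w k)⟩,
          inr_mem_stateIndex.2 (by simp only; omega), ?_⟩
        simp only [stateOf]
        rw [heq, Nat.add_sub_cancel' (by omega)]
      · have hM : (levelSet mu x).card = dyckM w (k + 1) ∧ k + 1 < numRuns w := by
          by_contra hcon
          refine heq (Finset.Subset.antisymm (fun j hj => ?_) hsub)
          obtain ⟨k', hk'⟩ := (mem_compatible.1 hA).2.2.1 j
          rw [mem_before_iff hA hk']
          by_contra hlt
          have h3 := dyckM_mono w (show k + 1 ≤ k' by omega)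
          have h4 := k'.2
          exact hnone x k' (by omega) j hk' hj
        exact hblock ⟨k + 1, hM.2⟩ hM.1 hsub heq
  · have hk' : (k : ℕ) + 1 < numRuns w := hk
    have hlen := dyckM_add_runLen w k
    have e1 := dyckM_lt_succ w k.2
    have e2 := dyckM_lt_succ w hk
    have e3 := dyckM_le_semilength w (k := (k : ℕ) + 1 + 1) hk
    -- the run is exhausted, and the next block is not reached, at the level of its last part of `μ`
    obtain ⟨j, hj⟩ := (mem_compatible.1 hA).1 ⟨k + 1, hk⟩
    have h1 := h ⟨k + 1, hk⟩ j hj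
    simp only at h1
    set x := part mu (dyckM w (k + 1)) with hx
    have h2 := h1.2 (by omega)
    have h3 : dyckM w (k + 1) ≤ (levelSet mu x).card := by
      have := (lt_card_levelSet_iff_part hmu (x := dyckM w (k + 1) - 1) (c := x) (by omega)).2
        (by rw [Nat.sub_add_cancel (by omega)])
      omega
    have h4 : (levelSet mu x).card = dyckM w (k + 1) := by
      refine le_antisymm ?_ h3
      by_contra hlt
      have := (lt_card_levelSet_iff_part hmu (x := dyckM w (k + 1)) (c := x) (by omega)).1
        (by omega)
      omega
    have h5 : levelSet m x = before A (k + 1) := by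
      refine Finset.Subset.antisymm (fun i hi => ?_) (hfull x k (by omega))
      have h6 := hstate x ⟨k + 1, hk⟩ h4 (hfull x k (by omega)) hi
      rw [before_succ, Finset.mem_union] at h6
      refine h6.resolve_right fun h7 => ?_
      have h8 := (h ⟨k + 1, hk⟩ i h7).2 (by simp)
      rw [mem_levelSet] at hi
      simp only at h8
      omega
    refine mem_levelSets.2 ⟨x, by omega, ?_, ?_⟩
    · exact stateOf_nonempty hw (inr_mem_stateIndex.2 ⟨runLen_pos k.2, le_rfl⟩)
    · rw [levelSet_elim hmu, h4, h5, stateOf, hlen]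

/-- Conversely, a pair whose level sets pass through the states of `(w, A)` is interlaced: every
state that meets a run of ones contains all the blocks before it, and the states at the ends of the
runs separate the blocks after them. -/
lemma antitone_and_interlaced_of_fitsStates (hw : w.semilength = n) (hA : A ∈ compatible f w)
    {m : Fin g → ℕ} {mu : Fin n → ℕ} (h : FitsStates n A (levelSets (Sum.elim m mu))) :
    Antitone mu ∧ Interlaced w A m mu := by
  have hlev : ∀ x, 1 ≤ x → (levelSet (Sum.elim m mu) x).Nonempty → ∃ q ∈ stateIndex A,
      stateOf n A q = levelSet (Sum.elim m mu) x := by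
    intro x hx hne
    exact Finset.mem_image.1 (h.1 (mem_levelSets.2 ⟨x, hx, hne, rfl⟩))
  have hright : ∀ (q : Σ k : Fin (numRuns w), Finset (Fin (A k).card) ⊕ ℕ) (i : Fin n),
      Sum.inr i ∈ stateOf n A q ↔ (i : ℕ) < stateHeight A q := by
    rintro ⟨k, I | i'⟩ i <;> exact inr_mem_state
  have hmu : Antitone mu := by
    intro i j hij
    by_contra hlt
    have hj : Sum.inr j ∈ levelSet (Sum.elim m mu) (mu j) := by simp
    obtain ⟨q, -, hq⟩ := hlev (mu j) (by omega) ⟨_, hj⟩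
    rw [← hq, hright] at hj
    have hi : Sum.inr i ∈ levelSet (Sum.elim m mu) (mu j) := by
      rw [← hq, hright]
      exact lt_of_le_of_lt (Fin.le_def.1 hij) hj
    simp at hi
    omega
  refine ⟨hmu, fun k j hj => ⟨?_, fun hk => ?_⟩⟩
  · have e1 := dyckM_lt_succ w k.2
    have e2 := dyckM_le_semilength w (k := (k : ℕ) + 1) k.2
    have hlt : dyckM w k < n := by omega
    rw [part_succ mu hlt]
    rcases Nat.eq_zero_or_pos (mu ⟨dyckM w k, hlt⟩) with h0 | hpos
    · omega
    · have hi : Sum.inr ⟨dyckM w k, hlt⟩ ∈ levelSet (Sum.elim m mu) (mu ⟨dyckM w k, hlt⟩) := by simp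
      obtain ⟨q, hqi, hq⟩ := hlev _ hpos ⟨_, hi⟩
      rw [← hq, hright] at hi
      have hjm : Sum.inl j ∈ levelSet (Sum.elim m mu) (mu ⟨dyckM w k, hlt⟩) := by
        rw [← hq]
        rcases q with ⟨k', I | i⟩ <;> simp only [stateHeight] at hi
        · refine inl_mem_state.2 (Finset.mem_union_left _ ((mem_before_iff hA hj).2 ?_))
          by_contra hle
          have := dyckM_mono w (show (k' : ℕ) ≤ k by omega)
          omega
        · refine inl_mem_state.2 ((mem_before_iff hA hj).2 ?_)
          by_contra hle
          have h1 := dyckM_mono w (show (k' : ℕ) + 1 ≤ k by omega)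
          have h2 := dyckM_add_runLen w k'
          have h3 := inr_mem_stateIndex.1 hqi
          omega
      simpa using hjm
  · obtain ⟨k', hk'⟩ : ∃ k', (k : ℕ) = k' + 1 := ⟨k - 1, by omega⟩
    have hk2 := k.2
    have hmark := h.2 ⟨k', by omega⟩ (by simp only; omega)
    obtain ⟨x, hx, -, hS⟩ := mem_levelSets.1 hmark
    have e1 := dyckM_lt_succ w (k := k') (by omega)
    have e2 := dyckM_le_semilength w (k := k' + 1) (by omega)
    have e3 := dyckM_add_runLen w k'
    have hlt : dyckM w (k' + 1) - 1 < n := by omega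
    have h1 : Sum.inr ⟨dyckM w (k' + 1) - 1, hlt⟩ ∈ levelSet (Sum.elim m mu) x := by
      rw [← hS, hright]
      simp only [stateHeight]
      omega
    have h2 : Sum.inl j ∉ levelSet (Sum.elim m mu) x := by
      rw [← hS, stateOf, inl_mem_state, mem_before_iff hA hj]
      simp only
      omega
    simp only [mem_levelSet, Sum.elim_inr, Sum.elim_inl, not_le] at h1 h2
    rw [hk', show dyckM w (k' + 1) = dyckM w (k' + 1) - 1 + 1 by omega, part_succ mu hlt]
    omega

end States

/-! ### Weights and coefficients of chains of states -/

section Weights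

variable {g n : ℕ} {f : Fin g → ℕ} {w : DyckWord} {A : Fin (numRuns w) → Finset (Fin g)}

/-- The factor that a level set contributes to the summand belonging to a pair `(ℓ, μ)`. -/
noncomputable def stateWeight (p n : ℕ) (f : Fin g → ℕ) (t : ℂ) (S : Finset (Fin g ⊕ Fin n)) : ℂ :=
  (p : ℂ) ^ (S.toRight.card * (2 * n + ∑ j ∈ S.toLeft, f j - S.toRight.card)) *
    t ^ (2 * ∑ j ∈ S.toLeft, f j + S.toRight.card)

lemma sum_before_union_pick (hA : A ∈ compatible f w) (k : Fin (numRuns w))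
    (I : Finset (Fin (A k).card)) :
    ∑ j ∈ before A k ∪ pick A k I, f j = epsData f w A k I := by
  rw [Finset.sum_union ((disjoint_before hA k).mono_right (pick_subset k I)),
    sum_before hA k.2.le, pick, Finset.sum_map, epsData]
  rfl

lemma stateWeight_inl (p : ℕ) (t : ℂ) (hw : w.semilength = n) (hA : A ∈ compatible f w)
    (k : Fin (numRuns w)) (I : Finset (Fin (A k).card)) :
    stateWeight p n f t (stateOf n A ⟨k, Sum.inl I⟩) = yData p n f w A k t I := by
  have hM : dyckM w k ≤ n := hw ▸ dyckM_le_semilength w k.2.le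
  rw [stateWeight, stateOf, toLeft_state, card_toRight_state _ hM, sum_before_union_pick hA, yData,
    show 2 * n + epsData f w A k I - dyckM w k = 2 * n - dyckM w k + epsData f w A k I by omega,
    mul_comm (dyckM w k)]

lemma stateWeight_inr (p : ℕ) (t : ℂ) (hw : w.semilength = n) (hA : A ∈ compatible f w)
    (k : Fin (numRuns w)) {i : ℕ} (hi : i ≤ runLen w k) :
    stateWeight p n f t (stateOf n A ⟨k, Sum.inr i⟩) =
      xData p n w (k + 1) t (dyckM w k + i) := by
  have h2 := dyckM_add_runLen w k
  have hM : dyckM w (k + 1) ≤ n := hw ▸ dyckM_le_semilength w k.2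
  rw [stateWeight, stateOf, toLeft_state, card_toRight_state _ (by omega), sum_before hA k.2, xData]

/-- The numerical data are less than `1` in absolute value: the cube of this one is at most `(p ^
{2n} |t| ^ 3) ^ {2F + M}`, as `3 M (2n + F - M) ≤ 2n (2F + M)` for `M ≤ min(F, n)`. -/
lemma norm_weight_lt_one {p : ℕ} (hp : 1 ≤ p) {t : ℂ} (ht : (p : ℝ) ^ (2 * n) * ‖t‖ ^ 3 < 1)
    {F M : ℕ} (hF : 0 < F) (hMF : M ≤ F) (hMn : M ≤ n) :
    ‖(p : ℂ) ^ (M * (2 * n + F - M)) * t ^ (2 * F + M)‖ < 1 := by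
  have hp' : (1 : ℝ) ≤ p := by exact_mod_cast hp
  have h1 : 3 * (M * (2 * n + F - M)) ≤ 2 * n * (2 * F + M) := by
    obtain ⟨a, rfl⟩ := Nat.exists_eq_add_of_le hMF
    obtain ⟨b, rfl⟩ := Nat.exists_eq_add_of_le hMn
    rw [show 2 * (M + b) + (M + a) - M = 2 * (M + b) + a by omega]
    nlinarith [Nat.zero_le (M * a), Nat.zero_le (a * b)]
  rw [← pow_lt_one_iff_of_nonneg (norm_nonneg _) (n := 3) (by norm_num)]
  rw [norm_mul, norm_pow, norm_pow, Complex.norm_natCast, mul_pow, ← pow_mul, ← pow_mul,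
    mul_comm _ 3]
  calc (p : ℝ) ^ (3 * (M * (2 * n + F - M))) * ‖t‖ ^ ((2 * F + M) * 3)
      ≤ (p : ℝ) ^ (2 * n * (2 * F + M)) * ‖t‖ ^ ((2 * F + M) * 3) := by
        gcongr
    _ = ((p : ℝ) ^ (2 * n) * ‖t‖ ^ 3) ^ (2 * F + M) := by
        rw [mul_pow, ← pow_mul, ← pow_mul, mul_comm 3]
    _ < 1 := pow_lt_one₀ (by positivity) ht (by omega)

lemma norm_stateWeight_lt_one (hf : ∀ i, 0 < f i) {p : ℕ} (hp : 1 ≤ p) {t : ℂ}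
    (ht : (p : ℝ) ^ (2 * n) * ‖t‖ ^ 3 < 1)
    (hw : w.semilength = n) (hA : A ∈ compatible f w)
    {q : Σ k : Fin (numRuns w), Finset (Fin (A k).card) ⊕ ℕ} (hq : q ∈ stateIndex A) :
    ‖stateWeight p n f t (stateOf n A q)‖ < 1 := by
  have hM := card_toRight_stateOf hw hq
  rw [stateWeight, hM]
  rcases q with ⟨k, I | i⟩
  · have h1 : dyckM w k ≤ n := hw ▸ dyckM_le_semilength w k.2.le
    have h2 := dyckM_le_dyckL w k.2.le
    obtain ⟨i, hi⟩ := inl_mem_stateIndex.1 hq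
    have h3 : f ((A k).orderEmbOfFin rfl i) ≤ ∑ j ∈ I, f ((A k).orderEmbOfFin rfl j) :=
      Finset.single_le_sum (f := fun j => f ((A k).orderEmbOfFin rfl j)) (fun _ _ => Nat.zero_le _) hi
    have h4 := hf ((A k).orderEmbOfFin rfl i)
    rw [stateOf, toLeft_state, sum_before_union_pick hA]
    refine norm_weight_lt_one hp ht ?_ ?_ h1 <;> simp only [epsData, stateHeight] <;> omega
  · have h1 : dyckM w (k + 1) ≤ n := hw ▸ dyckM_le_semilength w k.2
    have h2 := dyckM_le_dyckL w (k := (k : ℕ) + 1) k.2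
    have h3 := dyckM_add_runLen w k
    have h4 := inr_mem_stateIndex.1 hq
    have h5 : stateHeight A ⟨k, Sum.inr i⟩ = dyckM w k + i := rfl
    rw [stateOf, toLeft_state, sum_before hA (k := (k : ℕ) + 1) k.2, h5]
    refine norm_weight_lt_one hp ht ?_ ?_ ?_ <;> omega

/-- The factor in the number of subgroups which depends only on the set of level sets. -/
noncomputable def chainCoeff (Y : ℂ) (w : DyckWord) (y : Finset (Finset (Fin g ⊕ Fin n))) : ℂ :=
  ∏ k : Fin (numRuns w), ∏ j ∈ Finset.range (runLen w k),
    (1 - Y ^ (dyckL w (k + 1) - dyckM w k - j)) /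
      (1 - Y ^ (nextIn (insert n (y.image fun S => S.toRight.card)) (dyckM w k + j) -
        (dyckM w k + j)))

open scoped Classical in
/-- The coefficient `chainCoeff` for the chains that belong to `(w, A)`, and zero otherwise. -/
noncomputable def pairCoeff (n : ℕ) (Y : ℂ) (A : Fin (numRuns w) → Finset (Fin g))
    (y : Finset (Finset (Fin g ⊕ Fin n))) : ℂ :=
  if IsFlag y ∧ FitsStates n A y then chainCoeff Y w y else 0

/-- On a chain of states, the coefficient is a product over the runs of ones. -/
lemma chainCoeff_image (Y : ℂ) (hw : w.semilength = n)
    {z : Finset (Σ k : Fin (numRuns w), Finset (Fin (A k).card) ⊕ ℕ)} (hz : z ⊆ stateIndex A)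
    (hfit : FitsStates n A (z.image (stateOf n A))) :
    chainCoeff Y w (z.image (stateOf n A)) =
      ∏ k : Fin (numRuns w), runCoeff Y (dyckL w (k + 1) - dyckM w k) (runLen w k)
        ((stepIndex A k).filter fun x => ⟨k, x⟩ ∈ z).toRight := by
  rw [chainCoeff]
  refine Finset.prod_congr rfl fun k _ => Finset.prod_congr rfl fun j hj => ?_
  rw [Finset.mem_range] at hj
  set u := ((stepIndex A k).filter fun x => (⟨k, x⟩ : Σ k : Fin (numRuns w),
    Finset (Fin (A k).card) ⊕ ℕ) ∈ z).toRight with hu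
  have hmemu : ∀ i, i ∈ u ↔ (⟨k, Sum.inr i⟩ : Σ k : Fin (numRuns w),
      Finset (Fin (A k).card) ⊕ ℕ) ∈ z := by
    intro i
    rw [hu, Finset.mem_toRight, Finset.mem_filter, and_iff_right_iff_imp]
    intro h
    simpa [stateIndex] using hz h
  have hlen := dyckM_add_runLen w k
  have hlen0 := runLen_pos k.2
  -- the heights between the two ends of the `k`-th run
  have key : nextIn (insert n ((z.image (stateOf n A)).image fun S => S.toRight.card))
      (dyckM w k + j) = dyckM w k + nextIn (insert (runLen w k) u) j := by
    have hx : nextIn (insert (runLen w k) u) j ∈ insert (runLen w k) u ∧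
        j < nextIn (insert (runLen w k) u) j :=
      Nat.sInf_mem (s := {i : ℕ | i ∈ insert (runLen w k) u ∧ j < i})
        ⟨runLen w k, Finset.mem_insert_self _ _, hj⟩
    have hxmin : ∀ i ∈ insert (runLen w k) u, j < i → nextIn (insert (runLen w k) u) j ≤ i :=
      fun i hi hji => Nat.sInf_le ⟨hi, hji⟩
    have htop : dyckM w (k + 1) ∈
        insert n ((z.image (stateOf n A)).image fun S => S.toRight.card) := by
      by_cases hk : (k : ℕ) + 1 < numRuns w
      · refine Finset.mem_insert_of_mem (Finset.mem_image.2 ⟨_, hfit.2 k hk, ?_⟩)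
        rw [card_toRight_stateOf hw (inr_mem_stateIndex.2 ⟨hlen0, le_rfl⟩)]
        exact hlen
      · have hk' : (k : ℕ) + 1 = numRuns w := by have := k.2; omega
        rw [hk', dyckM_numRuns, hw]
        exact Finset.mem_insert_self _ _
    refine nextIn_eq_of_forall ?_ (by omega) ?_
    · rcases Finset.mem_insert.1 hx.1 with h | h
      · rw [h, hlen]
        exact htop
      · refine Finset.mem_insert_of_mem (Finset.mem_image.2
          ⟨_, Finset.mem_image_of_mem _ ((hmemu _).1 h), ?_⟩)
        rw [card_toRight_stateOf hw (hz ((hmemu _).1 h))]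
        rfl
    · intro i hi hlt
      by_contra hcon
      have hle := hxmin _ (Finset.mem_insert_self _ _) hj
      have h5 : dyckM w (k + 1) ≤ n := hw ▸ dyckM_le_semilength w k.2
      rcases Finset.mem_insert.1 hi with rfl | h
      · omega
      · obtain ⟨S, hS, rfl⟩ := Finset.mem_image.1 h
        obtain ⟨q, hq, rfl⟩ := Finset.mem_image.1 hS
        simp only [card_toRight_stateOf hw (hz hq)] at hcon hlt hi
        rcases q with ⟨k', I | i⟩ <;> simp only [stateHeight] at hcon hlt
        · rcases Nat.lt_or_ge k k' with hkk | hkk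
          · have := dyckM_mono w (show (k : ℕ) + 1 ≤ k' from hkk)
            omega
          · have := dyckM_mono w hkk
            omega
        · have h6 := inr_mem_stateIndex.1 (hz hq)
          have h7 := dyckM_add_runLen w k'
          rcases lt_trichotomy (k : ℕ) k' with hkk | hkk | hkk
          · have := dyckM_mono w (show (k : ℕ) + 1 ≤ k' from hkk)
            omega
          · obtain rfl := Fin.ext hkk
            have := hxmin i (Finset.mem_insert_of_mem ((hmemu i).2 hq)) (by omega)
            omega
          · have := dyckM_mono w (show (k' : ℕ) + 1 ≤ k from hkk)
            omega
  rw [key, Nat.add_sub_add_left]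

/-- The contribution of the `k`-th block and the following run to the sum over all chains. -/
lemma sum_stepIndex (Y : ℂ) (X₁ : ∀ k : Fin (numRuns w), Finset (Fin (A k).card) → ℂ)
    (X₂ : Fin (numRuns w) → ℕ → ℂ) (hA : A ∈ compatible f w)
    (hX₁ : ∀ k, 1 - X₁ k Finset.univ ≠ 0) (hX₂ : ∀ k, 1 - X₂ k (runLen w k) ≠ 0)
    (hY : ∀ l, 1 ≤ l → 1 - Y ^ l ≠ 0) (k : Fin (numRuns w)) [DecidablePred
      fun y : Finset (Finset (Fin (A k).card)) => IsFlag y] :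
    ∑ u ∈ (stepIndex A k).powerset,
      ((if IsFlag u.toLeft then 1 else 0) * ∏ I ∈ u.toLeft, X₁ k I / (1 - X₁ k I)) *
      ((if (k : ℕ) + 1 < numRuns w → runLen w k ∈ u.toRight then
        runCoeff Y (dyckL w (k + 1) - dyckM w k) (runLen w k) u.toRight else 0) *
        ∏ i ∈ u.toRight, X₂ k i / (1 - X₂ k i)) =
    igusaWO (A k).card (X₁ k) *
      (if (k : ℕ) + 1 < numRuns w then
        gaussBinom (dyckL w (k + 1) - dyckM w k) (dyckL w (k + 1) - dyckM w (k + 1)) Y *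
          igusaCirc (runLen w k) Y (X₂ k)
      else igusa (runLen w k) Y (X₂ k)) := by
  have h1 := dyckM_add_runLen w k
  have h2 := dyckM_le_dyckL w (k := (k : ℕ) + 1) k.2
  have h3 := runLen_pos k.2
  rw [stepIndex, sum_powerset_disjSum _ _
    (fun u => (if IsFlag u then 1 else 0) * ∏ I ∈ u, X₁ k I / (1 - X₁ k I))
    (fun u => (if (k : ℕ) + 1 < numRuns w → runLen w k ∈ u then
        runCoeff Y (dyckL w (k + 1) - dyckM w k) (runLen w k) u else 0) *
        ∏ i ∈ u, X₂ k i / (1 - X₂ k i))]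
  congr 1
  · rw [← sum_isFlag_eq_igusaWO (Finset.card_pos.2 ((mem_compatible.1 hA).1 k)) (X₁ k) (hX₁ k)]
    exact Finset.sum_congr rfl fun u _ => by congr
  · split_ifs with hk
    · simp only [hk, true_imp_iff]
      rw [sum_runCoeff_of_mem Y (X₂ k) h3 (by omega) (fun l hl _ => hY l hl)]
      congr 2
      omega
    · simp only [hk, false_imp_iff, if_true]
      have hk' : (k : ℕ) + 1 = numRuns w := by have := k.2; omega
      have h4 : dyckL w (k + 1) - dyckM w k = runLen w k := by
        rw [runLen, hk', dyckL_numRuns, dyckM_numRuns]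
      rw [h4, sum_runCoeff_self Y (X₂ k) h3 (hX₂ k) (fun l hl _ => hY l hl)]

/-- The sum over all chains of states is a product of Igusa functions. -/
lemma sum_pairCoeff (Y : ℂ) (X : Finset (Fin g ⊕ Fin n) → ℂ) (hA : A ∈ compatible f w)
    (hw : w.semilength = n)
    (hX : ∀ q ∈ stateIndex A, 1 - X (stateOf n A q) ≠ 0) (hY : ∀ l, 1 ≤ l → 1 - Y ^ l ≠ 0) :
    ∑ y, pairCoeff n Y A y * ∏ S ∈ y, X S / (1 - X S) =
      ∏ k : Fin (numRuns w),
        (igusaWO (A k).card (fun I => X (stateOf n A ⟨k, Sum.inl I⟩)) *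
        (if (k : ℕ) + 1 < numRuns w then
          gaussBinom (dyckL w (k + 1) - dyckM w k) (dyckL w (k + 1) - dyckM w (k + 1)) Y *
            igusaCirc (runLen w k) Y (fun i => X (stateOf n A ⟨k, Sum.inr i⟩))
        else igusa (runLen w k) Y (fun i => X (stateOf n A ⟨k, Sum.inr i⟩)))) := by
  classical
  have hinj := stateOf_injOn (n := n) hw hA
  rw [← Finset.sum_subset (Finset.subset_univ ((stateIndex A).image (stateOf n A)).powerset) ?_]
  swap
  · intro y _ hy
    rw [Finset.mem_powerset] at hy
    rw [pairCoeff, if_neg (fun h => hy h.2.1), zero_mul]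
  rw [Finset.powerset_image, Finset.sum_image ?_]
  swap
  · intro z hz z' hz' h
    rw [Finset.mem_coe, Finset.mem_powerset] at hz hz'
    exact (Finset.image_eq_image_iff_of_injOn hinj hz hz').1 h
  rw [Finset.prod_congr rfl fun k _ => (sum_stepIndex Y
    (fun k I => X (stateOf n A ⟨k, Sum.inl I⟩)) (fun k i => X (stateOf n A ⟨k, Sum.inr i⟩)) hA
    (fun k => hX _ (inl_mem_stateIndex.2 ?_))
    (fun k => hX _ (inr_mem_stateIndex.2 ⟨runLen_pos k.2, le_rfl⟩)) hY k).symm]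
  swap
  · obtain ⟨j, hj⟩ := (mem_compatible.1 hA).1 k
    exact ⟨⟨0, Finset.card_pos.2 ⟨j, hj⟩⟩, Finset.mem_univ _⟩
  rw [← sum_powerset_sigma]
  refine Finset.sum_congr rfl fun z hz => ?_
  rw [Finset.mem_powerset] at hz
  rw [Finset.prod_image (hinj.mono (Finset.coe_subset.2 hz))]
  have hzs : z = Finset.univ.sigma fun k => (stepIndex A k).filter fun x => ⟨k, x⟩ ∈ z := by
    ext ⟨k, x⟩
    simp only [Finset.mem_sigma, Finset.mem_univ, Finset.mem_filter, true_and, iff_and_self]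
    intro h
    simpa [stateIndex] using hz h
  have hprod : ∏ q ∈ z, X (stateOf n A q) / (1 - X (stateOf n A q)) =
      ∏ k, ((∏ I ∈ ((stepIndex A k).filter fun x => (⟨k, x⟩ : Σ k : Fin (numRuns w),
          Finset (Fin (A k).card) ⊕ ℕ) ∈ z).toLeft,
            X (stateOf n A ⟨k, Sum.inl I⟩) / (1 - X (stateOf n A ⟨k, Sum.inl I⟩))) *
        ∏ i ∈ ((stepIndex A k).filter fun x => (⟨k, x⟩ : Σ k : Fin (numRuns w),
          Finset (Fin (A k).card) ⊕ ℕ) ∈ z).toRight,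
            X (stateOf n A ⟨k, Sum.inr i⟩) / (1 - X (stateOf n A ⟨k, Sum.inr i⟩))) := by
    conv_lhs => rw [hzs]
    rw [Finset.prod_sigma]
    refine Finset.prod_congr rfl fun k _ => ?_
    conv_lhs => rw [← Finset.toLeft_disjSum_toRight (u := (stepIndex A k).filter _)]
    rw [Finset.prod_disjSum]
  have hmark : ∀ k : Fin (numRuns w),
      stateOf n A ⟨k, Sum.inr (runLen w k)⟩ ∈ z.image (stateOf n A) ↔
        runLen w k ∈ ((stepIndex A k).filter fun x => (⟨k, x⟩ : Σ k : Fin (numRuns w),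
          Finset (Fin (A k).card) ⊕ ℕ) ∈ z).toRight := by
    intro k
    have hin : (⟨k, Sum.inr (runLen w k)⟩ : Σ k : Fin (numRuns w),
        Finset (Fin (A k).card) ⊕ ℕ) ∈ stateIndex A :=
      inr_mem_stateIndex.2 ⟨runLen_pos k.2, le_rfl⟩
    rw [Finset.mem_toRight, Finset.mem_filter, Finset.mem_image]
    constructor
    · rintro ⟨q, hq, h⟩
      obtain rfl := hinj (hz hq) hin h
      exact ⟨by simpa [stateIndex] using hin, hq⟩
    · exact fun h => ⟨_, h.2, rfl⟩
  rw [hprod, pairCoeff, isFlag_image_stateOf hw hA hz]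
  split_ifs with hcond
  · rw [chainCoeff_image Y hw hz hcond.2, ← Finset.prod_mul_distrib]
    refine Finset.prod_congr rfl fun k _ => ?_
    rw [if_pos (hcond.1 k), if_pos fun hk => (hmark k).1 (hcond.2.2 k hk)]
    ring
  · rw [zero_mul, eq_comm, Finset.prod_eq_zero_iff]
    by_contra hne
    push Not at hne
    refine hcond ⟨fun k => ?_, Finset.image_subset_image hz, fun k hk => (hmark k).2 ?_⟩
    · by_contra h
      exact hne k (Finset.mem_univ _) (by rw [if_neg h]; ring)
    · by_contra h
      exact hne k (Finset.mem_univ _)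
        (mul_eq_zero_of_right _ (by rw [if_neg fun h' => h (h' hk), zero_mul]))

end Weights

/-! ### The summands as weights of level sets -/

section TermFormula

variable {g n : ℕ} {f : Fin g → ℕ} {w : DyckWord} {A : Fin (numRuns w) → Finset (Fin g)}

lemma one_sub_inv_pow_ne_zero (p : ℕ) [hp : Fact p.Prime] {l : ℕ} (hl : l ≠ 0) :
    1 - (p : ℂ)⁻¹ ^ l ≠ 0 := by
  rw [sub_ne_zero]
  intro h
  have h1 := congrArg norm h
  rw [norm_one, norm_pow, norm_inv, Complex.norm_natCast] at h1
  exact absurd h1.symm (pow_lt_one₀ (by positivity)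
    (inv_lt_one_of_one_lt₀ (by exact_mod_cast hp.out.one_lt)) hl).ne

/-- The partition conjugate to `a` consists of the sizes of the level sets. -/
lemma sum_min_eq (a : Fin n → ℕ) (c : ℕ) :
    ∑ i, min (a i) c = ∑ x ∈ Finset.Icc 1 c, (levelSet a x).card := by
  induction c with
  | zero => simp
  | succ c ih => rw [sum_min_succ, ih, Finset.sum_Icc_succ_top (by omega)]

lemma sum_eq_sum_card_levelSet {a : Fin n → ℕ} {N : ℕ} (ha : ∀ i, a i ≤ N) :
    ∑ i, a i = ∑ x ∈ Finset.Icc 1 N, (levelSet a x).card := by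
  rw [← sum_min_eq]
  exact Finset.sum_congr rfl fun i _ => (min_eq_left (ha i)).symm

lemma sum_sum_min_eq (a : Fin n → ℕ) {b : Fin n → ℕ} {N : ℕ} (hb : ∀ i, b i ≤ N) :
    ∑ j, ∑ i, min (a i) (b j) =
      ∑ x ∈ Finset.Icc 1 N, (levelSet a x).card * (levelSet b x).card := by
  have h : ∀ x, (levelSet a x).card * (levelSet b x).card =
      ∑ j, if x ≤ b j then (levelSet a x).card else 0 := by
    intro x
    rw [← Finset.sum_filter, Finset.sum_const, smul_eq_mul, mul_comm]
    rfl
  have h2 : ∑ x ∈ Finset.Icc 1 N, (levelSet a x).card * (levelSet b x).card =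
      ∑ x ∈ Finset.Icc 1 N, ∑ j, if x ≤ b j then (levelSet a x).card else 0 :=
    Finset.sum_congr rfl fun x _ => h x
  rw [h2, Finset.sum_comm (s := Finset.Icc 1 N)]
  refine Finset.sum_congr rfl fun j _ => ?_
  rw [sum_min_eq, ← Finset.sum_filter]
  refine Finset.sum_congr ?_ fun _ _ => rfl
  ext x
  have := hb j
  simp only [Finset.mem_Icc, Finset.mem_filter]
  omega

lemma prod_runs {F : Type*} [CommMonoid F] (w : DyckWord) (G : ℕ → F) (r : ℕ) :
    ∏ k ∈ Finset.range r, ∏ j ∈ Finset.range (runLen w k), G (dyckM w k + j) =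
      ∏ x ∈ Finset.range (dyckM w r), G x := by
  induction r with
  | zero => simp
  | succ r ih => rw [Finset.prod_range_succ, ih, ← Finset.prod_range_add, dyckM_add_runLen]

/-- At the parts of `μ` in the `k`-th run of ones, exactly the blocks up to the `k`-th are reached.
-/
lemma Interlaced.levelSet_eq (hw : w.semilength = n) (hA : A ∈ compatible f w)
    {m : Fin g → ℕ} {mu : Fin n → ℕ} (hmu : Antitone mu) (h : Interlaced w A m mu)
    (k : Fin (numRuns w)) (x : Fin n) (h1 : dyckM w k ≤ x) (h2 : (x : ℕ) < dyckM w (k + 1)) :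
    levelSet m (mu x) = before A (k + 1) := by
  ext i
  obtain ⟨k', hk'⟩ := (mem_compatible.1 hA).2.2.1 i
  rw [mem_before_iff hA hk', mem_levelSet]
  have h3 := h k' i hk'
  have hle : dyckM w (k' + 1) ≤ n := hw ▸ dyckM_le_semilength w k'.2
  have hlt := dyckM_lt_succ w k'.2
  constructor
  · intro hx
    by_contra hcon
    have h4 := h3.2 (by omega)
    have h5 := dyckM_mono w (show (k : ℕ) + 1 ≤ k' by omega)
    rw [show dyckM w k' = dyckM w k' - 1 + 1 by omega, part_succ mu (by omega)] at h4
    have h6 := hmu (a := x) (b := ⟨dyckM w k' - 1, by omega⟩) (by rw [Fin.le_def]; simp only; omega)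
    omega
  · intro hk
    have h4 := h3.1
    rw [part_succ mu (by omega)] at h4
    have h5 := dyckM_mono w (show (k' : ℕ) ≤ k by omega)
    have h6 := hmu (a := ⟨dyckM w k', by omega⟩) (b := x) (by rw [Fin.le_def]; simp only; omega)
    omega

/-- The number of parts of `μ` not less than `μ_x` is the next place after `x` at which `μ` drops.
-/
lemma card_levelSet_eq_nextIn {m : Fin g → ℕ} {mu : Fin n → ℕ} (hmu : Antitone mu) (x : Fin n) :
    (levelSet mu (mu x)).card =
      nextIn (insert n ((levelSets (Sum.elim m mu)).image fun S => S.toRight.card)) x := by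
  have hcard : ∀ c, (levelSet mu c).card ≤ n := fun c => (Finset.card_le_univ _).trans (by simp)
  have hx : (x : ℕ) < (levelSet mu (mu x)).card := (lt_card_levelSet_iff hmu).2 le_rfl
  refine (nextIn_eq_of_forall ?_ hx ?_).symm
  · rcases Nat.eq_zero_or_pos (mu x) with h0 | hpos
    · refine Finset.mem_insert.2 (Or.inl ?_)
      rw [h0]
      simp [levelSet]
    · refine Finset.mem_insert_of_mem (Finset.mem_image.2
        ⟨_, mem_levelSets.2 ⟨mu x, hpos, ⟨Sum.inr x, by simp⟩, rfl⟩, ?_⟩)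
      rw [levelSet_elim hmu, card_toRight_state _ (hcard _)]
  · intro i hi hlt
    rcases Finset.mem_insert.1 hi with rfl | hi
    · exact hcard _
    · obtain ⟨S, hS, rfl⟩ := Finset.mem_image.1 hi
      obtain ⟨c, hc, -, rfl⟩ := mem_levelSets.1 hS
      simp only [levelSet_elim hmu, card_toRight_state _ (hcard _)] at hlt ⊢
      have h1 := (lt_card_levelSet_iff hmu).1 hlt
      exact Finset.card_le_card fun i hi => by
        rw [mem_levelSet] at hi ⊢
        omega

/-- On the level sets of an interlaced pair, `chainCoeff` is the quotient of products in the number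
of subgroups (`alpha_mul_eq`), with `Y = p⁻¹`. -/
lemma chainCoeff_levelSets (Y : ℂ) (hn : ∑ i, f i = n) (hw : w.semilength = n)
    (hA : A ∈ compatible f w) {m : Fin g → ℕ} {mu : Fin n → ℕ} (hmu : Antitone mu)
    (h : Interlaced w A m mu) :
    chainCoeff Y w (levelSets (Sum.elim m mu)) =
      ∏ x : Fin n, (1 - Y ^ ((levelSet (sortDesc (m ∘ block hn)) (mu x)).card - x)) /
        (1 - Y ^ ((levelSet mu (mu x)).card - x)) := by
  set G : ℕ → ℂ := fun x => if hx : x < n then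
    (1 - Y ^ ((levelSet (sortDesc (m ∘ block hn)) (mu ⟨x, hx⟩)).card - x)) /
      (1 - Y ^ ((levelSet mu (mu ⟨x, hx⟩)).card - x)) else 1 with hG
  have h1 : ∏ x : Fin n, (1 - Y ^ ((levelSet (sortDesc (m ∘ block hn)) (mu x)).card - x)) /
        (1 - Y ^ ((levelSet mu (mu x)).card - x)) = ∏ x ∈ Finset.range n, G x := by
    rw [Finset.prod_range]
    exact Finset.prod_congr rfl fun x _ => by simp [hG]
  have h2 := prod_runs w G (numRuns w)
  rw [dyckM_numRuns, hw] at h2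
  rw [h1, ← h2, Finset.prod_range, chainCoeff]
  refine Finset.prod_congr rfl fun k _ => Finset.prod_congr rfl fun j hj => ?_
  have hlen := dyckM_add_runLen w k
  have hle : dyckM w (k + 1) ≤ n := hw ▸ dyckM_le_semilength w k.2
  rw [Finset.mem_range] at hj
  have hx : dyckM w k + j < n := by omega
  rw [hG]
  simp only [dif_pos hx]
  rw [card_levelSet_eq_nextIn (m := m) hmu, card_levelSet_sortDesc, card_levelSet_block,
    h.levelSet_eq hw hA hmu k ⟨dyckM w k + j, hx⟩ (by simp) (by simp only; omega),
    sum_before hA (k := (k : ℕ) + 1) k.2, Nat.sub_sub]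

/-- The summand belonging to `(ℓ, μ)` is the product of the weights of its level sets and a
coefficient depending only on which level sets occur. -/
lemma term_eq (p : ℕ) [Fact p.Prime] (t : ℂ) (hn : ∑ i, f i = n) (hw : w.semilength = n)
    (hA : A ∈ compatible f w) {m : Fin g → ℕ} {mu : Fin n → ℕ} (hmu : Antitone mu)
    (h : Interlaced w A m mu) :
    term p t (m ∘ block hn, mu) =
      chainCoeff (p : ℂ)⁻¹ w (levelSets (Sum.elim m mu)) *
        levelWeight (stateWeight p n f t) (Sum.elim m mu) := by
  have hp0 : (p : ℂ) ≠ 0 := by exact_mod_cast (Fact.out : p.Prime).ne_zero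
  have hcard : ∀ c, (levelSet mu c).card ≤ n := fun c => (Finset.card_le_univ _).trans (by simp)
  set N := Finset.univ.sup (Sum.elim m mu) with hN
  have hmN : ∀ i, m i ≤ N := fun i => Finset.le_sup (f := Sum.elim m mu) (Finset.mem_univ (Sum.inl i))
  have hmuN : ∀ i, mu i ≤ N := fun i =>
    Finset.le_sup (f := Sum.elim m mu) (Finset.mem_univ (Sum.inr i))
  set F : ℕ → ℕ := fun x => ∑ j ∈ levelSet m x, f j with hF
  set M : ℕ → ℕ := fun x => (levelSet mu x).card with hM
  have hle : mu ≤ sortDesc (m ∘ block hn) :=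
    (h.hasOverlapType hn hw hA hmu).le hw (antitone_sortDesc _) hmu
  have hFx : ∀ x, (levelSet (sortDesc (m ∘ block hn)) x).card = F x := fun x => by
    rw [card_levelSet_sortDesc, card_levelSet_block]
  have hl : ∑ i, (m ∘ block hn) i = ∑ x ∈ Finset.Icc 1 N, F x := by
    rw [sum_eq_sum_card_levelSet (a := m ∘ block hn) (N := N) fun i => hmN _]
    exact Finset.sum_congr rfl fun x _ => card_levelSet_block hn m x
  have hmus : ∑ i, mu i = ∑ x ∈ Finset.Icc 1 N, M x := sum_eq_sum_card_levelSet hmuN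
  have hw1 : levelWeight (stateWeight p n f t) (Sum.elim m mu) =
      (p : ℂ) ^ (∑ x ∈ Finset.Icc 1 N, M x * (2 * n + F x - M x)) *
        t ^ (∑ x ∈ Finset.Icc 1 N, (2 * F x + M x)) := by
    rw [levelWeight, ← Finset.prod_pow_eq_pow_sum, ← Finset.prod_pow_eq_pow_sum,
      ← Finset.prod_mul_distrib]
    refine Finset.prod_congr rfl fun x _ => ?_
    rw [stateWeight, levelSet_elim hmu, toLeft_state, card_toRight_state _ (hcard x)]
  have halpha := alpha_mul_eq p (antitone_sortDesc (m ∘ block hn)) hmu hle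
  rw [sum_sum_min_eq mu hmuN, sum_sum_min_eq _ hmuN] at halpha
  have hD : ∏ x : Fin n, (1 - (p : ℂ)⁻¹ ^ ((levelSet mu (mu x)).card - x)) ≠ 0 := by
    refine Finset.prod_ne_zero_iff.2 fun x _ => ?_
    have hx : (x : ℕ) < (levelSet mu (mu x)).card := (lt_card_levelSet_iff hmu).2 le_rfl
    exact one_sub_inv_pow_ne_zero p (by omega)
  have hexp : ∑ x ∈ Finset.Icc 1 N, M x * (2 * n + F x - M x) + ∑ x ∈ Finset.Icc 1 N, M x * M x =
      2 * n * ∑ x ∈ Finset.Icc 1 N, M x + ∑ x ∈ Finset.Icc 1 N, F x * M x := by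
    rw [← Finset.sum_add_distrib, Finset.mul_sum, ← Finset.sum_add_distrib]
    refine Finset.sum_congr rfl fun x _ => ?_
    have := hcard x
    rw [← mul_add, Nat.sub_add_cancel (by simp only [hM]; omega)]
    ring
  have hexp' : (p : ℂ) ^ (∑ x ∈ Finset.Icc 1 N, M x * (2 * n + F x - M x)) *
      (p : ℂ) ^ (∑ x ∈ Finset.Icc 1 N, M x * M x) =
      ((p : ℂ) ^ (2 * n)) ^ (∑ x ∈ Finset.Icc 1 N, M x) *
        (p : ℂ) ^ (∑ x ∈ Finset.Icc 1 N, F x * M x) := by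
    rw [← pow_add, hexp, pow_add, pow_mul]
  simp only [hFx] at halpha
  rw [hw1, chainCoeff_levelSets _ hn hw hA hmu h, term]
  simp only [hFx]
  rw [Finset.prod_div_distrib]
  refine mul_right_cancel₀ (mul_ne_zero (pow_ne_zero (∑ x ∈ Finset.Icc 1 N, M x * M x) hp0) hD) ?_
  rw [Finset.sum_add_distrib, ← Finset.mul_sum, hl, hmus, mul_pow, pow_add]
  simp only [hM] at hexp' halpha ⊢
  calc _ = ((alpha p (sortDesc (m ∘ block hn)) mu : ℂ) *
        ((p : ℂ) ^ (∑ x ∈ Finset.Icc 1 N, (levelSet mu x).card * (levelSet mu x).card) *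
        ∏ x : Fin n, (1 - (p : ℂ)⁻¹ ^ ((levelSet mu (mu x)).card - x)))) *
        (((p : ℂ) ^ (2 * n)) ^ (∑ x ∈ Finset.Icc 1 N, (levelSet mu x).card)) *
        (t ^ (∑ x ∈ Finset.Icc 1 N, (levelSet mu x).card) *
          t ^ (2 * ∑ x ∈ Finset.Icc 1 N, F x)) := by ring
    _ = (∏ x : Fin n, (1 - (p : ℂ)⁻¹ ^ (F (mu x) - x))) *
        (((p : ℂ) ^ (2 * n)) ^ (∑ x ∈ Finset.Icc 1 N, (levelSet mu x).card) *
          (p : ℂ) ^ (∑ x ∈ Finset.Icc 1 N, F x * (levelSet mu x).card)) *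
        (t ^ (∑ x ∈ Finset.Icc 1 N, (levelSet mu x).card) *
          t ^ (2 * ∑ x ∈ Finset.Icc 1 N, F x)) := by rw [halpha]; ring
    _ = _ := by
      rw [← hexp']
      generalize (∏ x : Fin n, (1 - (p : ℂ)⁻¹ ^ ((levelSet mu (mu x)).card - x))) = Q at hD ⊢
      generalize (∏ x : Fin n, (1 - (p : ℂ)⁻¹ ^ (F (mu x) - x))) = Q'
      rw [div_mul_eq_mul_div, div_mul_eq_mul_div, eq_div_iff hD]
      ring

end TermFormula

/-! ### The explicit formula for the functions `D` -/

section DFormula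

variable {g n : ℕ} {f : Fin g → ℕ} {w : DyckWord} {A : Fin (numRuns w) → Finset (Fin g)}

open scoped Classical in
/-- The summand belonging to `(ℓ, μ)`, where `ℓ` is given by its values `m` on the blocks, if the
pair belongs to `(w, A)`, and zero otherwise. -/
noncomputable def interlacedTerm (p : ℕ) (t : ℂ) (hn : ∑ i, f i = n)
    (A : Fin (numRuns w) → Finset (Fin g)) (x : (Fin g → ℕ) × (Fin n → ℕ)) : ℂ :=
  if Antitone x.2 ∧ Interlaced w A x.1 x.2 then term p t (x.1 ∘ block hn, x.2) else 0

lemma interlacedTerm_eq (p : ℕ) [Fact p.Prime] (t : ℂ) (hn : ∑ i, f i = n) (hw : w.semilength = n)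
    (hn0 : 0 < n) (hA : A ∈ compatible f w) (x : (Fin g → ℕ) × (Fin n → ℕ)) :
    interlacedTerm p t hn A x = pairCoeff n (p : ℂ)⁻¹ A (levelSets (Sum.elim x.1 x.2)) *
      levelWeight (stateWeight p n f t) (Sum.elim x.1 x.2) := by
  rw [interlacedTerm, pairCoeff]
  split_ifs with h1 h2 h2
  · exact term_eq p t hn hw hA h1.1 h1.2
  · exact absurd ⟨isFlag_levelSets _, fitsStates_of_interlaced hw
      (numRuns_pos (by omega)) hA h1.1 h1.2⟩ h2
  · exact absurd (antitone_and_interlaced_of_fitsStates hw hA h2.2) h1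
  · rw [zero_mul]

/-- The product over the steps, with the four kinds of factors collected. The Gaussian binomial of
the last run is `1`, as `L_r = M_r = n`. -/
lemma prod_igusa_runs (hn0 : 0 < n) (hw : w.semilength = n) (Y : ℂ) (W : Fin (numRuns w) → ℂ)
    (X : ℕ → ℕ → ℂ) :
    ∏ k : Fin (numRuns w), (W k * (if (k : ℕ) + 1 < numRuns w then
      gaussBinom (dyckL w (k + 1) - dyckM w k) (dyckL w (k + 1) - dyckM w (k + 1)) Y *
        igusaCirc (runLen w k) Y (X (k + 1))
      else igusa (runLen w k) Y (X (k + 1)))) =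
    (∏ i ∈ Finset.Icc 1 (numRuns w),
      gaussBinom (dyckL w i - dyckM w (i - 1)) (dyckL w i - dyckM w i) Y) * (∏ k, W k) *
    (∏ i ∈ Finset.Ico 1 (numRuns w), igusaCirc (dyckM w i - dyckM w (i - 1)) Y (X i)) *
    igusa (n - dyckM w (numRuns w - 1)) Y (X (numRuns w)) := by
  obtain ⟨r, hr⟩ : ∃ r, numRuns w = r + 1 :=
    Nat.exists_eq_add_one_of_ne_zero (numRuns_pos (w := w) (by omega)).ne'
  have hL : dyckL w (r + 1) = n := by rw [← hr, dyckL_numRuns, hw]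
  have hM : dyckM w (r + 1) = n := by rw [← hr, dyckM_numRuns, hw]
  rw [Finset.prod_mul_distrib, Fin.prod_univ_eq_prod_range (fun k => if k + 1 < numRuns w then
      gaussBinom (dyckL w (k + 1) - dyckM w k) (dyckL w (k + 1) - dyckM w (k + 1)) Y *
        igusaCirc (runLen w k) Y (X (k + 1))
      else igusa (runLen w k) Y (X (k + 1))) (numRuns w)]
  have h1 : ∀ G : ℕ → ℂ, ∏ i ∈ Finset.Icc 1 (r + 1), G i = (∏ k ∈ Finset.range r, G (k + 1)) *
      G (r + 1) := fun G => by
    rw [← Finset.prod_range_succ (fun k => G (k + 1)), Finset.range_eq_Ico,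
      Finset.prod_Ico_add' G 0 (r + 1) 1]
    rfl
  have h2 : ∀ G : ℕ → ℂ, ∏ i ∈ Finset.Ico 1 (r + 1), G i = ∏ k ∈ Finset.range r, G (k + 1) :=
    fun G => by
    rw [Finset.range_eq_Ico, Finset.prod_Ico_add' G 0 r 1]
  generalize ∏ k, W k = P
  rw [hr, h1, h2, Finset.prod_range_succ, if_neg (lt_irrefl _), runLen, hL, hM]
  have h3 : gaussBinom (n - dyckM w (r + 1 - 1)) (n - n) Y = 1 := by simp [gaussBinom]
  rw [h3, Finset.prod_congr rfl fun k hk => if_pos (by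
    rw [Finset.mem_range] at hk; omega : k + 1 < r + 1), Finset.prod_mul_distrib]
  simp only [Nat.add_sub_cancel, runLen]
  ring

variable {p : ℕ} [hp : Fact p.Prime] {t : ℂ}

/-- The value of `D_{w,A}`: a product of Gaussian binomials and Igusa functions in the numerical
data. -/
noncomputable def igusaProduct (p n : ℕ) (f : Fin g → ℕ) (w : DyckWord)
    (A : Fin (numRuns w) → Finset (Fin g)) (t : ℂ) : ℂ :=
  (∏ i ∈ Finset.Icc 1 (numRuns w),
    gaussBinom (dyckL w i - dyckM w (i - 1)) (dyckL w i - dyckM w i) (p : ℂ)⁻¹) *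
  (∏ k : Fin (numRuns w), igusaWO (A k).card (yData p n f w A k t)) *
  (∏ i ∈ Finset.Ico 1 (numRuns w), igusaCirc (dyckM w i - dyckM w (i - 1)) (p : ℂ)⁻¹
    (fun j => xData p n w i t (dyckM w (i - 1) + j))) *
  igusa (n - dyckM w (numRuns w - 1)) (p : ℂ)⁻¹
    (fun j => xData p n w (numRuns w) t (dyckM w (numRuns w - 1) + j))

lemma igusa_congr {F : Type*} [Field F] {h : ℕ} (Y : F) {X X' : ℕ → F}
    (hX : ∀ i ≤ h, X i = X' i) : igusa h Y X = igusa h Y X' ∧ igusaCirc h Y X = igusaCirc h Y X' := by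
  have h1 : igusaSum h Y X = igusaSum h Y X' := by
    refine Finset.sum_congr rfl fun I hI => ?_
    congr 1
    refine Finset.prod_congr rfl fun i hi => ?_
    have := Finset.mem_Ico.1 (Finset.mem_powerset.1 hI hi)
    rw [hX i (by omega)]
  rw [igusa, igusa, igusaCirc, igusaCirc, h1, hX h le_rfl]
  exact ⟨rfl, rfl⟩

/-- The sum of all the terms belonging to `(w, A)`. -/
theorem hasSum_interlacedTerm (hf : ∀ i, 0 < f i) (hn : ∑ i, f i = n) (hw : w.semilength = n)
    (hn0 : 0 < n) (hA : A ∈ compatible f w) (ht : (p : ℝ) ^ (2 * n) * ‖t‖ ^ 3 < 1) :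
    HasSum (interlacedTerm p t hn A) (igusaProduct p n f w A t) ∧
      Summable fun x => ‖interlacedTerm p t hn A x‖ := by
  have hnorm : ∀ q ∈ stateIndex A, ‖stateWeight p n f t (stateOf n A q)‖ < 1 :=
    fun q hq => norm_stateWeight_lt_one hf hp.out.one_lt.le ht hw hA hq
  have hne : ∀ q ∈ stateIndex A, 1 - stateWeight p n f t (stateOf n A q) ≠ 0 := by
    intro q hq h
    have := hnorm q hq
    rw [← sub_eq_zero.1 h, norm_one] at this
    exact lt_irrefl _ this
  have key := hasSum_coeff_levelWeight (stateWeight p n f t) (pairCoeff n (p : ℂ)⁻¹ A)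
    (fun y hy _ S hS => by
      rw [pairCoeff] at hy
      have h2 : FitsStates n A y := by
        by_contra hcon
        exact hy (if_neg fun h => hcon h.2)
      obtain ⟨q, hq, rfl⟩ := Finset.mem_image.1 (h2.1 hS)
      exact hnorm q hq)
    (fun y hy => if_neg fun h => hy h.1)
  rw [sum_pairCoeff _ _ hA hw hne fun l hl => one_sub_inv_pow_ne_zero p (by omega)] at key
  have hval : ∏ k : Fin (numRuns w),
        (igusaWO (A k).card (fun I => stateWeight p n f t (stateOf n A ⟨k, Sum.inl I⟩)) *
        (if (k : ℕ) + 1 < numRuns w then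
          gaussBinom (dyckL w (k + 1) - dyckM w k) (dyckL w (k + 1) - dyckM w (k + 1)) (p : ℂ)⁻¹ *
            igusaCirc (runLen w k) (p : ℂ)⁻¹
              (fun i => stateWeight p n f t (stateOf n A ⟨k, Sum.inr i⟩))
        else igusa (runLen w k) (p : ℂ)⁻¹
          (fun i => stateWeight p n f t (stateOf n A ⟨k, Sum.inr i⟩)))) =
      igusaProduct p n f w A t := by
    rw [igusaProduct, ← prod_igusa_runs hn0 hw _ _
      (fun i j => xData p n w i t (dyckM w (i - 1) + j))]
    refine Finset.prod_congr rfl fun k _ => ?_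
    have h1 := igusa_congr (p : ℂ)⁻¹
      (X := fun i => stateWeight p n f t (stateOf n A ⟨k, Sum.inr i⟩))
      (X' := fun j => xData p n w (k + 1) t (dyckM w (k + 1 - 1) + j))
      fun i hi => stateWeight_inr p t hw hA k hi
    rw [h1.1, h1.2, show (fun I => stateWeight p n f t (stateOf n A ⟨k, Sum.inl I⟩)) =
      yData p n f w A k t from funext fun I => stateWeight_inl p t hw hA k I]
  rw [hval] at key
  have hfun : interlacedTerm p t hn A = (fun a : Fin g ⊕ Fin n → ℕ =>
      pairCoeff n (p : ℂ)⁻¹ A (levelSets a) * levelWeight (stateWeight p n f t) a) ∘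
        (Equiv.sumArrowEquivProdArrow (Fin g) (Fin n) ℕ).symm := by
    funext x
    exact interlacedTerm_eq p t hn hw hn0 hA x
  rw [hfun]
  exact ⟨(Equiv.hasSum_iff _).2 key.1, key.2.comp_injective
    (Equiv.sumArrowEquivProdArrow (Fin g) (Fin n) ℕ).symm.injective⟩

omit hp in
/-- The pairs with weak ordering `v` are interlaced with the set partition that `v` induces. -/
lemma pairs_term_eq (hf : ∀ i, 0 < f i) (hn : ∑ i, f i = n) (hw : w.semilength = n)
    {v : Equiv.Perm (Fin g) × Finset ℕ} (hv : Induces f w v A) (x : pairs n f w v) :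
    interlacedTerm p t hn A (psi f x.1.1, x.1.2) = term p t x.1 := by
  obtain ⟨⟨l, mu⟩, h1, h2, h3, -, h5⟩ := x
  have hl := (mem_admissible_iff hn).1 h1
  subst h2
  simp only at h1 h3 h5 hl hv ⊢
  rw [hl] at h5
  rw [interlacedTerm, if_pos ⟨h3, interlaced_of_induces hf hn hw hv h5⟩]
  exact congrArg (fun l => term p t (l, mu)) hl.symm

lemma pairs_injective (hn : ∑ i, f i = n) {v : Equiv.Perm (Fin g) × Finset ℕ} :
    Function.Injective fun x : pairs n f w v => (psi f x.1.1, x.1.2) := by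
  rintro ⟨⟨l, mu⟩, h1, _⟩ ⟨⟨l', mu'⟩, h1', _⟩ h
  simp only [Prod.mk.injEq] at h
  have hl := (mem_admissible_iff hn).1 h1
  have hl' := (mem_admissible_iff hn).1 h1'
  simp only at hl hl'
  exact Subtype.ext (Prod.ext (hl.trans ((congrArg (· ∘ block hn) h.1).trans hl'.symm)) h.2)

lemma summable_term (hf : ∀ i, 0 < f i) (hn : ∑ i, f i = n) (hw : w.semilength = n)
    (hn0 : 0 < n) (hA : A ∈ compatible f w) (ht : (p : ℝ) ^ (2 * n) * ‖t‖ ^ 3 < 1)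
    {v : Equiv.Perm (Fin g) × Finset ℕ} (hv : Induces f w v A) :
    Summable fun x : pairs n f w v => term p t x.1 :=
  ((hasSum_interlacedTerm hf hn hw hn0 hA ht).1.summable.comp_injective
    (pairs_injective hn)).congr fun x => pairs_term_eq hf hn hw hv x

/-- The terms belonging to `(w, A)` are those of the series `D_{w,v}` for all `v` inducing `A`. -/
theorem DwA_eq (hf : ∀ i, 0 < f i) (hn : ∑ i, f i = n) (hw : w.semilength = n)
    (hn0 : 0 < n) (hA : A ∈ compatible f w) (ht : (p : ℝ) ^ (2 * n) * ‖t‖ ^ 3 < 1) :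
    DwA p n f w A t = igusaProduct p n f w A t := by
  classical
  have h1 : ∀ v ∈ (weakOrderings g).filter (fun v => Induces f w v A),
      HasSum (fun x : (Fin g → ℕ) × (Fin n → ℕ) =>
        if weakOrderOf x.1 = v then interlacedTerm p t hn A x else 0) (Dwv p n f w v t) := by
    intro v hv
    have hv' := (Finset.mem_filter.1 hv).2
    have h2 : HasSum _ (Dwv p n f w v t) := (summable_term hf hn hw hn0 hA ht hv').hasSum
    rw [← (pairs_injective (f := f) (w := w) (v := v) hn).hasSum_iff]
    · convert h2 using 1
      funext x
      rw [Function.comp_apply, if_pos x.2.2.1, pairs_term_eq hf hn hw hv' x]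
    · intro x hx
      by_contra hne
      have h3 : weakOrderOf x.1 = v := by
        by_contra hcon
        exact hne (if_neg hcon)
      rw [if_pos h3, interlacedTerm] at hne
      have h4 : Antitone x.2 ∧ Interlaced w A x.1 x.2 := by
        by_contra hcon
        exact hne (if_neg hcon)
      have h5 := h4.2.hasOverlapType hn hw hA h4.1
      have h6 := psi_comp_block hf hn x.1
      refine hx ⟨⟨(x.1 ∘ block hn, x.2), (mem_admissible_iff hn).2 (by rw [h6]), ?_, h4.1,
        h5.le hw (antitone_sortDesc _) h4.1, h5⟩, ?_⟩
      · rw [h6]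
        exact h3
      · simp only [h6]
  refine (hasSum_sum h1).unique ?_
  convert (hasSum_interlacedTerm hf hn hw hn0 hA ht).1 using 1
  funext x
  rw [Finset.sum_ite_eq, ite_eq_left_iff]
  intro hx
  rw [interlacedTerm, if_neg]
  exact fun h => hx (Finset.mem_filter.2 ⟨weakOrderOf_mem _, h.2.induces hw hA h.1⟩)

end DFormula

/-! ### Sums over families with finite fibres -/

section Fibers

variable {ι B : Type*}

/-- Absolute convergence of a series may be checked after collecting the terms in the fibres of a
map. -/
lemma summable_norm_comp_iff (φ : ι → B) [hfin : ∀ b, Finite {i // φ i = b}] (G : B → ℂ) :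
    (Summable fun i => ‖G (φ i)‖) ↔ Summable fun b => ‖(Nat.card {i // φ i = b} : ℂ) * G b‖ := by
  have h1 : ∀ (b : B) (x : {i // φ i = b}), ‖G (φ (Equiv.sigmaFiberEquiv φ ⟨b, x⟩))‖ = ‖G b‖ := by
    rintro b ⟨i, rfl⟩
    rfl
  rw [← (Equiv.sigmaFiberEquiv φ).summable_iff, summable_sigma_of_nonneg
    (f := (fun i => ‖G (φ i)‖) ∘ Equiv.sigmaFiberEquiv φ) fun _ => norm_nonneg _]
  have h2 : ∀ b, Summable fun x : {i // φ i = b} =>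
      ((fun i => ‖G (φ i)‖) ∘ Equiv.sigmaFiberEquiv φ) ⟨b, x⟩ := fun b => Summable.of_finite
  rw [and_iff_right h2]
  refine summable_congr fun b => ?_
  have := Fintype.ofFinite {i // φ i = b}
  rw [tsum_fintype]
  refine (Finset.sum_congr rfl fun x _ => h1 b x).trans ?_
  rw [Finset.sum_const, Finset.card_univ,
    norm_mul, Complex.norm_natCast, Nat.card_eq_fintype_card, nsmul_eq_mul]

lemma tsum_comp_eq (φ : ι → B) [hfin : ∀ b, Finite {i // φ i = b}] (G : B → ℂ)
    (h : Summable fun i => ‖G (φ i)‖) :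
    ∑' i, G (φ i) = ∑' b, (Nat.card {i // φ i = b} : ℂ) * G b := by
  have h1 : ∀ (b : B) (x : {i // φ i = b}), G (φ (Equiv.sigmaFiberEquiv φ ⟨b, x⟩)) = G b := by
    rintro b ⟨i, rfl⟩
    rfl
  have h2 := ((Equiv.sigmaFiberEquiv φ).summable_iff (f := fun i => G (φ i))).2 h.of_norm
  rw [← (Equiv.sigmaFiberEquiv φ).tsum_eq]
  refine (Summable.tsum_sigma' (fun b => Summable.of_finite) h2).trans (tsum_congr fun b => ?_)
  have := Fintype.ofFinite {i // φ i = b}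
  refine (tsum_fintype _).trans ((Finset.sum_congr rfl fun x _ => h1 b x).trans ?_)
  rw [Finset.sum_const, Finset.card_univ,
    Nat.card_eq_fintype_card, nsmul_eq_mul]

/-- A Dirichlet series counting objects by a norm is the sum over the objects. -/
lemma lseries_eq_tsum (idx : ι → ℕ) (h0 : ∀ i, idx i ≠ 0)
    (hfin : ∀ m, m ≠ 0 → Finite {i // idx i = m}) {a : ℕ → ℕ}
    (ha : ∀ m, m ≠ 0 → a m = Nat.card {i // idx i = m}) {s : ℂ}
    (hs : Summable fun i => ‖(idx i : ℂ) ^ (-s)‖) :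
    LSeriesSummable (fun m => (a m : ℂ)) s ∧
      LSeries (fun m => (a m : ℂ)) s = ∑' i, (idx i : ℂ) ^ (-s) := by
  have hfin' : ∀ m, Finite {i // idx i = m} := fun m => by
    rcases eq_or_ne m 0 with rfl | hm
    · have : IsEmpty {i // idx i = 0} := ⟨fun i => h0 _ i.2⟩
      infer_instance
    · exact hfin m hm
  have hterm : LSeries.term (fun m => (a m : ℂ)) s =
      fun m : ℕ => (Nat.card {i // idx i = m} : ℂ) * (m : ℂ) ^ (-s) := by
    funext m
    rcases eq_or_ne m 0 with rfl | hm
    · have : IsEmpty {i // idx i = 0} := ⟨fun i => h0 _ i.2⟩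
      simp
    · rw [LSeries.term_of_ne_zero hm, ha m hm, Complex.cpow_neg, div_eq_mul_inv]
  constructor
  · rw [LSeriesSummable, hterm]
    exact ((summable_norm_comp_iff idx fun m : ℕ => (m : ℂ) ^ (-s)).1 hs).of_norm
  · rw [LSeries, hterm]
    exact (tsum_comp_eq idx (fun m : ℕ => (m : ℂ) ^ (-s)) hs).symm

end Fibers

/-! ### Submodules of finite index over the `p`-adic integers -/

section FiniteIndex

variable {p : ℕ} [hp : Fact p.Prime]

lemma finite_padicInt_quotient {I : Ideal ℤ_[p]} (hI : I ≠ ⊥) : Finite (ℤ_[p] ⧸ I) := by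
  obtain ⟨k, rfl⟩ := PadicInt.ideal_eq_span_pow_p hI
  rw [← PadicInt.ker_toZModPow]
  have : NeZero (p ^ k) := ⟨(pow_pos hp.out.pos k).ne'⟩
  exact Finite.of_injective _ (RingHom.kerLift_injective (PadicInt.toZModPow (p := p) k))

variable {V V₁ V₂ : Type*} [AddCommGroup V] [Module ℤ_[p] V] [AddCommGroup V₁] [Module ℤ_[p] V₁]
  [AddCommGroup V₂] [Module ℤ_[p] V₂]

lemma index_smul_mem (N : Submodule ℤ_[p] V) (v : V) :
    (N.toAddSubgroup.index : ℤ_[p]) • v ∈ N := by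
  rw [Nat.cast_smul_eq_nsmul]
  exact N.toAddSubgroup.nsmul_index_mem v

/-- All submodules of index `m` contain `m V`, and `V / m V` is finite. -/
lemma finite_submodules [Module.Finite ℤ_[p] V] {m : ℕ} (hm : m ≠ 0) :
    Finite {N : Submodule ℤ_[p] V // N.toAddSubgroup.index = m} := by
  set I : Ideal ℤ_[p] := Ideal.span {(m : ℤ_[p])} with hI
  have h1 : Finite (ℤ_[p] ⧸ I) := finite_padicInt_quotient (by
    rw [hI, Ne, Ideal.span_singleton_eq_bot]
    exact_mod_cast hm)
  have h2 : Finite (V ⧸ I • (⊤ : Submodule ℤ_[p] V)) :=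
    Submodule.finite_quotient_smul I Module.Finite.fg_top
  refine Finite.of_injective (fun N : {N : Submodule ℤ_[p] V // N.toAddSubgroup.index = m} =>
    N.1.map (I • (⊤ : Submodule ℤ_[p] V)).mkQ) fun N N' h => ?_
  have h3 : ∀ N : {N : Submodule ℤ_[p] V // N.toAddSubgroup.index = m},
      I • (⊤ : Submodule ℤ_[p] V) ≤ N.1 := by
    intro N
    rw [hI, Submodule.ideal_span_singleton_smul]
    rintro _ ⟨v, -, rfl⟩
    have := index_smul_mem N.1 v
    rwa [N.2] at this
  have h4 := congrArg (Submodule.comap (I • (⊤ : Submodule ℤ_[p] V)).mkQ) h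
  simp only [Submodule.comap_map_mkQ, sup_of_le_right (h3 _)] at h4
  exact Subtype.ext h4

/-- A submodule of finite index of a free module is free of the same rank. -/
lemma nonempty_basis_of_index [Module.Free ℤ_[p] V] [Module.Finite ℤ_[p] V] {r : ℕ}
    (hr : Module.finrank ℤ_[p] V = r) {N : Submodule ℤ_[p] V}
    (hN : N.toAddSubgroup.index ≠ 0) : Nonempty (Module.Basis (Fin r) ℤ_[p] N) := by
  have h1 : Module.finrank ℤ_[p] (V ⧸ N) = 0 := by
    rw [Module.finrank_eq_zero_iff_isTorsion]
    intro x
    obtain ⟨v, rfl⟩ := N.mkQ_surjective x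
    refine ⟨⟨(N.toAddSubgroup.index : ℤ_[p]), mem_nonZeroDivisors_of_ne_zero
      (by exact_mod_cast hN)⟩, ?_⟩
    change (N.toAddSubgroup.index : ℤ_[p]) • N.mkQ v = 0
    rw [← map_smul, Submodule.mkQ_apply, Submodule.Quotient.mk_eq_zero]
    exact index_smul_mem N v
  have h2 := Submodule.finrank_quotient_add_finrank N
  rw [h1, zero_add, hr] at h2
  exact ⟨Module.finBasisOfFinrankEq ℤ_[p] N h2⟩

lemma card_hom_of_basis {r : ℕ} (b : Module.Basis (Fin r) ℤ_[p] V₁) :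
    Nat.card (V₁ →ₗ[ℤ_[p]] V₂) = Nat.card V₂ ^ r := by
  rw [← Nat.card_congr (b.constr ℤ_[p]).toEquiv, Nat.card_fun, Nat.card_fin]

/-- The submodule of `V₁ × V₂` consisting of the pairs `(x, y)` with `x` in the domain of `φ` and
`y` in the coset `φ x`. -/
def graphOf {N₁ : Submodule ℤ_[p] V₁} {N₂ : Submodule ℤ_[p] V₂} (φ : N₁ →ₗ[ℤ_[p]] V₂ ⧸ N₂) :
    Submodule ℤ_[p] (V₁ × V₂) where
  carrier := {v | ∃ h : v.1 ∈ N₁, φ ⟨v.1, h⟩ = N₂.mkQ v.2}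
  zero_mem' := ⟨N₁.zero_mem, by
    rw [Prod.snd_zero, map_zero]
    exact map_zero φ⟩
  add_mem' := by
    rintro v v' ⟨h, e⟩ ⟨h', e'⟩
    refine ⟨N₁.add_mem h h', ?_⟩
    rw [Prod.snd_add, map_add, ← e, ← e', ← map_add]
    rfl
  smul_mem' := by
    rintro c v ⟨h, e⟩
    refine ⟨N₁.smul_mem c h, ?_⟩
    rw [Prod.smul_snd, map_smul, ← e, ← map_smul]
    rfl

lemma mem_graphOf {N₁ : Submodule ℤ_[p] V₁} {N₂ : Submodule ℤ_[p] V₂}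
    {φ : N₁ →ₗ[ℤ_[p]] V₂ ⧸ N₂} {v : V₁ × V₂} :
    v ∈ graphOf φ ↔ ∃ h : v.1 ∈ N₁, φ ⟨v.1, h⟩ = N₂.mkQ v.2 := Iff.rfl

lemma map_fst_graphOf {N₁ : Submodule ℤ_[p] V₁} {N₂ : Submodule ℤ_[p] V₂}
    (φ : N₁ →ₗ[ℤ_[p]] V₂ ⧸ N₂) :
    (graphOf φ).map (LinearMap.fst ℤ_[p] V₁ V₂) = N₁ := by
  ext x
  rw [Submodule.mem_map]
  constructor
  · rintro ⟨v, ⟨h, -⟩, rfl⟩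
    exact h
  · intro h
    obtain ⟨y, hy⟩ := N₂.mkQ_surjective (φ ⟨x, h⟩)
    exact ⟨(x, y), ⟨h, hy.symm⟩, rfl⟩

lemma comap_inr_graphOf {N₁ : Submodule ℤ_[p] V₁} {N₂ : Submodule ℤ_[p] V₂}
    (φ : N₁ →ₗ[ℤ_[p]] V₂ ⧸ N₂) :
    (graphOf φ).comap (LinearMap.inr ℤ_[p] V₁ V₂) = N₂ := by
  ext y
  rw [Submodule.mem_comap, mem_graphOf]
  have h0 : φ 0 = 0 := map_zero φ
  constructor
  · rintro ⟨h, e⟩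
    have h1 : N₂.mkQ y = 0 := e.symm.trans h0
    rwa [Submodule.mkQ_apply, Submodule.Quotient.mk_eq_zero] at h1
  · intro hy
    refine ⟨N₁.zero_mem, ?_⟩
    have h1 : N₂.mkQ y = 0 := by rwa [Submodule.mkQ_apply, Submodule.Quotient.mk_eq_zero]
    exact h0.trans h1.symm

/-- The submodules of `V₁ × V₂` with given projection `N₁` to `V₁` and intersection `N₂` with `V₂`
correspond to the homomorphisms `N₁ → V₂ / N₂`. -/
lemma bijective_graphOf (N₁ : Submodule ℤ_[p] V₁) (N₂ : Submodule ℤ_[p] V₂) :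
    Function.Bijective fun φ : N₁ →ₗ[ℤ_[p]] V₂ ⧸ N₂ =>
      (⟨graphOf φ, map_fst_graphOf φ, comap_inr_graphOf φ⟩ :
        {N : Submodule ℤ_[p] (V₁ × V₂) // N.map (LinearMap.fst ℤ_[p] V₁ V₂) = N₁ ∧
          N.comap (LinearMap.inr ℤ_[p] V₁ V₂) = N₂}) := by
  constructor
  · intro φ φ' h
    have h1 : graphOf φ = graphOf φ' := congrArg Subtype.val h
    ext ⟨x, hx⟩
    obtain ⟨y, hy⟩ := N₂.mkQ_surjective (φ ⟨x, hx⟩)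
    have h2 : ((x, y) : V₁ × V₂) ∈ graphOf φ' := h1 ▸ (⟨hx, hy.symm⟩ : ((x, y) : V₁ × V₂) ∈ graphOf φ)
    obtain ⟨_, h3⟩ := h2
    exact hy.symm.trans h3.symm
  · rintro ⟨N, rfl, rfl⟩
    have hex : ∀ x : N.map (LinearMap.fst ℤ_[p] V₁ V₂), ∃ y : V₂, ((x : V₁), y) ∈ N := by
      rintro ⟨x, hx⟩
      obtain ⟨⟨_, y⟩, hv, rfl⟩ := Submodule.mem_map.1 hx
      exact ⟨y, hv⟩
    choose y hy using hex
    have hkey : ∀ (x : N.map (LinearMap.fst ℤ_[p] V₁ V₂)) (y' : V₂), ((x : V₁), y') ∈ N →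
        (N.comap (LinearMap.inr ℤ_[p] V₁ V₂)).mkQ y' =
          (N.comap (LinearMap.inr ℤ_[p] V₁ V₂)).mkQ (y x) := by
      intro x y' h
      rw [Submodule.mkQ_apply, Submodule.mkQ_apply, Submodule.Quotient.eq, Submodule.mem_comap]
      have := N.sub_mem h (hy x)
      simpa using this
    let φ : N.map (LinearMap.fst ℤ_[p] V₁ V₂) →ₗ[ℤ_[p]]
        V₂ ⧸ N.comap (LinearMap.inr ℤ_[p] V₁ V₂) :=
      { toFun := fun x => (N.comap (LinearMap.inr ℤ_[p] V₁ V₂)).mkQ (y x)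
        map_add' := fun x x' => by
          rw [← map_add]
          exact (hkey _ _ (N.add_mem (hy x) (hy x'))).symm
        map_smul' := fun c x => by
          rw [RingHom.id_apply, ← map_smul]
          exact (hkey _ _ (N.smul_mem c (hy x))).symm }
    refine ⟨φ, Subtype.ext (Submodule.ext fun v => ?_)⟩
    rw [mem_graphOf]
    constructor
    · rintro ⟨h, e⟩
      have e' : (N.comap (LinearMap.inr ℤ_[p] V₁ V₂)).mkQ (y ⟨v.1, h⟩) =
        (N.comap (LinearMap.inr ℤ_[p] V₁ V₂)).mkQ v.2 := e
      rw [Submodule.mkQ_apply, Submodule.mkQ_apply, Submodule.Quotient.eq,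
        Submodule.mem_comap] at e'
      have := N.sub_mem (hy ⟨v.1, h⟩) e'
      simpa using this
    · intro hv
      exact ⟨Submodule.mem_map_of_mem (f := LinearMap.fst ℤ_[p] V₁ V₂) hv, (hkey _ _ hv).symm⟩

/-- The index of a submodule of `V₁ × V₂` is the product of the indices of its projection and its
intersection. -/
lemma index_prod (N : Submodule ℤ_[p] (V₁ × V₂)) :
    N.toAddSubgroup.index = (N.map (LinearMap.fst ℤ_[p] V₁ V₂)).toAddSubgroup.index *
      (N.comap (LinearMap.inr ℤ_[p] V₁ V₂)).toAddSubgroup.index := by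
  have h1 : (N.comap (LinearMap.inr ℤ_[p] V₁ V₂)).toAddSubgroup.index =
      N.toAddSubgroup.relIndex (AddMonoidHom.inr V₁ V₂).range :=
    AddSubgroup.index_comap N.toAddSubgroup (AddMonoidHom.inr V₁ V₂)
  have h2 : (N.map (LinearMap.fst ℤ_[p] V₁ V₂)).toAddSubgroup.index =
      (N.toAddSubgroup ⊔ (AddMonoidHom.inr V₁ V₂).range).index := by
    have h3 : (N.map (LinearMap.fst ℤ_[p] V₁ V₂)).toAddSubgroup =
        N.toAddSubgroup.map (AddMonoidHom.fst V₁ V₂) := rfl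
    have h4 : (AddMonoidHom.inr V₁ V₂).range = (AddMonoidHom.fst V₁ V₂).ker := by
      ext ⟨a, b⟩
      simp [AddSubgroup.mem_prod, eq_comm]
    rw [h3, AddSubgroup.index_map, AddMonoidHom.range_eq_top.2 Prod.fst_surjective,
      AddSubgroup.index_top, mul_one, h4]
  rw [h1, h2, mul_comm, ← AddSubgroup.relIndex_sup_left, sup_comm,
    AddSubgroup.relIndex_mul_index le_sup_right]

lemma card_submodules_prod [Module.Free ℤ_[p] V₁] [Module.Finite ℤ_[p] V₁] {r : ℕ}
    (hr : Module.finrank ℤ_[p] V₁ = r) {N₁ : Submodule ℤ_[p] V₁} (N₂ : Submodule ℤ_[p] V₂)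
    (hN₁ : N₁.toAddSubgroup.index ≠ 0) :
    Nat.card {N : Submodule ℤ_[p] (V₁ × V₂) // N.map (LinearMap.fst ℤ_[p] V₁ V₂) = N₁ ∧
      N.comap (LinearMap.inr ℤ_[p] V₁ V₂) = N₂} = N₂.toAddSubgroup.index ^ r := by
  obtain ⟨b⟩ := nonempty_basis_of_index hr hN₁
  rw [← Nat.card_congr (Equiv.ofBijective _ (bijective_graphOf N₁ N₂)), card_hom_of_basis b]
  rfl

end FiniteIndex

/-! ### Convergence of the zeta function of a free module -/

section Convergence

/-- The submodules of finite index. -/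
abbrev FinIdx (p : ℕ) [Fact p.Prime] (V : Type*) [AddCommGroup V] [Module ℤ_[p] V] :=
  {N : Submodule ℤ_[p] V // N.toAddSubgroup.index ≠ 0}

variable {p : ℕ} [hp : Fact p.Prime]
variable {V V₁ V₂ : Type*} [AddCommGroup V] [Module ℤ_[p] V] [AddCommGroup V₁] [Module ℤ_[p] V₁]
  [AddCommGroup V₂] [Module ℤ_[p] V₂]

/-- The index of a submodule of finite index. -/
noncomputable def FinIdx.idx (N : FinIdx p V) : ℕ := N.1.toAddSubgroup.index

lemma FinIdx.idx_ne_zero (N : FinIdx p V) : N.idx ≠ 0 := N.2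

/-- A linear equivalence maps submodules of finite index to submodules of finite index. -/
noncomputable def finIdxCongr (e : V₁ ≃ₗ[ℤ_[p]] V₂) : FinIdx p V₁ ≃ FinIdx p V₂ :=
  (Submodule.orderIsoMapComap e).toEquiv.subtypeEquiv fun N => by
    have : (N.map (e : V₁ →ₗ[ℤ_[p]] V₂)).toAddSubgroup.index = N.toAddSubgroup.index :=
      AddSubgroup.index_map_of_bijective (f := (e : V₁ →ₗ[ℤ_[p]] V₂).toAddMonoidHom)
        e.bijective N.toAddSubgroup
    rw [← this]
    rfl

lemma idx_finIdxCongr (e : V₁ ≃ₗ[ℤ_[p]] V₂) (N : FinIdx p V₁) : (finIdxCongr e N).idx = N.idx :=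
  AddSubgroup.index_map_of_bijective (f := (e : V₁ →ₗ[ℤ_[p]] V₂).toAddMonoidHom)
    e.bijective N.1.toAddSubgroup

lemma summable_finIdxCongr_iff (e : V₁ ≃ₗ[ℤ_[p]] V₂) (F : ℕ → ℝ) :
    (Summable fun N : FinIdx p V₁ => F N.idx) ↔ Summable fun N : FinIdx p V₂ => F N.idx := by
  rw [← (finIdxCongr e).summable_iff]
  exact summable_congr fun N => by rw [Function.comp_apply, idx_finIdxCongr]

/-- The projection to `V₁` and the intersection with `V₂` of a submodule of `V₁ × V₂`. -/
noncomputable def splitFinIdx (N : FinIdx p (V₁ × V₂)) : FinIdx p V₁ × FinIdx p V₂ :=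
  (⟨N.1.map (LinearMap.fst ℤ_[p] V₁ V₂), fun h => N.2 (by rw [index_prod, h, zero_mul])⟩,
    ⟨N.1.comap (LinearMap.inr ℤ_[p] V₁ V₂), fun h => N.2 (by rw [index_prod, h, mul_zero])⟩)

lemma idx_split (N : FinIdx p (V₁ × V₂)) :
    N.idx = (splitFinIdx N).1.idx * (splitFinIdx N).2.idx := index_prod N.1

lemma card_split_fiber [Module.Free ℤ_[p] V₁] [Module.Finite ℤ_[p] V₁] {r : ℕ}
    (hr : Module.finrank ℤ_[p] V₁ = r) (q : FinIdx p V₁ × FinIdx p V₂) :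
    Nat.card {N : FinIdx p (V₁ × V₂) // splitFinIdx N = q} = q.2.idx ^ r := by
  rw [FinIdx.idx, ← card_submodules_prod hr q.2.1 q.1.2]
  refine Nat.card_congr
    { toFun := fun N => ⟨N.1.1, congrArg (fun q => q.1.1) N.2, congrArg (fun q => q.2.1) N.2⟩
      invFun := fun N => ⟨⟨N.1, ?_⟩, ?_⟩
      left_inv := fun N => rfl
      right_inv := fun N => rfl }
  · rw [index_prod, N.2.1, N.2.2]
    exact mul_ne_zero q.1.2 q.2.2
  · exact Prod.ext (Subtype.ext N.2.1) (Subtype.ext N.2.2)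

lemma finite_split_fiber [Module.Free ℤ_[p] V₁] [Module.Finite ℤ_[p] V₁]
    (q : FinIdx p V₁ × FinIdx p V₂) : Finite {N : FinIdx p (V₁ × V₂) // splitFinIdx N = q} :=
  Nat.finite_of_card_ne_zero (by
    rw [card_split_fiber rfl]
    exact pow_ne_zero _ q.2.2)

lemma norm_natCast_cpow_neg (m : ℕ) (hm : m ≠ 0) (s : ℂ) :
    ‖(m : ℂ) ^ (-s)‖ = (m : ℝ) ^ (-s.re) := by
  rw [Complex.norm_natCast_cpow_of_pos (Nat.pos_of_ne_zero hm), Complex.neg_re]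

lemma natCast_pow_mul_cpow_neg {m : ℕ} (hm : m ≠ 0) (r : ℕ) (s : ℂ) :
    (m : ℂ) ^ r * (m : ℂ) ^ (-s) = (m : ℂ) ^ (-(s - r)) := by
  rw [neg_sub, sub_eq_add_neg, Complex.cpow_add _ _ (by exact_mod_cast hm), Complex.cpow_natCast]

/-- The zeta function of `V₁ × V₂` at `s` is the product of those of `V₁` at `s` and of `V₂` at `s -
r`, where `r` is the rank of `V₁`. -/
lemma summable_prod [Module.Free ℤ_[p] V₁] [Module.Finite ℤ_[p] V₁] {r : ℕ}
    (hr : Module.finrank ℤ_[p] V₁ = r) {s : ℂ}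
    (h1 : Summable fun N : FinIdx p V₁ => ‖(N.idx : ℂ) ^ (-s)‖)
    (h2 : Summable fun N : FinIdx p V₂ => ‖(N.idx : ℂ) ^ (-(s - r))‖) :
    Summable fun N : FinIdx p (V₁ × V₂) => ‖(N.idx : ℂ) ^ (-s)‖ := by
  have : ∀ q : FinIdx p V₁ × FinIdx p V₂, Finite {N : FinIdx p (V₁ × V₂) // splitFinIdx N = q} :=
    finite_split_fiber
  have h3 := (summable_norm_comp_iff (splitFinIdx (p := p) (V₁ := V₁) (V₂ := V₂))
    fun q => (q.1.idx : ℂ) ^ (-s) * (q.2.idx : ℂ) ^ (-s)).2 ?_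
  · refine h3.congr fun N => ?_
    rw [idx_split, Nat.cast_mul, Complex.natCast_mul_natCast_cpow]
  · refine (h1.mul_of_nonneg h2 (fun _ => norm_nonneg _) fun _ => norm_nonneg _).congr fun q => ?_
    rw [card_split_fiber hr, ← norm_mul, ← natCast_pow_mul_cpow_neg q.2.idx_ne_zero]
    push_cast
    congr 1
    ring

lemma index_span_pow (k : ℕ) :
    (Ideal.span {(p : ℤ_[p]) ^ k}).toAddSubgroup.index = p ^ k := by
  have h := Nat.card_congr (RingHom.quotientKerEquivOfSurjective
    (ZMod.ringHom_surjective (PadicInt.toZModPow (p := p) k))).toEquiv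
  rw [PadicInt.ker_toZModPow, Nat.card_zmod] at h
  exact h

lemma summable_padicInt {s : ℂ} (hs : 0 < s.re) :
    Summable fun N : FinIdx p ℤ_[p] => ‖(N.idx : ℂ) ^ (-s)‖ := by
  have hp1 : (1 : ℝ) < p := by exact_mod_cast hp.out.one_lt
  let e : ℕ → FinIdx p ℤ_[p] := fun k => ⟨Ideal.span {(p : ℤ_[p]) ^ k}, by
    rw [index_span_pow]
    exact (pow_pos hp.out.pos k).ne'⟩
  have he : Function.Bijective e := by
    constructor
    · intro k k' h
      have h1 := congrArg FinIdx.idx h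
      simp only [FinIdx.idx, e, index_span_pow] at h1
      exact Nat.pow_right_injective hp.out.two_le h1
    · intro N
      have hN : N.1 ≠ ⊥ := by
        intro h
        have := index_smul_mem N.1 (1 : ℤ_[p])
        rw [h, Submodule.mem_bot, smul_eq_mul, mul_one, Nat.cast_eq_zero, ← h] at this
        exact N.2 this
      obtain ⟨k, hk⟩ := PadicInt.ideal_eq_span_pow_p hN
      exact ⟨k, Subtype.ext hk.symm⟩
  rw [← (Equiv.ofBijective e he).summable_iff]
  have h1 : Summable fun k : ℕ => ((p : ℝ) ^ (-s.re)) ^ k :=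
    summable_geometric_of_lt_one (by positivity) (Real.rpow_lt_one_of_one_lt_of_neg hp1 (by linarith))
  refine h1.congr fun k => ?_
  have h2 : (e k).idx = p ^ k := index_span_pow k
  rw [Function.comp_apply, Equiv.ofBijective_apply, norm_natCast_cpow_neg _ (e k).idx_ne_zero, h2,
    Nat.cast_pow, ← Real.rpow_natCast, ← Real.rpow_natCast, ← Real.rpow_mul (by positivity),
    ← Real.rpow_mul (by positivity), mul_comm]

/-- The zeta function of a free module of rank `d` converges for `Re s > d - 1`. -/
lemma summable_free (d : ℕ) {s : ℂ} (hs : (d : ℝ) - 1 < s.re) :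
    Summable fun N : FinIdx p (Fin d → ℤ_[p]) => ‖(N.idx : ℂ) ^ (-s)‖ := by
  induction d generalizing s with
  | zero =>
    have : Subsingleton (Submodule ℤ_[p] (Fin 0 → ℤ_[p])) :=
      (Submodule.subsingleton_iff ℤ_[p]).2 inferInstance
    exact Summable.of_finite
  | succ d ih =>
    push_cast at hs
    refine (summable_finIdxCongr_iff (Fin.consLinearEquiv ℤ_[p] fun _ : Fin (d + 1) => ℤ_[p])
      fun m => ‖(m : ℂ) ^ (-s)‖).1 ?_
    have hd : (0 : ℝ) ≤ d := Nat.cast_nonneg d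
    refine summable_prod (r := 1) (Module.finrank_self _) (summable_padicInt (by linarith)) (ih ?_)
    simp only [Nat.cast_one, Complex.sub_re, Complex.one_re]
    linarith

end Convergence

/-! ### Subgroups of finite abelian `p`-groups: duality and types -/

section Types

/-- A finite abelian group has as many subgroups of any given index as of that order. -/
lemma exists_dual (G : Type*) [AddCommGroup G] [Finite G] :
    ∃ e : AddSubgroup G ≃ AddSubgroup G, ∀ H, Nat.card (e H) = H.index := by
  let M := Multiplicative G
  have : Finite M := inferInstanceAs (Finite G)
  have : HasEnoughRootsOfUnity ℂ (Monoid.exponent M) := by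
    have : NeZero (Monoid.exponent M) := ⟨Monoid.exponent_ne_zero_of_finite⟩
    infer_instance
  obtain ⟨e⟩ := CommGroup.monoidHom_mulEquiv_of_hasEnoughRootsOfUnity M ℂ
  refine ⟨AddSubgroup.toSubgroup.toEquiv.trans
    ((CommGroup.subgroupOrderIsoSubgroupMonoidHom M ℂ).toEquiv.trans
      (OrderDual.ofDual.trans (e.mapSubgroup.toEquiv.trans
        AddSubgroup.toSubgroup.toEquiv.symm))), fun H => ?_⟩
  have h1 := CommGroup.card_subgroupOrderIsoSubgroupMonoidHom (M := ℂ) (AddSubgroup.toSubgroup H)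
  have h2 := Nat.card_congr (e.subgroupMap
    (CommGroup.subgroupOrderIsoSubgroupMonoidHom M ℂ (AddSubgroup.toSubgroup H)).ofDual).toEquiv
  exact h2.symm.trans h1

variable {p : ℕ} [hp : Fact p.Prime] {n : ℕ}

/-- The type of a finite abelian `p`-group is unique. -/
lemma eq_of_addEquiv {mu mu' : Fin n → ℕ} (hmu : Antitone mu) (hmu' : Antitone mu')
    (e : (∀ j, ZMod (p ^ mu j)) ≃+ ∀ j, ZMod (p ^ mu' j)) : mu = mu' := by
  have : ∀ mu : Fin n → ℕ, Finite (∀ j, ZMod (p ^ mu j)) := fun mu => by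
    have : ∀ j, NeZero (p ^ mu j) := fun j => ⟨(pow_pos hp.out.pos _).ne'⟩
    infer_instance
  have key : ∀ {mu mu' : Fin n → ℕ}, Antitone mu → Antitone mu' →
      ((∀ j, ZMod (p ^ mu j)) ≃+ ∀ j, ZMod (p ^ mu' j)) → mu ≤ mu' := by
    intro mu mu' hmu hmu' e
    refine le_of_alpha_ne_zero p hmu' hmu ?_
    rw [alpha]
    have : Nonempty {H : AddSubgroup (∀ j, ZMod (p ^ mu' j)) //
      Nonempty (H ≃+ ∀ j, ZMod (p ^ mu j))} := ⟨⟨⊤, ⟨AddSubgroup.topEquiv.trans e.symm⟩⟩⟩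
    exact Nat.card_pos.ne'
  exact le_antisymm (key hmu hmu' e) (key hmu' hmu e.symm)

variable {V : Type*} [AddCommGroup V] [Module ℤ_[p] V]

/-- An additive subgroup which contains `p ^ k V` is a submodule, as the integers are dense in the
`p`-adic integers. -/
def submoduleOfAddSubgroup (H : AddSubgroup V) {k : ℕ} (hH : ∀ v : V, (p : ℤ_[p]) ^ k • v ∈ H) :
    Submodule ℤ_[p] V where
  __ := H
  smul_mem' c v hv := by
    obtain ⟨d, hd⟩ := Ideal.mem_span_singleton'.1 (PadicInt.appr_spec k c)
    have h1 : c • v = c.appr k • v + (p : ℤ_[p]) ^ k • d • v := by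
      rw [← Nat.cast_smul_eq_nsmul ℤ_[p], smul_smul, ← add_smul, mul_comm, hd,
        add_sub_cancel]
    change c • v ∈ H
    rw [h1]
    exact H.add_mem (H.nsmul_mem hv _) (hH _)

/-- Every subgroup of a group of type `λ` has a type with as many parts as `λ`. -/
lemma exists_type (lam : Fin n → ℕ) (H : AddSubgroup (∀ j, ZMod (p ^ lam j))) :
    ∃ mu : Fin n → ℕ, Antitone mu ∧ Nonempty (H ≃+ ∀ j, ZMod (p ^ mu j)) := by
  let q : (Fin n → ℤ_[p]) →+ ∀ j, ZMod (p ^ lam j) :=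
    { toFun := fun x j => PadicInt.toZModPow (lam j) (x j)
      map_zero' := funext fun j => map_zero _
      map_add' := fun x y => funext fun j => map_add _ _ _ }
  have hq : Function.Surjective q := fun y => by
    choose x hx using fun j => ZMod.ringHom_surjective (PadicInt.toZModPow (p := p) (lam j)) (y j)
    exact ⟨x, funext hx⟩
  set k := Finset.univ.sup lam
  have hk : ∀ v : Fin n → ℤ_[p], q ((p : ℤ_[p]) ^ k • v) = 0 := by
    intro v
    funext j
    change PadicInt.toZModPow (lam j) ((p : ℤ_[p]) ^ k * v j) = 0
    rw [← RingHom.mem_ker, PadicInt.ker_toZModPow, Ideal.mem_span_singleton]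
    exact (pow_dvd_pow _ (Finset.le_sup (Finset.mem_univ j))).mul_right _
  have hp0 : (p : ℤ_[p]) ^ k ≠ 0 := pow_ne_zero _ (by exact_mod_cast hp.out.ne_zero)
  -- `H` is the quotient of one lattice by another
  let N : Submodule ℤ_[p] (Fin n → ℤ_[p]) := submoduleOfAddSubgroup (H.comap q) (k := k) fun v => by
    rw [AddSubgroup.mem_comap, hk]
    exact H.zero_mem
  have hNH : ∀ v, v ∈ N ↔ q v ∈ H := fun v => Iff.rfl
  let K : Submodule ℤ_[p] N := submoduleOfAddSubgroup
    ((q.comp N.subtype.toAddMonoidHom).ker) (k := k) fun v => by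
      rw [AddMonoidHom.mem_ker]
      exact hk v
  have hK : ∀ v : N, v ∈ K ↔ q v = 0 := fun v => Iff.rfl
  have hfin : Finite (∀ j, ZMod (p ^ lam j)) := by
    have : ∀ j, NeZero (p ^ lam j) := fun j => ⟨(pow_pos hp.out.pos _).ne'⟩
    infer_instance
  have hN : N.toAddSubgroup.index ≠ 0 := by
    have : N.toAddSubgroup.index = H.index := H.index_comap_of_surjective hq
    rw [this]
    exact AddSubgroup.index_ne_zero_of_finite
  obtain ⟨b⟩ := nonempty_basis_of_index (Module.finrank_fin_fun ℤ_[p]) hN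
  let e₁ : N ⧸ K ≃+ H := by
    let q' : N →+ H :=
      { toFun := fun v => ⟨q v, v.2⟩
        map_zero' := Subtype.ext (map_zero q)
        map_add' := fun x y => Subtype.ext (map_add q _ _) }
    have hker : q'.ker = K.toAddSubgroup := by
      ext v
      rw [AddMonoidHom.mem_ker]
      exact Subtype.ext_iff
    exact (QuotientAddGroup.quotientAddEquivOfEq hker.symm).trans
      (QuotientAddGroup.quotientKerEquivOfSurjective q' fun y => by
        obtain ⟨x, hx⟩ := hq y
        exact ⟨⟨x, by rw [hNH, hx]; exact y.2⟩, Subtype.ext hx⟩)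
  have hKi : K.toAddSubgroup.index ≠ 0 := by
    have : Nat.card (N ⧸ K) = Nat.card H := Nat.card_congr e₁.toEquiv
    exact this.trans_ne Nat.card_pos.ne'
  have : Module.Free ℤ_[p] N := Module.Free.of_basis b
  have : Module.Finite ℤ_[p] N := Module.Finite.of_basis b
  have hrank : Module.finrank ℤ_[p] N = n := by
    rw [Module.finrank_eq_card_basis b, Fintype.card_fin]
  obtain ⟨b'⟩ := nonempty_basis_of_index hrank hKi
  have h : Module.finrank ℤ_[p] K = Module.finrank ℤ_[p] N := by
    rw [hrank, Module.finrank_eq_card_basis b', Fintype.card_fin]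
  have e₂ := K.quotientEquivPiSpan b h
  choose e he using fun i => PadicInt.ideal_eq_span_pow_p (s := Ideal.span
    {Submodule.smithNormalFormCoeffs b h i}) (by
      rw [Ne, Ideal.span_singleton_eq_bot]
      exact Submodule.smithNormalFormCoeffs_ne_zero b h i)
  have e₃ : ∀ i, (ℤ_[p] ⧸ Ideal.span {Submodule.smithNormalFormCoeffs b h i}) ≃+ ZMod (p ^ e i) :=
    fun i => ((Ideal.quotEquivOfEq ((he i).trans (PadicInt.ker_toZModPow (e i)).symm)).trans
      (RingHom.quotientKerEquivOfSurjective (ZMod.ringHom_surjective _))).toAddEquiv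
  refine ⟨sortDesc e, antitone_sortDesc e, ⟨e₁.symm.trans (e₂.toAddEquiv.trans
    ((AddEquiv.piCongrRight e₃).trans ?_))⟩⟩
  exact (RingEquiv.piCongrLeft (fun i => ZMod (p ^ e i))
    (Tuple.sort (OrderDual.toDual ∘ e))).symm.toAddEquiv

/-- The subgroups of a group of type `λ`, sorted by the type of their dual. -/
lemma exists_dualType {Q : Type*} [AddCommGroup Q] {lam : Fin n → ℕ}
    (e : Q ≃+ ∀ j, ZMod (p ^ lam j)) :
    ∃ τ : AddSubgroup Q → (Fin n → ℕ), (∀ H, H.index = p ^ ∑ i, τ H i) ∧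
      (∀ H, Antitone (τ H)) ∧
      ∀ mu, Antitone mu → Nat.card {H // τ H = mu} = alpha p lam mu := by
  have : ∀ j, NeZero (p ^ lam j) := fun j => ⟨(pow_pos hp.out.pos _).ne'⟩
  obtain ⟨d, hd⟩ := exists_dual (∀ j, ZMod (p ^ lam j))
  choose ty hanti hty using exists_type (p := p) lam
  let E : AddSubgroup Q ≃ AddSubgroup (∀ j, ZMod (p ^ lam j)) := e.mapAddSubgroup.toEquiv.trans d
  refine ⟨fun H => ty (E H), fun H => ?_, fun H => hanti _, fun mu hmu => ?_⟩
  · obtain ⟨e'⟩ := hty (E H)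
    have h1 := Nat.card_congr e'.toEquiv
    rw [Nat.card_pi, Finset.prod_congr rfl fun i _ => Nat.card_zmod _,
      Finset.prod_pow_eq_pow_sum] at h1
    rw [← h1]
    refine (AddSubgroup.index_map_of_bijective (f := e.toAddMonoidHom) e.bijective H).symm.trans ?_
    exact (hd _).symm
  · refine Nat.card_congr (E.subtypeEquiv fun H => ?_)
    obtain ⟨e'⟩ := hty (E H)
    constructor
    · rintro rfl
      exact ⟨e'⟩
    · rintro ⟨e''⟩
      exact eq_of_addEquiv (hanti _) hmu (e'.symm.trans e'')

end Types

/-! ### Ideals dividing an unramified prime -/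

section Dedekind

variable {O : Type*} [CommRing O] [IsDedekindDomain O] [CharZero O]
variable {p : ℕ} [hp : Fact p.Prime] {g : ℕ} {P : Fin g → Ideal O}

lemma prime_of_prod_eq (hP : ∀ i, (P i).IsPrime) (hprod : Ideal.span {(p : O)} = ∏ i, P i)
    (i : Fin g) : Prime (P i) := by
  refine Ideal.prime_of_isPrime (fun h => ?_) (hP i)
  have h1 : ∏ i, P i = ⊥ := Finset.prod_eq_zero (Finset.mem_univ i) h
  rw [← hprod, Ideal.span_singleton_eq_bot] at h1
  exact hp.out.ne_zero (by exact_mod_cast h1)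

lemma isMaximal_of_prod_eq (hP : ∀ i, (P i).IsPrime) (hprod : Ideal.span {(p : O)} = ∏ i, P i)
    (i : Fin g) : (P i).IsMaximal :=
  (hP i).isMaximal (prime_of_prod_eq hP hprod i).ne_zero

lemma eq_of_dvd (hP : ∀ i, (P i).IsPrime) (hprod : Ideal.span {(p : O)} = ∏ i, P i)
    {Q : Ideal O} (hQ : Prime Q) {i : Fin g} (h : Q ∣ P i) : Q = P i :=
  associated_iff_eq.1 (hQ.associated_of_dvd (prime_of_prod_eq hP hprod i) h)

/-- An ideal containing a power of `p` is a product of primes above `p`. -/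
lemma exists_eq_prod_pow (hP : ∀ i, (P i).IsPrime) (hinj : Function.Injective P)
    (hprod : Ideal.span {(p : O)} = ∏ i, P i) {I : Ideal O} {k : ℕ} (hI : (p : O) ^ k ∈ I) :
    ∃ l : Fin g → ℕ, I = ∏ i, P i ^ l i := by
  classical
  have hdvd : I ∣ (∏ i, P i) ^ k := by
    rw [← hprod, Ideal.span_singleton_pow, Ideal.dvd_iff_le, Ideal.span_singleton_le_iff_mem]
    exact hI
  have hne : I ≠ ⊥ := by
    rintro rfl
    rw [Submodule.mem_bot] at hI
    exact pow_ne_zero k (by exact_mod_cast hp.out.ne_zero) hI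
  refine ⟨fun i => (UniqueFactorizationMonoid.normalizedFactors I).count (P i), ?_⟩
  conv_lhs => rw [← Ideal.prod_normalizedFactors_eq_self hne, Finset.prod_multiset_count]
  rw [← Finset.prod_image (s := Finset.univ) (g := P) (f := fun Q =>
    Q ^ (UniqueFactorizationMonoid.normalizedFactors I).count Q) (fun _ _ _ _ h => hinj h)]
  refine Finset.prod_subset (fun Q hQ => ?_) fun Q _ hQ => ?_
  · rw [Multiset.mem_toFinset] at hQ
    have hQp := UniqueFactorizationMonoid.prime_of_normalized_factor Q hQ
    have h1 := hQp.dvd_of_dvd_pow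
      ((UniqueFactorizationMonoid.dvd_of_mem_normalizedFactors hQ).trans hdvd)
    obtain ⟨i, -, hi⟩ := (hQp.dvd_finsetProd_iff _).1 h1
    exact Finset.mem_image.2 ⟨i, Finset.mem_univ i, (eq_of_dvd hP hprod hQp hi).symm⟩
  · rw [Multiset.mem_toFinset] at hQ
    rw [Multiset.count_eq_zero_of_notMem hQ, pow_zero]

lemma prod_pow_injective (hP : ∀ i, (P i).IsPrime) (hinj : Function.Injective P)
    (hprod : Ideal.span {(p : O)} = ∏ i, P i) :
    Function.Injective fun l : Fin g → ℕ => ∏ i, P i ^ l i := by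
  have key : ∀ l l' : Fin g → ℕ, ∏ i, P i ^ l i ∣ ∏ i, P i ^ l' i → ∀ i, l i ≤ l' i := by
    intro l l' h i
    have hi := prime_of_prod_eq hP hprod i
    have h1 : P i ^ l i ∣ ∏ i, P i ^ l' i :=
      (Finset.dvd_prod_of_mem (fun i => P i ^ l i) (Finset.mem_univ i)).trans h
    rw [← Finset.mul_prod_erase _ _ (Finset.mem_univ i)] at h1
    have h2 := hi.pow_dvd_of_dvd_mul_right (l i) (fun h3 => by
      obtain ⟨j, hj, h4⟩ := (hi.dvd_finsetProd_iff _).1 h3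
      exact (Finset.mem_erase.1 hj).1
        (hinj (eq_of_dvd hP hprod hi (hi.dvd_of_dvd_pow h4)).symm)) h1
    exact (pow_dvd_pow_iff hi.ne_zero hi.not_isUnit).1 h2
  intro l l' h
  simp only at h
  exact funext fun i => le_antisymm (key l l' (dvd_of_eq h) i) (key l' l (dvd_of_eq h.symm) i)

omit [CharZero O] hp in
lemma pow_mem_prod_pow (hprod : Ideal.span {(p : O)} = ∏ i, P i) {l : Fin g → ℕ} {k : ℕ}
    (hl : ∀ i, l i ≤ k) : (p : O) ^ k ∈ ∏ i, P i ^ l i := by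
  rw [← Ideal.span_singleton_le_iff_mem, ← Ideal.span_singleton_pow, hprod, ← Ideal.dvd_iff_le,
    ← Finset.prod_pow]
  exact Finset.prod_dvd_prod_of_dvd _ _ fun i _ => pow_dvd_pow _ (hl i)

/-- As `p` is unramified, it generates each prime above it up to high powers of that prime. -/
lemma le_span_sup_pow (hP : ∀ i, (P i).IsPrime) (hinj : Function.Injective P)
    (hprod : Ideal.span {(p : O)} = ∏ i, P i) (i : Fin g) (l : ℕ) :
    P i ≤ Ideal.span {(p : O)} ⊔ P i ^ l := by
  set Q := ∏ j ∈ Finset.univ.erase i, P j with hQ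
  have hPQ : Ideal.span {(p : O)} = P i * Q := by
    rw [hprod, hQ, Finset.mul_prod_erase _ _ (Finset.mem_univ i)]
  have hcop : Q ⊔ P i ^ l = ⊤ := by
    by_contra hne
    obtain ⟨M, hM, hle⟩ := Ideal.exists_le_maximal _ hne
    have h1 : P i ≤ M := by
      rcases Nat.eq_zero_or_pos l with rfl | hl
      · exact absurd (by simp) hne
      · exact (hM.isPrime.pow_le_iff hl.ne').1 (le_sup_right.trans hle)
    have h2 : P i = M := (isMaximal_of_prod_eq hP hprod i).eq_of_le hM.ne_top h1
    obtain ⟨j, hj, h3⟩ := (hM.isPrime.prod_le).1 (le_sup_left.trans hle)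
    rw [← h2] at h3
    exact (Finset.mem_erase.1 hj).1
      (hinj ((isMaximal_of_prod_eq hP hprod j).eq_of_le (hP i).ne_top h3))
  calc P i = P i * (Q ⊔ P i ^ l) := by rw [hcop, Ideal.mul_top]
    _ = Ideal.span {(p : O)} ⊔ P i * P i ^ l := by rw [Ideal.mul_sup, ← hPQ]
    _ ≤ _ := sup_le_sup_left Ideal.mul_le_right _

variable [Module.Free ℤ O] [Module.Finite ℤ O] {f : Fin g → ℕ}

omit [CharZero O] in
lemma absNorm_eq_pow (hP : ∀ i, (P i).IsPrime) (hprod : Ideal.span {(p : O)} = ∏ i, P i)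
    (hdeg : ∀ i, (P i).inertiaDeg ℤ = f i) (i : Fin g) : Ideal.absNorm (P i) = p ^ f i := by
  have h1 := hP i
  have h2 : (P i).LiesOver (Ideal.span {(p : ℤ)}) := by
    rw [Ideal.liesOver_iff]
    have hmax : (Ideal.span {(p : ℤ)}).IsMaximal :=
      PrincipalIdealRing.isMaximal_of_irreducible
        (Nat.prime_iff_prime_int.1 hp.out).irreducible
    refine hmax.eq_of_le (Ideal.IsPrime.under ℤ (P i)).ne_top ?_
    rw [Ideal.span_singleton_le_iff_mem, Ideal.under_def, Ideal.mem_comap]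
    have h3 : (p : O) ∈ P i := by
      rw [← Ideal.span_singleton_le_iff_mem, hprod, ← Ideal.dvd_iff_le]
      exact Finset.dvd_prod_of_mem _ (Finset.mem_univ i)
    simpa using h3
  rw [← hdeg i, Ideal.pow_inertiaDeg]

omit [CharZero O] in
lemma finrank_eq_sum (hP : ∀ i, (P i).IsPrime) (hprod : Ideal.span {(p : O)} = ∏ i, P i)
    (hdeg : ∀ i, (P i).inertiaDeg ℤ = f i) : Module.finrank ℤ O = ∑ i, f i := by
  have h1 := Ideal.absNorm_span_natCast (S := O) p
  rw [hprod, map_prod, Finset.prod_congr rfl fun i _ => absNorm_eq_pow hP hprod hdeg i,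
    Finset.prod_pow_eq_pow_sum] at h1
  exact (Nat.pow_right_injective hp.out.two_le h1).symm

/-- An elementary abelian group of order `p ^ k` is generated by `k` elements. -/
lemma exists_generators {G : Type*} [AddCommGroup G] [Module (ZMod p) G] {k : ℕ}
    (hcard : Nat.card G = p ^ k) :
    ∃ b : Fin k → G, ∀ y, ∃ c : Fin k → ℕ, y = ∑ j, c j • b j := by
  have : Finite G := Nat.finite_of_card_ne_zero (by
    rw [hcard]
    exact (pow_pos hp.out.pos _).ne')
  have := Fintype.ofFinite G
  have hrank : Module.finrank (ZMod p) G = k := by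
    have h1 := Module.card_eq_pow_finrank (K := ZMod p) (V := G)
    rw [ZMod.card, ← Nat.card_eq_fintype_card, hcard] at h1
    exact (Nat.pow_right_injective hp.out.two_le h1).symm
  have : Module.Finite (ZMod p) G := Module.Finite.of_finite
  have b := Module.finBasisOfFinrankEq (ZMod p) G hrank
  refine ⟨b, fun y => ⟨fun j => (b.repr y j).val, ?_⟩⟩
  conv_lhs => rw [← b.sum_repr y]
  refine Finset.sum_congr rfl fun j _ => ?_
  rw [← Nat.cast_smul_eq_nsmul (ZMod p), ZMod.natCast_zmod_val]

/-- As `p` is unramified, the additive group of `O / P ^ l` is a power of `ℤ / p ^ l`. -/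
lemma nonempty_quotient_pow_equiv (hP : ∀ i, (P i).IsPrime) (hinj : Function.Injective P)
    (hprod : Ideal.span {(p : O)} = ∏ i, P i) (hdeg : ∀ i, (P i).inertiaDeg ℤ = f i) (i : Fin g)
    (l : ℕ) : Nonempty ((Fin (f i) → ZMod (p ^ l)) ≃+ O ⧸ P i ^ l) := by
  have hpP : (p : O) ∈ P i := by
    rw [← Ideal.span_singleton_le_iff_mem, hprod, ← Ideal.dvd_iff_le]
    exact Finset.dvd_prod_of_mem _ (Finset.mem_univ i)
  have hcard : Nat.card (O ⧸ P i) = p ^ f i := absNorm_eq_pow hP hprod hdeg i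
  have hcard' : Nat.card (O ⧸ P i ^ l) = p ^ (f i * l) := by
    have : Ideal.absNorm (P i ^ l) = p ^ (f i * l) := by
      rw [map_pow, absNorm_eq_pow hP hprod hdeg, pow_mul]
    exact this
  -- generators of the residue field
  obtain ⟨x, hx⟩ : ∃ x : Fin (f i) → O, ∀ y, ∃ c : Fin (f i) → ℕ, y - ∑ j, c j • x j ∈ P i := by
    obtain ⟨b, hb⟩ := @exists_generators p _ (O ⧸ P i) _ (AddCommGroup.zmodModule fun y => by
      obtain ⟨y, rfl⟩ := Ideal.Quotient.mk_surjective y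
      rw [nsmul_eq_mul, ← map_natCast (Ideal.Quotient.mk (P i)), ← map_mul,
        Ideal.Quotient.eq_zero_iff_mem]
      exact Ideal.mul_mem_right _ _ hpP) _ hcard
    choose x hx using fun j => Ideal.Quotient.mk_surjective (b j)
    refine ⟨x, fun y => ?_⟩
    obtain ⟨c, hc⟩ := hb (Ideal.Quotient.mk _ y)
    refine ⟨c, ?_⟩
    rw [← Ideal.Quotient.eq, map_sum, hc]
    exact Finset.sum_congr rfl fun j _ => by rw [map_nsmul, hx]
  let ψ : Fin (f i) → (ZMod (p ^ l) →+ O ⧸ P i ^ l) := fun j => ZMod.lift (p ^ l)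
    ⟨(zmultiplesHom (O ⧸ P i ^ l)) (Ideal.Quotient.mk _ (x j)), by
      rw [zmultiplesHom_apply, natCast_zsmul, ← map_nsmul, Ideal.Quotient.eq_zero_iff_mem,
        nsmul_eq_mul, Nat.cast_pow]
      exact Ideal.mul_mem_right _ _ (Ideal.pow_mem_pow hpP l)⟩
  have hψ : ∀ j (c : ℕ), ψ j (c : ZMod (p ^ l)) = Ideal.Quotient.mk _ (c • x j) := by
    intro j c
    have h1 := ZMod.lift_coe (p ^ l) ⟨(zmultiplesHom (O ⧸ P i ^ l)) (Ideal.Quotient.mk _ (x j)), by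
      rw [zmultiplesHom_apply, natCast_zsmul, ← map_nsmul, Ideal.Quotient.eq_zero_iff_mem,
        nsmul_eq_mul, Nat.cast_pow]
      exact Ideal.mul_mem_right _ _ (Ideal.pow_mem_pow hpP l)⟩ (c : ℤ)
    rw [Int.cast_natCast] at h1
    exact h1.trans ((natCast_zsmul _ _).trans (map_nsmul _ _ _).symm)
  let Φ : (Fin (f i) → ZMod (p ^ l)) →+ O ⧸ P i ^ l :=
    ∑ j, (ψ j).comp (Pi.evalAddMonoidHom _ j)
  have hΦ : ∀ c : Fin (f i) → ℕ, Φ (fun j => (c j : ZMod (p ^ l))) =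
      Ideal.Quotient.mk _ (∑ j, c j • x j) := by
    intro c
    rw [AddMonoidHom.finsetSum_apply, map_sum]
    exact Finset.sum_congr rfl fun j _ => hψ j (c j)
  -- as `p` generates the prime up to `P ^ l`, the generators generate everything modulo `p`
  have hstep : ∀ y : O, ∃ c z, Ideal.Quotient.mk (P i ^ l) y = Φ c + p • Ideal.Quotient.mk _ z := by
    intro y
    obtain ⟨c, hc⟩ := hx y
    obtain ⟨a, ha, b, hb, hab⟩ := Submodule.mem_sup.1 (le_span_sup_pow hP hinj hprod i l hc)
    obtain ⟨z, rfl⟩ := Ideal.mem_span_singleton'.1 ha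
    refine ⟨fun j => (c j : ZMod (p ^ l)), z, ?_⟩
    rw [hΦ, ← map_nsmul, ← map_add, Ideal.Quotient.eq]
    rw [show y - (∑ j, c j • x j + p • z) = b by
      rw [← sub_sub, ← hab, nsmul_eq_mul]
      ring]
    exact hb
  have hsurj : Function.Surjective Φ := by
    have h1 : ∀ (m : ℕ) (y : O), ∃ c z,
        Ideal.Quotient.mk (P i ^ l) y = Φ c + p ^ m • Ideal.Quotient.mk _ z := by
      intro m
      induction m with
      | zero => exact fun y => ⟨0, y, by rw [map_zero, pow_zero, one_smul, zero_add]⟩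
      | succ m ih =>
        intro y
        obtain ⟨c, z, h⟩ := ih y
        obtain ⟨c', z', h'⟩ := hstep z
        refine ⟨c + p ^ m • c', z', ?_⟩
        rw [h, h', map_add, map_nsmul, smul_add, smul_smul, pow_succ, add_assoc]
    intro y
    obtain ⟨y, rfl⟩ := Ideal.Quotient.mk_surjective y
    obtain ⟨c, z, h⟩ := h1 l y
    refine ⟨c, ?_⟩
    rw [h, ← map_nsmul, Ideal.Quotient.eq_zero_iff_mem.2, add_zero]
    rw [nsmul_eq_mul, Nat.cast_pow]
    exact Ideal.mul_mem_right _ _ (Ideal.pow_mem_pow hpP l)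
  have : NeZero (p ^ l) := ⟨(pow_pos hp.out.pos _).ne'⟩
  refine ⟨AddEquiv.ofBijective Φ (hsurj.bijective_of_nat_card_le ?_)⟩
  rw [hcard', Nat.card_fun, Nat.card_zmod, Nat.card_fin, ← pow_mul, mul_comm]

lemma nonempty_quotient_prod_equiv (hP : ∀ i, (P i).IsPrime) (hinj : Function.Injective P)
    (hprod : Ideal.span {(p : O)} = ∏ i, P i) (hdeg : ∀ i, (P i).inertiaDeg ℤ = f i) {n : ℕ}
    (hn : ∑ i, f i = n) (l : Fin g → ℕ) :
    Nonempty ((O ⧸ ∏ i, P i ^ l i) ≃+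
      ∀ j : Fin n, ZMod (p ^ sortDesc (l ∘ block hn) j)) := by
  have e₁ := (IsDedekindDomain.quotientEquivPiOfProdEq (∏ i, P i ^ l i) P l
    (prime_of_prod_eq hP hprod) (fun i j hij h => hij (hinj h)) rfl).toAddEquiv
  have e₂ := fun i => (nonempty_quotient_pow_equiv hP hinj hprod hdeg i (l i)).some.symm
  have e₃ : ∀ i, {x // block hn x = i} ≃ Fin (f i) := fun i =>
    Fintype.equivFinOfCardEq (by rw [Fintype.card_subtype, card_block])
  let q : (∀ i, Fin (f i) → ZMod (p ^ l i)) →+ ∀ x : Fin n, ZMod (p ^ l (block hn x)) :=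
    { toFun := fun a x => a (block hn x) (e₃ _ ⟨x, rfl⟩)
      map_zero' := rfl
      map_add' := fun a b => rfl }
  have hq : Function.Bijective q := by
    constructor
    · intro a b h
      funext i y
      obtain ⟨⟨x, rfl⟩, rfl⟩ := (e₃ i).surjective y
      exact congrFun h x
    · intro a
      let G : ∀ i, {x // block hn x = i} → ZMod (p ^ l i) := fun i y => y.2 ▸ a y.1
      refine ⟨fun i y => G i ((e₃ i).symm y), funext fun x => ?_⟩
      exact congrArg (G _) ((e₃ _).symm_apply_apply ⟨x, rfl⟩)
  have e₄ := AddEquiv.ofBijective q hq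
  have e₅ := (RingEquiv.piCongrLeft (fun x => ZMod (p ^ l (block hn x)))
    (Tuple.sort (OrderDual.toDual ∘ (l ∘ block hn)))).symm.toAddEquiv
  exact ⟨e₁.trans ((AddEquiv.piCongrRight e₂).trans (e₄.trans e₅))⟩

end Dedekind

/-! ### The completion of a Dedekind ring at an unramified prime -/

section Completion

open TensorProduct

variable {p : ℕ} [hp : Fact p.Prime] {O : Type*} [CommRing O]

/-- The map from `O` to `ℤ_p ⊗ O`. -/
noncomputable abbrev toCompletion (p : ℕ) [Fact p.Prime] (O : Type*) [CommRing O] :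
    O →+* ℤ_[p] ⊗[ℤ] O :=
  (Algebra.TensorProduct.includeRight : O →ₐ[ℤ] ℤ_[p] ⊗[ℤ] O).toRingHom

lemma toCompletion_apply (x : O) : toCompletion p O x = 1 ⊗ₜ x := rfl

/-- `O` is dense in its completion. -/
lemma exists_approx (k : ℕ) (x : ℤ_[p] ⊗[ℤ] O) :
    ∃ y z, x = toCompletion p O y + (p : ℤ_[p] ⊗[ℤ] O) ^ k * z := by
  induction x with
  | zero => exact ⟨0, 0, by rw [map_zero, mul_zero, add_zero]⟩
  | tmul a y =>
    obtain ⟨d, hd⟩ := Ideal.mem_span_singleton'.1 (PadicInt.appr_spec k a)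
    refine ⟨a.appr k * y, d ⊗ₜ y, ?_⟩
    have h1 : (p : ℤ_[p] ⊗[ℤ] O) ^ k * d ⊗ₜ y = (d * (p : ℤ_[p]) ^ k) ⊗ₜ y := by
      rw [← map_natCast (algebraMap ℤ_[p] (ℤ_[p] ⊗[ℤ] O)), ← map_pow, ← Algebra.smul_def,
        smul_tmul', smul_eq_mul, mul_comm]
    have h2 : toCompletion p O (a.appr k * y) = (a.appr k : ℤ_[p]) ⊗ₜ y := by
      rw [toCompletion_apply, ← nsmul_eq_mul, tmul_smul, smul_tmul', nsmul_one]
    rw [h1, h2, hd, ← add_tmul, add_sub_cancel]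
  | add x x' h h' =>
    obtain ⟨y, z, rfl⟩ := h
    obtain ⟨y', z', rfl⟩ := h'
    exact ⟨y + y', z + z', by rw [map_add]; ring⟩

/-- An element of `O` divisible by `p ^ k` in the completion is divisible by `p ^ k` in `O`. -/
lemma dvd_of_toCompletion_eq [Module.Free ℤ O] [Module.Finite ℤ O] {k : ℕ} {x : O} {z : ℤ_[p] ⊗[ℤ] O}
    (h : toCompletion p O x = (p : ℤ_[p] ⊗[ℤ] O) ^ k * z) : (p : O) ^ k ∣ x := by
  have b := Module.Free.chooseBasis ℤ O
  have h1 : ∀ i, (p : ℤ) ^ k ∣ b.repr x i := by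
    intro i
    have h2 := congrArg (fun y => (Algebra.TensorProduct.basis ℤ_[p] b).repr y i) h
    simp only [toCompletion_apply, Algebra.TensorProduct.basis_repr_tmul] at h2
    rw [← map_natCast (algebraMap ℤ_[p] (ℤ_[p] ⊗[ℤ] O)), ← map_pow, ← Algebra.smul_def,
      map_smul] at h2
    simp only [one_smul, Finsupp.mapRange_apply, Finsupp.smul_apply, smul_eq_mul] at h2
    rw [← PadicInt.pow_p_dvd_int_iff]
    exact ⟨_, h2⟩
  rw [← b.sum_repr x]
  refine Finset.dvd_sum fun i _ => ?_
  rw [zsmul_eq_mul]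
  refine Dvd.dvd.mul_right ?_ _
  obtain ⟨c, hc⟩ := h1 i
  exact ⟨c, by rw [hc]; push_cast; ring⟩

/-- The completion is integral over `ℤ_p`, so that all its maximal ideals contain `p`. -/
lemma mem_jacobson [Module.Free ℤ O] [Module.Finite ℤ O] :
    (p : ℤ_[p] ⊗[ℤ] O) ∈ Ideal.jacobson (⊥ : Ideal (ℤ_[p] ⊗[ℤ] O)) := by
  rw [Ideal.jacobson, Ideal.mem_sInf]
  rintro M ⟨-, hM⟩
  have h1 := IsLocalRing.eq_maximalIdeal
    (Ideal.isMaximal_comap_of_isIntegral_of_isMaximal (R := ℤ_[p]) M)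
  have h2 : (p : ℤ_[p]) ∈ M.comap (algebraMap ℤ_[p] (ℤ_[p] ⊗[ℤ] O)) := by
    rw [h1, PadicInt.maximalIdeal_eq_span_p]
    exact Ideal.mem_span_singleton_self _
  simpa using h2

lemma natCast_mem_nonZeroDivisors [Module.Free ℤ O] :
    (p : ℤ_[p] ⊗[ℤ] O) ∈ nonZeroDivisors (ℤ_[p] ⊗[ℤ] O) := by
  rw [mem_nonZeroDivisors_iff_right]
  intro z hz
  rw [mul_comm, ← map_natCast (algebraMap ℤ_[p] (ℤ_[p] ⊗[ℤ] O)), ← Algebra.smul_def] at hz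
  exact (smul_eq_zero.1 hz).resolve_left (by exact_mod_cast hp.out.ne_zero)

/-- The elements of an ideal of `O` are `p`-adically dense in its extension. -/
lemma mem_map_toCompletion {I : Ideal O} {x : ℤ_[p] ⊗[ℤ] O} (k : ℕ)
    (hx : x ∈ I.map (toCompletion p O)) :
    ∃ a ∈ I, ∃ z, x = toCompletion p O a + (p : ℤ_[p] ⊗[ℤ] O) ^ k * z := by
  induction hx using Submodule.span_induction with
  | mem x hx =>
    obtain ⟨a, ha, rfl⟩ := hx
    exact ⟨a, ha, 0, by rw [mul_zero, add_zero]⟩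
  | zero => exact ⟨0, I.zero_mem, 0, by rw [map_zero, mul_zero, add_zero]⟩
  | add x x' _ _ h h' =>
    obtain ⟨a, ha, z, rfl⟩ := h
    obtain ⟨a', ha', z', rfl⟩ := h'
    exact ⟨a + a', I.add_mem ha ha', z + z', by rw [map_add]; ring⟩
  | smul r x _ h =>
    obtain ⟨a, ha, z, rfl⟩ := h
    obtain ⟨y, z', hr⟩ := exists_approx k r
    refine ⟨y * a, I.mul_mem_left y ha, z' * toCompletion p O a + r * z, ?_⟩
    rw [map_mul, smul_eq_mul, mul_add]
    nth_rewrite 1 [hr]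
    ring

lemma comap_map_toCompletion [Module.Free ℤ O] [Module.Finite ℤ O] {I : Ideal O} {k : ℕ} (hI : (p : O) ^ k ∈ I) :
    (I.map (toCompletion p O)).comap (toCompletion p O) = I := by
  refine le_antisymm (fun x hx => ?_) Ideal.le_comap_map
  obtain ⟨a, ha, z, h⟩ := mem_map_toCompletion k (Ideal.mem_comap.1 hx)
  rw [← sub_eq_iff_eq_add', ← map_sub] at h
  have := I.add_mem (I.mem_of_dvd (dvd_of_toCompletion_eq h) hI) ha
  rwa [sub_add_cancel] at this

lemma map_comap_toCompletion {J : Ideal (ℤ_[p] ⊗[ℤ] O)} {k : ℕ}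
    (hJ : (p : ℤ_[p] ⊗[ℤ] O) ^ k ∈ J) :
    (J.comap (toCompletion p O)).map (toCompletion p O) = J := by
  refine le_antisymm Ideal.map_comap_le fun x hx => ?_
  obtain ⟨y, z, rfl⟩ := exists_approx k x
  have h1 : (p : ℤ_[p] ⊗[ℤ] O) ^ k ∈ (J.comap (toCompletion p O)).map (toCompletion p O) := by
    have h2 : toCompletion p O ((p : O) ^ k) = (p : ℤ_[p] ⊗[ℤ] O) ^ k := by
      rw [map_pow, map_natCast]
    rw [← h2]
    exact Ideal.mem_map_of_mem _ (by rwa [Ideal.mem_comap, h2])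
  refine Ideal.add_mem _ (Ideal.mem_map_of_mem _ ?_) (Ideal.mul_mem_right _ _ h1)
  rw [Ideal.mem_comap]
  have := J.sub_mem hx (J.mul_mem_right z hJ)
  rwa [add_sub_cancel_right] at this

/-- An ideal of finite index `m` contains `m`, which is a power of `p` up to a unit of `ℤ_p`. -/
lemma exists_pow_mem {J : Ideal (ℤ_[p] ⊗[ℤ] O)} (hJ : J.toAddSubgroup.index ≠ 0) :
    ∃ k, (p : ℤ_[p] ⊗[ℤ] O) ^ k ∈ J := by
  obtain ⟨k, hk⟩ := PadicInt.ideal_eq_span_pow_p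
    (s := Ideal.span {(J.toAddSubgroup.index : ℤ_[p])}) (by
      rw [Ne, Ideal.span_singleton_eq_bot]
      exact_mod_cast hJ)
  obtain ⟨c, hc⟩ := Ideal.mem_span_singleton'.1 (hk ▸ Ideal.mem_span_singleton_self ((p : ℤ_[p]) ^ k))
  refine ⟨k, ?_⟩
  have h1 := J.mul_mem_left (algebraMap ℤ_[p] _ c) (J.toAddSubgroup.nsmul_index_mem 1)
  have h2 := congrArg (algebraMap ℤ_[p] (ℤ_[p] ⊗[ℤ] O)) hc
  rw [map_mul, map_natCast, map_pow, map_natCast] at h2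
  rwa [nsmul_one, h2] at h1

variable [IsDedekindDomain O] [CharZero O] [Module.Free ℤ O] [Module.Finite ℤ O] {g : ℕ}
  {P : Fin g → Ideal O}

/-- The extension of a prime above `p` to the completion is principal, by Nakayama's lemma. -/
lemma exists_map_eq_span (hP : ∀ i, (P i).IsPrime) (hprod : Ideal.span {(p : O)} = ∏ i, P i)
    (i : Fin g) : ∃ a, (P i).map (toCompletion p O) = Ideal.span {a} := by
  have hp0 : Ideal.span {(p : O)} ≠ 0 := by
    rw [Ne, Ideal.zero_eq_bot, Ideal.span_singleton_eq_bot]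
    exact_mod_cast hp.out.ne_zero
  obtain ⟨b, hb⟩ := IsDedekindDomain.exists_sup_span_eq (I := Ideal.span {(p : O)} * P i)
    (J := P i) Ideal.mul_le_right (mul_ne_zero hp0 (prime_of_prod_eq hP hprod i).ne_zero)
  refine ⟨toCompletion p O b, le_antisymm ?_ ?_⟩
  · refine Submodule.le_of_le_smul_of_le_jacobson_bot (I := Ideal.span {(p : ℤ_[p] ⊗[ℤ] O)})
      ?_ ?_ ?_
    · exact Ideal.FG.map (IsNoetherian.noetherian (P i)) _
    · rw [Ideal.span_singleton_le_iff_mem]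
      exact mem_jacobson
    · conv_lhs => rw [← hb]
      rw [Ideal.map_sup, Ideal.map_mul, Ideal.map_span, Ideal.map_span, Set.image_singleton,
        Set.image_singleton, map_natCast, sup_comm]
      rfl
  · rw [Ideal.span_singleton_le_iff_mem]
    refine Ideal.mem_map_of_mem _ ?_
    rw [← hb]
    exact Ideal.mem_sup_right (Ideal.mem_span_singleton_self b)

variable {π : Fin g → ℤ_[p] ⊗[ℤ] O}

omit [IsDedekindDomain O] [CharZero O] [Module.Free ℤ O] [Module.Finite ℤ O] in
lemma map_prod_pow (hπ : ∀ i, (P i).map (toCompletion p O) = Ideal.span {π i}) (l : Fin g → ℕ) :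
    (∏ i, P i ^ l i).map (toCompletion p O) = Ideal.span {∏ i, π i ^ l i} := by
  rw [← Ideal.mapHom_apply, map_prod, ← Ideal.prod_span_singleton]
  refine Finset.prod_congr rfl fun i _ => ?_
  rw [map_pow, Ideal.mapHom_apply, hπ, Ideal.span_singleton_pow]

omit [CharZero O] [Module.Finite ℤ O] in
lemma uniformizer_mem_nonZeroDivisors (hprod : Ideal.span {(p : O)} = ∏ i, P i)
    (hπ : ∀ i, (P i).map (toCompletion p O) = Ideal.span {π i}) (l : Fin g → ℕ) :
    ∏ i, π i ^ l i ∈ nonZeroDivisors (ℤ_[p] ⊗[ℤ] O) := by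
  refine prod_mem fun i _ => pow_mem ?_ _
  have h1 : toCompletion p O p ∈ (P i).map (toCompletion p O) := by
    refine Ideal.mem_map_of_mem _ ?_
    rw [← Ideal.span_singleton_le_iff_mem, hprod, ← Ideal.dvd_iff_le]
    exact Finset.dvd_prod_of_mem _ (Finset.mem_univ i)
  rw [hπ, map_natCast, Ideal.mem_span_singleton'] at h1
  obtain ⟨c, hc⟩ := h1
  have h2 := natCast_mem_nonZeroDivisors (p := p) (O := O)
  rw [← hc] at h2
  exact (mul_mem_nonZeroDivisors.1 h2).2

omit [Module.Free ℤ O] [Module.Finite ℤ O] in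
/-- Ideals of finite index are extended from `O`, hence products of powers of the primes above `p`.
-/
lemma exists_eq_span_prod_pow (hP : ∀ i, (P i).IsPrime) (hinj : Function.Injective P)
    (hprod : Ideal.span {(p : O)} = ∏ i, P i)
    (hπ : ∀ i, (P i).map (toCompletion p O) = Ideal.span {π i})
    {J : Ideal (ℤ_[p] ⊗[ℤ] O)} (hJ : J.toAddSubgroup.index ≠ 0) :
    ∃ l : Fin g → ℕ, J = Ideal.span {∏ i, π i ^ l i} := by
  obtain ⟨k, hk⟩ := exists_pow_mem hJ
  obtain ⟨l, hl⟩ := exists_eq_prod_pow (k := k) hP hinj hprod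
    (I := J.comap (toCompletion p O)) (by rwa [Ideal.mem_comap, map_pow, map_natCast])
  exact ⟨l, by rw [← map_prod_pow hπ, ← hl, map_comap_toCompletion hk]⟩

omit [CharZero O] in
lemma comap_span_prod_pow (hprod : Ideal.span {(p : O)} = ∏ i, P i)
    (hπ : ∀ i, (P i).map (toCompletion p O) = Ideal.span {π i}) (l : Fin g → ℕ) :
    (Ideal.span {∏ i, π i ^ l i}).comap (toCompletion p O) = ∏ i, P i ^ l i := by
  rw [← map_prod_pow hπ, comap_map_toCompletion (pow_mem_prod_pow hprod
    (fun i => Finset.le_sup (f := l) (Finset.mem_univ i)))]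

lemma span_prod_pow_injective (hP : ∀ i, (P i).IsPrime) (hinj : Function.Injective P)
    (hprod : Ideal.span {(p : O)} = ∏ i, P i)
    (hπ : ∀ i, (P i).map (toCompletion p O) = Ideal.span {π i}) {l l' : Fin g → ℕ}
    (h : Ideal.span {∏ i, π i ^ l i} = Ideal.span {∏ i, π i ^ l' i}) : l = l' := by
  refine prod_pow_injective hP hinj hprod ?_
  simp only
  rw [← comap_span_prod_pow hprod hπ, h, comap_span_prod_pow hprod hπ]

lemma nonempty_quotient_span_equiv {f : Fin g → ℕ} {n : ℕ} (hP : ∀ i, (P i).IsPrime)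
    (hinj : Function.Injective P)
    (hprod : Ideal.span {(p : O)} = ∏ i, P i) (hdeg : ∀ i, (P i).inertiaDeg ℤ = f i)
    (hn : ∑ i, f i = n) (hπ : ∀ i, (P i).map (toCompletion p O) = Ideal.span {π i})
    (l : Fin g → ℕ) : Nonempty (((ℤ_[p] ⊗[ℤ] O) ⧸ Ideal.span {∏ i, π i ^ l i}) ≃+
      ∀ j : Fin n, ZMod (p ^ sortDesc (l ∘ block hn) j)) := by
  obtain ⟨e⟩ := nonempty_quotient_prod_equiv hP hinj hprod hdeg hn l
  set J := Ideal.span {∏ i, π i ^ l i} with hJ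
  have hker : RingHom.ker ((Ideal.Quotient.mk J).comp (toCompletion p O)) = ∏ i, P i ^ l i := by
    rw [← RingHom.comap_ker, Ideal.mk_ker, hJ, comap_span_prod_pow hprod hπ]
  have hsurj : Function.Surjective ((Ideal.Quotient.mk J).comp (toCompletion p O)) := by
    intro x
    obtain ⟨x, rfl⟩ := Ideal.Quotient.mk_surjective x
    have h1 := pow_mem_prod_pow hprod (fun i => Finset.le_sup (f := l) (Finset.mem_univ i))
    rw [← comap_span_prod_pow hprod hπ l, Ideal.mem_comap, map_pow, map_natCast, ← hJ] at h1
    obtain ⟨y, z, rfl⟩ := exists_approx (Finset.univ.sup l) x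
    refine ⟨y, ?_⟩
    rw [RingHom.comp_apply, map_add, Ideal.Quotient.eq_zero_iff_mem.2 (J.mul_mem_right z h1),
      add_zero]
  exact ⟨((RingHom.quotientKerEquivOfSurjective hsurj).symm.trans
    (Ideal.quotEquivOfEq hker)).toAddEquiv.trans e⟩

end Completion

/-! ### Submodules of `R × R` and their contents -/

section Content

variable {p : ℕ} [hp : Fact p.Prime] {g n : ℕ} {f : Fin g → ℕ}
variable {R : Type*} [CommRing R] [Algebra ℤ_[p] R]

/-- The properties of a system of uniformizers `π` of the completion of a ring of integers at an
unramified prime `p` with inertia degrees `f`: the nonzero ideals of finite index are uniquely the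
`(∏ π_i ^ l_i)`, and the quotient by such an ideal is a `p`-group of type `λ(l)`, where each `l_i`
is repeated `f_i` times. -/
structure IsUniformizing (hn : ∑ i, f i = n) (p : ℕ) {R : Type*} [CommRing R] (π : Fin g → R) :
    Prop where
  mem_nonZeroDivisors : ∀ l : Fin g → ℕ, ∏ i, π i ^ l i ∈ nonZeroDivisors R
  exists_eq_span : ∀ J : Ideal R, J.toAddSubgroup.index ≠ 0 →
    ∃ l : Fin g → ℕ, J = Ideal.span {∏ i, π i ^ l i}
  span_injective : ∀ l l' : Fin g → ℕ,
    Ideal.span {∏ i, π i ^ l i} = Ideal.span {∏ i, π i ^ l' i} → l = l'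
  nonempty_equiv : ∀ l : Fin g → ℕ, Nonempty ((R ⧸ Ideal.span {∏ i, π i ^ l i}) ≃+
    ∀ j : Fin n, ZMod (p ^ sortDesc (l ∘ block hn) j))

/-- The ideal generated by the coordinates of the elements of a submodule of `R × R`. -/
def content (N : Submodule ℤ_[p] (R × R)) : Ideal R :=
  Ideal.span (Prod.fst '' (N : Set (R × R)) ∪ Prod.snd '' (N : Set (R × R)))

lemma fst_mem_content {N : Submodule ℤ_[p] (R × R)} {x : R × R} (hx : x ∈ N) :
    x.1 ∈ content N := Ideal.subset_span (Or.inl ⟨x, hx, rfl⟩)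

lemma snd_mem_content {N : Submodule ℤ_[p] (R × R)} {x : R × R} (hx : x ∈ N) :
    x.2 ∈ content N := Ideal.subset_span (Or.inr ⟨x, hx, rfl⟩)

lemma content_le_iff {N : Submodule ℤ_[p] (R × R)} {N₂ : Submodule ℤ_[p] R} :
    (content N).restrictScalars ℤ_[p] ≤ N₂ ↔ ∀ x ∈ N, ∀ a, a * x.1 ∈ N₂ ∧ a * x.2 ∈ N₂ := by
  constructor
  · exact fun h x hx a => ⟨h ((content N).mul_mem_left a (fst_mem_content hx)),
      h ((content N).mul_mem_left a (snd_mem_content hx))⟩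
  · intro h y hy
    suffices key : ∀ a, a * y ∈ N₂ by simpa using key 1
    replace hy : y ∈ content N := hy
    induction hy using Submodule.span_induction with
    | mem y hy =>
      rcases hy with ⟨x, hx, rfl⟩ | ⟨x, hx, rfl⟩
      · exact fun a => (h x hx a).1
      · exact fun a => (h x hx a).2
    | zero => exact fun a => by rw [mul_zero]; exact N₂.zero_mem
    | add y z _ _ hy hz => exact fun a => by rw [mul_add]; exact N₂.add_mem (hy a) (hz a)
    | smul r y _ hy => exact fun a => by rw [smul_eq_mul, ← mul_assoc]; exact hy _

/-- The content contains the projection to the first coordinate. -/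
lemma index_content_ne_zero {N : Submodule ℤ_[p] (R × R)} (hN : N.toAddSubgroup.index ≠ 0) :
    (content N).toAddSubgroup.index ≠ 0 := by
  have h1 : (N.toAddSubgroup.map (AddMonoidHom.fst R R)).index ∣ N.toAddSubgroup.index :=
    AddSubgroup.index_map_dvd _ Prod.fst_surjective
  refine fun h0 => hN (Nat.eq_zero_of_zero_dvd ?_)
  have h2 : N.toAddSubgroup.map (AddMonoidHom.fst R R) ≤ (content N).toAddSubgroup := by
    rintro _ ⟨x, hx, rfl⟩
    exact fst_mem_content hx
  exact (h0 ▸ AddSubgroup.index_dvd_of_le h2).trans h1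

/-- The multiples of the elements of a submodule of `R × R` by an element of `R`. -/
noncomputable def scale (a : R) (N : Submodule ℤ_[p] (R × R)) : Submodule ℤ_[p] (R × R) :=
  N.map (Algebra.lsmul ℤ_[p] ℤ_[p] (R × R) a)

lemma content_scale (a : R) (N : Submodule ℤ_[p] (R × R)) :
    content (scale a N) = Ideal.span {a} * content N := by
  rw [content, content, Ideal.span_mul_span', Set.mul_union]
  congr 2 <;>
  · ext x
    simp only [scale, Submodule.map_coe, Set.mem_image, Set.singleton_mul]
    constructor
    · rintro ⟨_, ⟨y, hy, rfl⟩, rfl⟩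
      exact ⟨_, ⟨y, hy, rfl⟩, rfl⟩
    · rintro ⟨_, ⟨y, hy, rfl⟩, rfl⟩
      exact ⟨_, ⟨y, hy, rfl⟩, rfl⟩

/-- The multiplication by `a` maps `R × R` isomorphically to `(a) × (a)`. -/
lemma index_scale {a : R} (ha : a ∈ nonZeroDivisors R) (N : Submodule ℤ_[p] (R × R)) :
    (scale a N).toAddSubgroup.index =
      N.toAddSubgroup.index * (Ideal.span {a}).toAddSubgroup.index ^ 2 := by
  let μ : R × R →+ R × R := (Algebra.lsmul ℤ_[p] ℤ_[p] (R × R) a).toAddMonoidHom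
  have hμ : Function.Injective μ := by
    intro x y h
    have h1 : a * x.1 = a * y.1 := congrArg Prod.fst h
    have h2 : a * x.2 = a * y.2 := congrArg Prod.snd h
    exact Prod.ext (mul_cancel_left_mem_nonZeroDivisors ha |>.1 h1)
      (mul_cancel_left_mem_nonZeroDivisors ha |>.1 h2)
  have h1 : (scale a N).toAddSubgroup = N.toAddSubgroup.map μ := rfl
  have h2 : μ.range = (Ideal.span {a}).toAddSubgroup.prod (Ideal.span {a}).toAddSubgroup := by
    ext x
    rw [AddMonoidHom.mem_range, AddSubgroup.mem_prod]
    constructor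
    · rintro ⟨y, rfl⟩
      exact ⟨Ideal.mem_span_singleton'.2 ⟨y.1, mul_comm _ _⟩,
        Ideal.mem_span_singleton'.2 ⟨y.2, mul_comm _ _⟩⟩
    · rintro ⟨h3, h4⟩
      obtain ⟨b, hb⟩ := Ideal.mem_span_singleton'.1 h3
      obtain ⟨c, hc⟩ := Ideal.mem_span_singleton'.1 h4
      exact ⟨(b, c), Prod.ext ((mul_comm _ _).trans hb) ((mul_comm _ _).trans hc)⟩
  rw [h1, AddSubgroup.index_map_of_injective _ hμ, h2, AddSubgroup.index_prod, sq]

variable {hn : ∑ i, f i = n} {π : Fin g → R}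

/-- The `i`-th block has `f_i` places. -/
lemma sum_comp_block (hn : ∑ i, f i = n) (l : Fin g → ℕ) :
    ∑ j, (l ∘ block hn) j = ∑ i, f i * l i := by
  simp only [Function.comp_apply]
  rw [← Finset.sum_fiberwise (g := block hn)]
  refine Finset.sum_congr rfl fun i _ => ?_
  rw [Finset.sum_congr rfl (g := fun _ => l i), Finset.sum_const, card_block, smul_eq_mul]
  intro j hj
  rw [(Finset.mem_filter.1 hj).2]

omit hp [Algebra ℤ_[p] R] in
lemma IsUniformizing.index_span (h : IsUniformizing hn p π) (l : Fin g → ℕ) :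
    (Ideal.span {∏ i, π i ^ l i}).toAddSubgroup.index = p ^ ∑ i, f i * l i := by
  obtain ⟨e⟩ := h.nonempty_equiv l
  have h1 := Nat.card_congr e.toEquiv
  rw [Nat.card_pi, Finset.prod_congr rfl fun j _ => Nat.card_zmod _, Finset.prod_pow_eq_pow_sum] at h1
  rw [← sum_comp_block hn, ← Equiv.sum_comp (Tuple.sort (OrderDual.toDual ∘ l ∘ block hn))]
  exact h1

/-- The submodules of `R × R` of finite index with content `R`. -/
abbrev Primitive (p : ℕ) [Fact p.Prime] (R : Type*) [CommRing R] [Algebra ℤ_[p] R] :=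
  {N : FinIdx p (R × R) // content N.1 = ⊤}

/-- The multiple by `∏ π_i ^ l_i` of a primitive submodule; every submodule of finite index of `R × R`
is uniquely of this form. -/
noncomputable def IsUniformizing.ofPrimitive (h : IsUniformizing hn p π)
    (x : Primitive p R × (Fin g → ℕ)) : FinIdx p (R × R) :=
  ⟨scale (∏ i, π i ^ x.2 i) x.1.1.1, by
    rw [index_scale (h.mem_nonZeroDivisors _), h.index_span]
    exact mul_ne_zero x.1.1.2 (pow_ne_zero _ (pow_ne_zero _ hp.out.ne_zero))⟩

lemma IsUniformizing.content_ofPrimitive (h : IsUniformizing hn p π)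
    (x : Primitive p R × (Fin g → ℕ)) :
    content (h.ofPrimitive x).1 = Ideal.span {∏ i, π i ^ x.2 i} := by
  rw [ofPrimitive, content_scale, x.1.2, Ideal.mul_top]

lemma IsUniformizing.idx_ofPrimitive (h : IsUniformizing hn p π)
    (x : Primitive p R × (Fin g → ℕ)) :
    (h.ofPrimitive x).idx = x.1.1.idx * p ^ (2 * ∑ i, f i * x.2 i) := by
  rw [FinIdx.idx, ofPrimitive, index_scale (h.mem_nonZeroDivisors _), h.index_span, ← pow_mul,
    mul_comm 2]
  rfl

/-- The exponents are recovered from the content. -/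
lemma IsUniformizing.bijective_ofPrimitive (h : IsUniformizing hn p π) :
    Function.Bijective (h.ofPrimitive (R := R)) := by
  have hinj : ∀ l : Fin g → ℕ, Function.Injective
      (Algebra.lsmul ℤ_[p] ℤ_[p] (R × R) (∏ i, π i ^ l i)) := by
    intro l x y hxy
    have h1 : (∏ i, π i ^ l i) * x.1 = (∏ i, π i ^ l i) * y.1 := congrArg Prod.fst hxy
    have h2 : (∏ i, π i ^ l i) * x.2 = (∏ i, π i ^ l i) * y.2 := congrArg Prod.snd hxy
    exact Prod.ext (mul_cancel_left_mem_nonZeroDivisors (h.mem_nonZeroDivisors l) |>.1 h1)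
      (mul_cancel_left_mem_nonZeroDivisors (h.mem_nonZeroDivisors l) |>.1 h2)
  constructor
  · rintro ⟨N, l⟩ ⟨N', l'⟩ hNN
    have h1 : l = l' := h.span_injective l l' (by
      rw [← h.content_ofPrimitive (N, l), hNN, h.content_ofPrimitive])
    subst h1
    have h2 : scale (∏ i, π i ^ l i) N.1.1 = scale (∏ i, π i ^ l i) N'.1.1 :=
      congrArg Subtype.val hNN
    rw [Subtype.ext (Subtype.ext (Submodule.map_injective_of_injective (hinj l) h2))]
  · intro N
    obtain ⟨l, hl⟩ := h.exists_eq_span _ (index_content_ne_zero N.2)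
    let φ := Algebra.lsmul ℤ_[p] ℤ_[p] (R × R) (∏ i, π i ^ l i)
    have h1 : scale (∏ i, π i ^ l i) (N.1.comap φ) = N.1 := by
      refine Submodule.map_comap_eq_of_le fun x hx => ?_
      have h2 := fst_mem_content hx
      have h3 := snd_mem_content hx
      rw [hl, Ideal.mem_span_singleton'] at h2 h3
      obtain ⟨b, hb⟩ := h2
      obtain ⟨c, hc⟩ := h3
      exact ⟨(b, c), Prod.ext ((mul_comm _ _).trans hb) ((mul_comm _ _).trans hc)⟩
    have h2 : content (N.1.comap φ) = ⊤ := by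
      have h3 := content_scale (∏ i, π i ^ l i) (N.1.comap φ)
      rw [h1, hl] at h3
      have h4 := Ideal.mem_span_singleton_self (∏ i, π i ^ l i)
      rw [h3, Ideal.mem_span_singleton_mul] at h4
      obtain ⟨z, hz, h5⟩ := h4
      rw [Ideal.eq_top_iff_one]
      rwa [← mul_cancel_left_mem_nonZeroDivisors (h.mem_nonZeroDivisors l) |>.1
        (h5.trans (mul_one _).symm)]
    refine ⟨(⟨⟨N.1.comap φ, fun h0 => N.2 ?_⟩, h2⟩, l), Subtype.ext h1⟩
    rw [← h1, index_scale (h.mem_nonZeroDivisors l), h0, zero_mul]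

end Content

/-! ### Ideals of the Heisenberg Lie algebra -/

section Heisenberg

attribute [local instance 100] LieRing.ofAssociativeRing

variable {p : ℕ} [hp : Fact p.Prime]
variable {R : Type*} [CommRing R] [Algebra ℤ_[p] R]

/-- The coordinates of the elements of the Heisenberg Lie algebra. The last one is central. -/
def heisenbergEquiv (p : ℕ) [Fact p.Prime] (R : Type*) [CommRing R] [Algebra ℤ_[p] R] :
    heisenberg ℤ_[p] R ≃ₗ[ℤ_[p]] (R × R) × R where
  toFun X := ((X.1 0 1, X.1 1 2), X.1 0 2)
  map_add' X Y := rfl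
  map_smul' c X := rfl
  invFun x := ⟨!![0, x.1.1, x.2; 0, 0, x.1.2; 0, 0, 0], fun i j h => by
    fin_cases i <;> fin_cases j <;> first | rfl | exact absurd h (by decide)⟩
  left_inv X := by
    have h := X.2
    refine Subtype.ext (Matrix.ext fun i j => ?_)
    fin_cases i <;> fin_cases j <;> first | rfl | exact (h _ _ (by decide)).symm
  right_inv x := rfl

lemma heisenbergEquiv_lie (X Y : heisenberg ℤ_[p] R) : heisenbergEquiv p R ⁅X, Y⁆ =
    (0, X.1 0 1 * Y.1 1 2 - Y.1 0 1 * X.1 1 2) := by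
  have h1 := X.2
  have h2 := Y.2
  have h3 : ∀ i j, (⁅X, Y⁆ : heisenberg ℤ_[p] R).1 i j =
      ∑ k, X.1 i k * Y.1 k j - ∑ k, Y.1 i k * X.1 k j := fun i j => by
    rw [LieSubalgebra.coe_bracket, Ring.lie_def, Matrix.sub_apply, Matrix.mul_apply,
      Matrix.mul_apply]
  have h4 : ∀ Z : heisenberg ℤ_[p] R, ∀ i j : Fin 3, j ≤ i → Z.1 i j = 0 := fun Z => Z.2
  refine Prod.ext (Prod.ext ?_ ?_) ?_
  · refine (h3 0 1).trans ?_
    simp [Fin.sum_univ_three, h4 X 0 0, h4 Y 0 0, h4 X 1 1, h4 Y 1 1, h4 X 2 1, h4 Y 2 1]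
  · refine (h3 1 2).trans ?_
    simp [Fin.sum_univ_three, h4 X 1 0, h4 Y 1 0, h4 X 1 1, h4 Y 1 1, h4 X 2 2, h4 Y 2 2]
  · refine (h3 0 2).trans ?_
    simp [Fin.sum_univ_three, h4 X 0 0, h4 Y 0 0, h4 X 2 2, h4 Y 2 2]

/-- A submodule of the Heisenberg Lie algebra is an ideal if and only if its intersection with the
centre contains the content of its projection to the first two coordinates. -/
lemma lie_mem_iff (N : Submodule ℤ_[p] (heisenberg ℤ_[p] R)) :
    (∀ X Y : heisenberg ℤ_[p] R, Y ∈ N → ⁅X, Y⁆ ∈ N) ↔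
      (content ((N.map (heisenbergEquiv p R : heisenberg ℤ_[p] R →ₗ[ℤ_[p]] (R × R) × R)).map
        (LinearMap.fst ℤ_[p] (R × R) R))).restrictScalars ℤ_[p] ≤
      (N.map (heisenbergEquiv p R : heisenberg ℤ_[p] R →ₗ[ℤ_[p]] (R × R) × R)).comap
        (LinearMap.inr ℤ_[p] (R × R) R) := by
  set e := heisenbergEquiv p R with he
  have hmem : ∀ x, x ∈ N.map (e : heisenberg ℤ_[p] R →ₗ[ℤ_[p]] (R × R) × R) ↔ e.symm x ∈ N :=
    fun x => Submodule.mem_map_equiv (e := e) (x := x) N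
  rw [content_le_iff]
  constructor
  · rintro h _ ⟨_, ⟨Y, hY, rfl⟩, rfl⟩ a
    refine ⟨?_, ?_⟩
    · rw [Submodule.mem_comap, hmem]
      convert h (e.symm ((0, -a), 0)) Y hY using 1
      rw [LinearEquiv.symm_apply_eq, heisenbergEquiv_lie]
      refine Prod.ext rfl ?_
      change a * Y.1 0 1 = 0 * _ - Y.1 0 1 * (-a)
      ring
    · rw [Submodule.mem_comap, hmem]
      convert h (e.symm ((a, 0), 0)) Y hY using 1
      rw [LinearEquiv.symm_apply_eq, heisenbergEquiv_lie]
      refine Prod.ext rfl ?_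
      change a * Y.1 1 2 = a * _ - Y.1 0 1 * 0
      ring
  · intro h X Y hY
    have h1 := h (Y.1 0 1, Y.1 1 2) ⟨_, ⟨Y, hY, rfl⟩, rfl⟩
    have h2 := Submodule.sub_mem _ (h1 (X.1 0 1)).2 (h1 (X.1 1 2)).1
    rw [Submodule.mem_comap, hmem] at h2
    convert h2 using 1
    rw [LinearEquiv.eq_symm_apply, heisenbergEquiv_lie]
    refine Prod.ext rfl ?_
    change _ = X.1 0 1 * Y.1 1 2 - X.1 1 2 * Y.1 0 1
    ring

end Heisenberg

/-! ### The sum of the functions `D` -/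

section Total

variable {p : ℕ} [hp : Fact p.Prime] {g n : ℕ} {f : Fin g → ℕ}

/-- Every pair of partitions has a unique overlap type and a unique set partition interlaced with
it, so that the functions `D` add up to the sum over all pairs. -/
lemma hasSum_sum_DwA (hf : ∀ i, 0 < f i) (hn : ∑ i, f i = n) (hn0 : 0 < n) {t : ℂ}
    (ht : (p : ℝ) ^ (2 * n) * ‖t‖ ^ 3 < 1) [DecidablePred fun mu : Fin n → ℕ => Antitone mu] :
    HasSum (fun x : (Fin g → ℕ) × (Fin n → ℕ) =>
      if Antitone x.2 then term p t (x.1 ∘ block hn, x.2) else 0)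
      (∑ w : {w : DyckWord // w.semilength = n}, ∑ A ∈ compatible f w.1, DwA p n f w.1 A t) := by
  have h1 : HasSum (fun x => ∑ w : {w : DyckWord // w.semilength = n},
      ∑ A ∈ compatible f w.1, interlacedTerm p t hn A x)
      (∑ w : {w : DyckWord // w.semilength = n}, ∑ A ∈ compatible f w.1, DwA p n f w.1 A t) := by
    refine hasSum_sum fun w _ => hasSum_sum fun A hA => ?_
    rw [DwA_eq hf hn w.2 hn0 hA ht]
    exact (hasSum_interlacedTerm hf hn w.2 hn0 hA ht).1
  convert h1 using 1
  funext ⟨m, mu⟩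
  simp only [interlacedTerm]
  split_ifs with hmu
  · by_cases hα : alpha p (sortDesc (m ∘ block hn)) mu = 0
    · have h0 : term p t (m ∘ block hn, mu) = 0 := by
        rw [term, hα, Nat.cast_zero, zero_mul, zero_mul]
      simp only [h0, ite_self, Finset.sum_const_zero]
    · have hle := le_of_alpha_ne_zero p (antitone_sortDesc _) hmu hα
      obtain ⟨w, hw, hwo⟩ := exists_hasOverlapType (antitone_sortDesc _) hmu hle
      obtain ⟨A, hA, hI⟩ := hwo.exists_interlaced hf hn hw hmu
      rw [Finset.sum_eq_single ⟨w, hw⟩, Finset.sum_eq_single_of_mem A hA, if_pos ⟨hmu, hI⟩]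
      · exact fun A' hA' hne => if_neg fun h => hne (h.2.unique hw hA' hA hmu hI)
      · intro w' _ hne
        refine Finset.sum_eq_zero fun A' hA' => if_neg fun h => hne (Subtype.ext ?_)
        exact HasOverlapType.unique (antitone_sortDesc _) hmu w'.2 hw
          (h.2.hasOverlapType hn w'.2 hA' hmu) hwo
      · exact fun h => absurd (Finset.mem_univ _) h
  · exact (Finset.sum_eq_zero fun w _ => Finset.sum_eq_zero fun A _ =>
      if_neg fun h => hmu h.1).symm

/-- A product of geometric series. -/
lemma summable_norm_and_tsum_prod_pow {z : Fin g → ℂ} (hz : ∀ i, ‖z i‖ < 1) :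
    (Summable fun l : Fin g → ℕ => ‖∏ i, z i ^ l i‖) ∧
      ∑' l : Fin g → ℕ, ∏ i, z i ^ l i = ∏ i, (1 - z i)⁻¹ := by
  induction g with
  | zero => exact ⟨Summable.of_finite, by simp⟩
  | succ g ih =>
    obtain ⟨h1, h2⟩ := ih fun i => hz i.succ
    have h3 : Summable fun k : ℕ => ‖z 0 ^ k‖ := by
      simp only [norm_pow]
      exact summable_geometric_of_lt_one (norm_nonneg _) (hz 0)
    have h4 : ∀ x : ℕ × (Fin g → ℕ), ∏ i, z i ^ (Fin.consEquiv (fun _ => ℕ) x) i =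
        z 0 ^ x.1 * ∏ i, z (Fin.succ i) ^ x.2 i := fun x => by
      rw [Fin.prod_univ_succ]
      rfl
    constructor
    · rw [← (Fin.consEquiv fun _ : Fin (g + 1) => ℕ).summable_iff]
      refine (h3.mul_of_nonneg h1 (fun _ => norm_nonneg _) fun _ => norm_nonneg _).congr fun x => ?_
      rw [Function.comp_apply, h4, norm_mul]
    · rw [← (Fin.consEquiv fun _ : Fin (g + 1) => ℕ).tsum_eq, Fin.prod_univ_succ, ← h2,
        ← tsum_geometric_of_norm_lt_one (hz 0), tsum_mul_tsum_of_summable_norm h3 h1]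
      exact tsum_congr h4

omit hp in
lemma natCast_mul_pow_cpow (m k : ℕ) (s : ℂ) :
    ((m * p ^ k : ℕ) : ℂ) ^ (-s) = (m : ℂ) ^ (-s) * ((p : ℂ) ^ (-s)) ^ k := by
  rw [Nat.cast_mul, Complex.natCast_mul_natCast_cpow]
  congr 1
  induction k with
  | zero => simp
  | succ k ih => rw [pow_succ, Nat.cast_mul, Complex.natCast_mul_natCast_cpow, ih, pow_succ]

end Total

/-! ### The ideal zeta function of the Heisenberg Lie algebra -/

section Ideals

variable {p : ℕ} [hp : Fact p.Prime] {g n : ℕ} {f : Fin g → ℕ} {hn : ∑ i, f i = n}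
variable {R : Type*} [CommRing R] [Algebra ℤ_[p] R] {π : Fin g → R}

/-- The pairs of an exponent vector `l` and a submodule of finite index containing the ideal
`(∏ π_i ^ l_i)`. -/
abbrev OverIdeal (p : ℕ) [Fact p.Prime] {R : Type*} [CommRing R] [Algebra ℤ_[p] R]
    (π : Fin g → R) :=
  {x : (Fin g → ℕ) × FinIdx p R //
    (Ideal.span {∏ i, π i ^ x.1 i}).restrictScalars ℤ_[p] ≤ x.2.1}

/-- The submodules containing a nonzero ideal `J` correspond to the subgroups of `R ⧸ J`, and by
duality those of index `p ^ ∑ μ_i` may be counted by the subgroups of type `μ`. -/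
lemma IsUniformizing.exists_types (h : IsUniformizing hn p π) :
    ∃ φ : OverIdeal p π → (Fin g → ℕ) × (Fin n → ℕ),
      (∀ x, (φ x).1 = x.1.1 ∧ Antitone (φ x).2 ∧ x.1.2.idx = p ^ ∑ i, (φ x).2 i) ∧
      ∀ l mu, Antitone mu → Nat.card {x // φ x = (l, mu)} =
        alpha p (sortDesc (l ∘ block hn)) mu := by
  choose τ hτ1 hτ2 hτ3 using fun l => exists_dualType (h.nonempty_equiv l).some
  let q : ∀ l : Fin g → ℕ, R →+ R ⧸ Ideal.span {∏ i, π i ^ l i} := fun l =>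
    (Ideal.Quotient.mk _).toAddMonoidHom
  have hq : ∀ l, Function.Surjective (q l) := fun l => Ideal.Quotient.mk_surjective
  have hker : ∀ x : OverIdeal p π, (q x.1.1).ker ≤ x.1.2.1.toAddSubgroup :=
    fun x y hy => x.2 (Ideal.Quotient.eq_zero_iff_mem.1 hy)
  refine ⟨fun x => (x.1.1, τ x.1.1 (x.1.2.1.toAddSubgroup.map (q x.1.1))),
    fun x => ⟨rfl, hτ2 _ _, ?_⟩, fun l mu hmu => ?_⟩
  · simp only
    rw [← hτ1, AddSubgroup.index_map_eq _ (hq _) (hker x)]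
    rfl
  · rw [← hτ3 l mu hmu]
    have hpow : ∀ (H : AddSubgroup (R ⧸ Ideal.span {∏ i, π i ^ l i})) (v : R),
        (p : ℤ_[p]) ^ (∑ i, f i * l i) • v ∈ H.comap (q l) := by
      intro H v
      have h1 := (Ideal.span {∏ i, π i ^ l i}).toAddSubgroup.nsmul_index_mem v
      rw [h.index_span] at h1
      have h2 : (p : ℤ_[p]) ^ (∑ i, f i * l i) • v = p ^ (∑ i, f i * l i) • v := by
        rw [← Nat.cast_pow, Nat.cast_smul_eq_nsmul]
      rw [AddSubgroup.mem_comap, h2, show q l _ = 0 from Ideal.Quotient.eq_zero_iff_mem.2 h1]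
      exact H.zero_mem
    have hidx : ∀ H : AddSubgroup (R ⧸ Ideal.span {∏ i, π i ^ l i}),
        (submoduleOfAddSubgroup (H.comap (q l)) (hpow H)).toAddSubgroup.index ≠ 0 := by
      intro H
      change (H.comap (q l)).index ≠ 0
      rw [AddSubgroup.index_comap_of_surjective _ (hq l), hτ1]
      exact pow_ne_zero _ hp.out.ne_zero
    have hmap : ∀ H : AddSubgroup (R ⧸ Ideal.span {∏ i, π i ^ l i}),
        (submoduleOfAddSubgroup (H.comap (q l)) (hpow H)).toAddSubgroup.map (q l) = H :=
      fun H => AddSubgroup.map_comap_eq_self_of_surjective (hq l) H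
    symm
    refine Nat.card_congr (Equiv.ofBijective (fun H => ⟨⟨(l, ⟨_, hidx H.1⟩), ?_⟩, ?_⟩) ⟨?_, ?_⟩)
    · intro y hy
      change q l y ∈ H.1
      rw [show q l y = 0 from Ideal.Quotient.eq_zero_iff_mem.2 hy]
      exact H.1.zero_mem
    · simp only
      rw [hmap, H.2]
    · intro H H' hH
      have h1 := congrArg (fun x => x.1.1.2.1) hH
      simp only at h1
      refine Subtype.ext ?_
      rw [← hmap H.1, h1, hmap]
    · rintro ⟨⟨⟨l', N⟩, hN⟩, hx⟩
      obtain ⟨rfl, hx2⟩ := Prod.mk_inj.1 hx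
      refine ⟨⟨N.1.toAddSubgroup.map (q l'), hx2⟩, ?_⟩
      refine Subtype.ext (Subtype.ext (Prod.ext rfl (Subtype.ext ?_)))
      refine Submodule.toAddSubgroup_injective ?_
      exact AddSubgroup.comap_map_eq_self (hker ⟨(l', N), hN⟩)

variable [Module.Free ℤ_[p] R] [Module.Finite ℤ_[p] R]

omit [Module.Free ℤ_[p] R] in
/-- The sum over all submodules containing an ideal `(∏ π_i ^ l_i)`, for all `l`. A submodule whose
type is `μ` by duality has index `p ^ ∑ μ_i`, so that it contributes `(p ^ {2n} t) ^ ∑ μ_i t ^ {2 ∑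
f_i l_i}`. -/
lemma IsUniformizing.summable_and_tsum_overIdeal (h : IsUniformizing hn p π)
    (hf : ∀ i, 0 < f i) (hn0 : 0 < n) {s : ℂ}
    (ht : (p : ℝ) ^ (2 * n) * ‖(p : ℂ) ^ (-s)‖ ^ 3 < 1) :
    (Summable fun x : OverIdeal p π => ‖(x.1.2.idx : ℂ) ^ (2 * n) *
      ((x.1.2.idx * p ^ (2 * ∑ i, f i * x.1.1 i) : ℕ) : ℂ) ^ (-s)‖) ∧
    ∑' x : OverIdeal p π, (x.1.2.idx : ℂ) ^ (2 * n) *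
      ((x.1.2.idx * p ^ (2 * ∑ i, f i * x.1.1 i) : ℕ) : ℂ) ^ (-s) =
      ∑ w : {w : DyckWord // w.semilength = n}, ∑ A ∈ compatible f w.1,
        DwA p n f w.1 A ((p : ℂ) ^ (-s)) := by
  classical
  obtain ⟨φ, h1, h2⟩ := h.exists_types
  set t := (p : ℂ) ^ (-s) with ht'
  let G : (Fin g → ℕ) × (Fin n → ℕ) → ℂ := fun y =>
    ((p : ℂ) ^ (2 * n) * t) ^ (∑ i, y.2 i) * t ^ (2 * ∑ i, f i * y.1 i)
  have hG : ∀ x : OverIdeal p π, (x.1.2.idx : ℂ) ^ (2 * n) *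
      ((x.1.2.idx * p ^ (2 * ∑ i, f i * x.1.1 i) : ℕ) : ℂ) ^ (-s) = G (φ x) := by
    intro x
    obtain ⟨h3, -, h4⟩ := h1 x
    have h5 := natCast_mul_pow_cpow (p := p) 1 (∑ i, (φ x).2 i) s
    rw [one_mul, Nat.cast_one, Complex.one_cpow, one_mul] at h5
    rw [natCast_mul_pow_cpow, h4, h5, ← h3, ← ht', Nat.cast_pow]
    simp only [G]
    ring
  have hfin : ∀ y, Finite {x : OverIdeal p π // φ x = y} := by
    intro y
    have := finite_submodules (p := p) (V := R) (m := p ^ ∑ i, y.2 i)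
      (pow_ne_zero _ hp.out.ne_zero)
    refine Finite.of_injective (β := {N : Submodule ℤ_[p] R // N.toAddSubgroup.index = p ^ ∑ i, y.2 i})
      (fun x => ⟨x.1.1.2.1, (h1 x.1).2.2.trans (by rw [x.2])⟩) fun x x' hx => ?_
    refine Subtype.ext (Subtype.ext (Prod.ext ?_ (Subtype.ext (Subtype.mk.inj hx))))
    rw [← (h1 x.1).1, ← (h1 x'.1).1, x.2, x'.2]
  have hcard : ∀ y : (Fin g → ℕ) × (Fin n → ℕ), (Nat.card {x : OverIdeal p π // φ x = y} : ℂ) * G y =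
      if Antitone y.2 then term p t (y.1 ∘ block hn, y.2) else 0 := by
    intro y
    split_ifs with hy
    · rw [h2 y.1 y.2 hy]
      simp only [G, term, sum_comp_block]
      ring
    · have : IsEmpty {x : OverIdeal p π // φ x = y} := ⟨fun x => hy (x.2 ▸ (h1 x.1).2.1)⟩
      rw [Nat.card_of_isEmpty, Nat.cast_zero, zero_mul]
  have key := hasSum_sum_DwA hf hn hn0 ht
  have hs : Summable fun x => ‖G (φ x)‖ := by
    rw [summable_norm_comp_iff φ G]
    exact key.summable.norm.congr fun y => by rw [hcard]
  refine ⟨hs.congr fun x => by rw [hG], ?_⟩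
  rw [tsum_congr hG, tsum_comp_eq φ G hs, tsum_congr hcard]
  exact key.tsum_eq

omit [Module.Free ℤ_[p] R] [Module.Finite ℤ_[p] R] in
/-- The zeta function of `R × R` is the sum over the primitive submodules times an Euler factor. -/
lemma IsUniformizing.tsum_eq_primitive (h : IsUniformizing hn p π) {s : ℂ} (hf : ∀ i, 0 < f i)
    (ht : ‖(p : ℂ) ^ (-s)‖ < 1)
    (hs : Summable fun N : FinIdx p (R × R) => ‖(N.idx : ℂ) ^ (-s)‖) :
    (∏ i, (1 - ((p : ℂ) ^ (-s)) ^ (2 * f i))) * ∑' N : FinIdx p (R × R), (N.idx : ℂ) ^ (-s) =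
      ∑' N : Primitive p R, (N.1.idx : ℂ) ^ (-s) := by
  have hz : ∀ i, ‖((p : ℂ) ^ (-s)) ^ (2 * f i)‖ < 1 := fun i => by
    rw [norm_pow]
    exact pow_lt_one₀ (norm_nonneg _) ht (by have := hf i; omega)
  obtain ⟨h1, h2⟩ := summable_norm_and_tsum_prod_pow hz
  have h3 : Summable fun N : Primitive p R => ‖(N.1.idx : ℂ) ^ (-s)‖ :=
    hs.comp_injective Subtype.val_injective
  have h4 : ∀ x : Primitive p R × (Fin g → ℕ), ((h.ofPrimitive x).idx : ℂ) ^ (-s) =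
      (x.1.1.idx : ℂ) ^ (-s) * ∏ i, (((p : ℂ) ^ (-s)) ^ (2 * f i)) ^ x.2 i := fun x => by
    rw [h.idx_ofPrimitive, natCast_mul_pow_cpow, Finset.mul_sum, ← Finset.prod_pow_eq_pow_sum]
    congr 1
    exact Finset.prod_congr rfl fun i _ => by rw [← pow_mul, mul_assoc]
  rw [← (Equiv.ofBijective _ h.bijective_ofPrimitive).tsum_eq]
  simp only [Equiv.ofBijective_apply, h4]
  rw [← tsum_mul_tsum_of_summable_norm h3 h1, h2, mul_left_comm, ← Finset.prod_mul_distrib,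
    Finset.prod_eq_one, mul_one]
  intro i _
  refine mul_inv_cancel₀ fun h0 => ?_
  have := hz i
  rw [← sub_eq_zero.1 h0, norm_one] at this
  exact lt_irrefl _ this

/-- The pairs of submodules of finite index of `R × R` and `R` such that the second contains the
content of the first. -/
abbrev ContentPair (p : ℕ) [Fact p.Prime] (R : Type*) [CommRing R] [Algebra ℤ_[p] R] :=
  {q : FinIdx p (R × R) × FinIdx p R // (content q.1.1).restrictScalars ℤ_[p] ≤ q.2.1}

/-- A pair of submodules as above is given by a primitive submodule and a submodule containing an
ideal. -/
noncomputable def IsUniformizing.contentPair (h : IsUniformizing hn p π)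
    (x : Primitive p R × OverIdeal p π) : ContentPair p R :=
  ⟨(h.ofPrimitive (x.1, x.2.1.1), x.2.1.2), by
    rw [h.content_ofPrimitive]
    exact x.2.2⟩

omit [Module.Free ℤ_[p] R] [Module.Finite ℤ_[p] R] in
lemma IsUniformizing.bijective_contentPair (h : IsUniformizing hn p π) :
    Function.Bijective h.contentPair := by
  constructor
  · rintro ⟨N, ⟨⟨l, N₂⟩, hN⟩⟩ ⟨N', ⟨⟨l', N₂'⟩, hN'⟩⟩ hNN
    obtain ⟨h1, h2⟩ := Prod.mk_inj.1 (congrArg Subtype.val hNN)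
    obtain ⟨rfl, rfl⟩ := Prod.mk_inj.1 (h.bijective_ofPrimitive.1 h1)
    have h3 : N₂ = N₂' := h2
    subst h3
    rfl
  · rintro ⟨⟨N₁, N₂⟩, hN⟩
    obtain ⟨⟨N, l⟩, rfl⟩ := h.bijective_ofPrimitive.2 N₁
    refine ⟨(N, ⟨(l, N₂), ?_⟩), rfl⟩
    rw [← h.content_ofPrimitive (N, l)]
    exact hN

/-- The ideals of finite index of the Heisenberg Lie algebra. -/
abbrev HeisenbergIdeal (p : ℕ) [Fact p.Prime] (R : Type*) [CommRing R] [Algebra ℤ_[p] R] :=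
  {I : LieIdeal ℤ_[p] (heisenberg ℤ_[p] R) // I.toSubmodule.toAddSubgroup.index ≠ 0}

/-- The submodules of `(R × R) × R` that are ideals of the Heisenberg Lie algebra. -/
abbrev HeisenbergSubmodule (p : ℕ) [Fact p.Prime] (R : Type*) [CommRing R] [Algebra ℤ_[p] R] :=
  {N : FinIdx p ((R × R) × R) //
    (content (splitFinIdx N).1.1).restrictScalars ℤ_[p] ≤ (splitFinIdx N).2.1}

/-- An ideal of the Heisenberg Lie algebra in coordinates. -/
noncomputable def idealToSubmodule (I : HeisenbergIdeal p R) : HeisenbergSubmodule p R :=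
  ⟨finIdxCongr (heisenbergEquiv p R) ⟨I.1.toSubmodule, I.2⟩,
    (lie_mem_iff I.1.toSubmodule).1 fun _ _ hY => lie_mem_right _ _ I.1 _ _ hY⟩

omit [Module.Free ℤ_[p] R] [Module.Finite ℤ_[p] R] in
lemma idx_idealToSubmodule (I : HeisenbergIdeal p R) :
    (idealToSubmodule I).1.idx = I.1.toSubmodule.toAddSubgroup.index :=
  idx_finIdxCongr (heisenbergEquiv p R) ⟨I.1.toSubmodule, I.2⟩

omit [Module.Free ℤ_[p] R] [Module.Finite ℤ_[p] R] in
lemma bijective_idealToSubmodule : Function.Bijective (idealToSubmodule (p := p) (R := R)) := by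
  constructor
  · intro I I' h
    have h1 := (finIdxCongr (heisenbergEquiv p R)).injective (congrArg Subtype.val h)
    exact Subtype.ext (LieSubmodule.toSubmodule_injective (congrArg Subtype.val h1))
  · rintro ⟨N, hN⟩
    obtain ⟨N, rfl⟩ := (finIdxCongr (heisenbergEquiv p R)).surjective N
    exact ⟨⟨{ N.1 with lie_mem := fun {X Y} hY => (lie_mem_iff N.1).2 hN X Y hY }, N.2⟩, rfl⟩

/-- The two components of an ideal of the Heisenberg Lie algebra. -/
noncomputable def submoduleToPair (N : HeisenbergSubmodule p R) : ContentPair p R :=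
  ⟨splitFinIdx N.1, N.2⟩

lemma finite_submoduleToPair_fiber (q : ContentPair p R) :
    Finite {N // submoduleToPair N = q} := by
  have := finite_split_fiber q.1
  exact Finite.of_injective (β := {N : FinIdx p ((R × R) × R) // splitFinIdx N = q.1})
    (fun N => ⟨N.1.1, congrArg Subtype.val N.2⟩) fun N N' h =>
      Subtype.ext (Subtype.ext (Subtype.mk.inj h))

/-- An ideal is determined by its two components `N₁`, `N₂` and a homomorphism `N₁ → R / N₂`, where
`N₁` is free of rank `2n`. -/
lemma card_submoduleToPair_fiber (hR : Module.finrank ℤ_[p] R = n) (q : ContentPair p R) :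
    Nat.card {N // submoduleToPair N = q} = q.1.2.idx ^ (2 * n) := by
  rw [← card_split_fiber (V₁ := R × R) (r := 2 * n) (by rw [Module.finrank_prod, hR, two_mul]) q.1]
  exact Nat.card_congr
    { toFun := fun N => ⟨N.1.1, congrArg Subtype.val N.2⟩
      invFun := fun N => ⟨⟨N.1, by rw [N.2]; exact q.2⟩, Subtype.ext N.2⟩
      left_inv := fun N => rfl
      right_inv := fun N => rfl }

/-- The sum over the ideals of the Heisenberg Lie algebra: an ideal is given by a primitive
submodule of `R × R`, a submodule of `R` containing some `(∏ π_i ^ l_i)`, and a homomorphism. -/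
theorem IsUniformizing.summable_and_tsum_ideals (h : IsUniformizing hn p π)
    (hR : Module.finrank ℤ_[p] R = n) (hf : ∀ i, 0 < f i) (hn0 : 0 < n) {s : ℂ}
    (ht : (p : ℝ) ^ (2 * n) * ‖(p : ℂ) ^ (-s)‖ ^ 3 < 1)
    (hs : Summable fun N : FinIdx p (R × R) => ‖(N.idx : ℂ) ^ (-s)‖) :
    (Summable fun I : HeisenbergIdeal p R =>
      ‖(I.1.toSubmodule.toAddSubgroup.index : ℂ) ^ (-s)‖) ∧
    ∑' I : HeisenbergIdeal p R, (I.1.toSubmodule.toAddSubgroup.index : ℂ) ^ (-s) =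
      (∑' N : Primitive p R, (N.1.idx : ℂ) ^ (-s)) *
        ∑ w : {w : DyckWord // w.semilength = n}, ∑ A ∈ compatible f w.1,
          DwA p n f w.1 A ((p : ℂ) ^ (-s)) := by
  obtain ⟨h1, h2⟩ := h.summable_and_tsum_overIdeal hf hn0 ht
  have h3 : Summable fun N : Primitive p R => ‖(N.1.idx : ℂ) ^ (-s)‖ :=
    hs.comp_injective Subtype.val_injective
  let G : ContentPair p R → ℂ := fun q => ((q.1.1.idx * q.1.2.idx : ℕ) : ℂ) ^ (-s)
  have hfin : ∀ q : ContentPair p R, Finite {N // submoduleToPair N = q} :=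
    finite_submoduleToPair_fiber
  let e₁ := Equiv.ofBijective _ (bijective_idealToSubmodule (p := p) (R := R))
  let e₂ := Equiv.ofBijective _ h.bijective_contentPair
  have hG₁ : ∀ I : HeisenbergIdeal p R, (I.1.toSubmodule.toAddSubgroup.index : ℂ) ^ (-s) =
      G (submoduleToPair (e₁ I)) := fun I => by
    rw [← idx_idealToSubmodule, idx_split]
    rfl
  have hG₂ : ∀ x : Primitive p R × OverIdeal p π,
      (Nat.card {N // submoduleToPair N = e₂ x} : ℂ) * G (e₂ x) =
        (x.1.1.idx : ℂ) ^ (-s) * ((x.2.1.2.idx : ℂ) ^ (2 * n) *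
          ((x.2.1.2.idx * p ^ (2 * ∑ i, f i * x.2.1.1 i) : ℕ) : ℂ) ^ (-s)) := fun x => by
    rw [card_submoduleToPair_fiber hR]
    change ((x.2.1.2.idx ^ (2 * n) : ℕ) : ℂ) *
      (((h.ofPrimitive (x.1, x.2.1.1)).idx * x.2.1.2.idx : ℕ) : ℂ) ^ (-s) = _
    rw [h.idx_ofPrimitive, Nat.cast_pow, mul_left_comm, ← Complex.natCast_mul_natCast_cpow,
      ← Nat.cast_mul]
    congr 3
    simp only
    ring
  have h4 : Summable fun N => ‖G (submoduleToPair N)‖ := by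
    rw [summable_norm_comp_iff, ← e₂.summable_iff]
    refine (h3.mul_of_nonneg h1 (fun _ => norm_nonneg _) fun _ => norm_nonneg _).congr fun x => ?_
    rw [Function.comp_apply, hG₂, norm_mul (_ ^ (-s)) (_ * _)]
  constructor
  · exact (e₁.summable_iff.2 h4).congr fun I => by rw [hG₁]; rfl
  · rw [tsum_congr hG₁, e₁.tsum_eq fun N => G (submoduleToPair N), tsum_comp_eq _ _ h4,
      ← e₂.tsum_eq, tsum_congr hG₂, ← h2, tsum_mul_tsum_of_summable_norm h3 h1]

end Ideals

/-! ### The Heisenberg Lie algebra over a completed ring of integers -/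

section Integers

open TensorProduct

variable {p : ℕ} [hp : Fact p.Prime] {g n : ℕ} {f : Fin g → ℕ}

/-- The completion of `O` at an unramified prime has a system of uniformizers. -/
lemma exists_isUniformizing {O : Type*} [CommRing O] [IsDedekindDomain O] [CharZero O]
    [Module.Free ℤ O] [Module.Finite ℤ O] {P : Fin g → Ideal O} (hn : ∑ i, f i = n)
    (hP : ∀ i, (P i).IsPrime) (hinj : Function.Injective P)
    (hprod : Ideal.span {(p : O)} = ∏ i, P i) (hdeg : ∀ i, (P i).inertiaDeg ℤ = f i) :
    ∃ π : Fin g → ℤ_[p] ⊗[ℤ] O, IsUniformizing hn p π := by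
  choose π hπ using exists_map_eq_span (p := p) hP hprod
  exact ⟨π,
    { mem_nonZeroDivisors := uniformizer_mem_nonZeroDivisors hprod hπ
      exists_eq_span := fun J hJ => exists_eq_span_prod_pow hP hinj hprod hπ hJ
      span_injective := fun l l' h => span_prod_pow_injective hP hinj hprod hπ h
      nonempty_equiv := nonempty_quotient_span_equiv hP hinj hprod hdeg hn hπ }⟩

lemma finite_of_index_ne_zero {X : Type*} (F : X → ℕ) {m : ℕ} (hm : m ≠ 0)
    [h : Finite {x // F x = m}] : Finite {i : {x // F x ≠ 0} // F i.1 = m} :=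
  Finite.of_equiv _ (Equiv.subtypeSubtypeEquivSubtype (p := fun x => F x ≠ 0)
    (q := fun x => F x = m) fun h => by rwa [h]).symm

lemma card_of_index_ne_zero {X : Type*} (F : X → ℕ) {m : ℕ} (hm : m ≠ 0) :
    Nat.card {x // F x = m} = Nat.card {i : {x // F x ≠ 0} // F i.1 = m} :=
  Nat.card_congr (Equiv.subtypeSubtypeEquivSubtype (p := fun x => F x ≠ 0)
    (q := fun x => F x = m) fun h => by rwa [h]).symm

lemma norm_prime_cpow_neg (s : ℂ) : ‖(p : ℂ) ^ (-s)‖ = (p : ℝ) ^ (-s.re) :=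
  norm_natCast_cpow_neg p hp.out.ne_zero s

/-- If `Re s > 2n - 1`, then the explicit formula applies to `t = p ^ {-s}`, as
`2n - 3 (2n - 1) < 0`. -/
lemma pow_mul_norm_cpow_lt_one (hn0 : 0 < n) {s : ℂ} (hs : 2 * (n : ℝ) - 1 < s.re) :
    (p : ℝ) ^ (2 * n) * ‖(p : ℂ) ^ (-s)‖ ^ 3 < 1 := by
  have hp1 : (1 : ℝ) < p := by exact_mod_cast hp.out.one_lt
  have hp0 : (0 : ℝ) < p := by linarith
  have hn1 : (1 : ℝ) ≤ n := by exact_mod_cast hn0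
  rw [norm_prime_cpow_neg, ← Real.rpow_natCast, ← Real.rpow_natCast, ← Real.rpow_mul hp0.le,
    ← Real.rpow_add hp0]
  refine Real.rpow_lt_one_of_one_lt_of_neg hp1 ?_
  push_cast
  linarith

variable {R : Type*} [CommRing R] [Algebra ℤ_[p] R] [Module.Free ℤ_[p] R] [Module.Finite ℤ_[p] R]

omit [Module.Free ℤ_[p] R] in
lemma finite_heisenberg_ideals {m : ℕ} (hm : m ≠ 0) :
    Finite {I : LieIdeal ℤ_[p] (heisenberg ℤ_[p] R) // I.toSubmodule.toAddSubgroup.index = m} := by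
  have : Module.Finite ℤ_[p] (heisenberg ℤ_[p] R) :=
    Module.Finite.equiv (heisenbergEquiv p R).symm
  have := finite_submodules (p := p) (V := heisenberg ℤ_[p] R) hm
  exact Finite.of_injective (β := {N : Submodule ℤ_[p] (heisenberg ℤ_[p] R) //
    N.toAddSubgroup.index = m}) (fun I => ⟨I.1.toSubmodule, I.2⟩) fun I I' h =>
      Subtype.ext (LieSubmodule.toSubmodule_injective (Subtype.mk.inj h))

/-- As a module, `R × R` is `ℤ_p ^ {2n}`. -/
lemma summable_prod_self (hR : Module.finrank ℤ_[p] R = n) {s : ℂ} (hs : 2 * (n : ℝ) - 1 < s.re) :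
    (Summable fun N : FinIdx p (Fin (2 * n) → ℤ_[p]) => ‖(N.idx : ℂ) ^ (-s)‖) ∧
    (Summable fun N : FinIdx p (R × R) => ‖(N.idx : ℂ) ^ (-s)‖) ∧
    ∑' N : FinIdx p (Fin (2 * n) → ℤ_[p]), (N.idx : ℂ) ^ (-s) =
      ∑' N : FinIdx p (R × R), (N.idx : ℂ) ^ (-s) := by
  let e : (R × R) ≃ₗ[ℤ_[p]] (Fin (2 * n) → ℤ_[p]) :=
    LinearEquiv.ofFinrankEq _ _ (by rw [Module.finrank_prod, hR, Module.finrank_fin_fun, two_mul])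
  have h := summable_free (p := p) (2 * n) (s := s) (by push_cast; linarith)
  refine ⟨h, (summable_finIdxCongr_iff e fun m => ‖(m : ℂ) ^ (-s)‖).2 h, ?_⟩
  rw [← (finIdxCongr e).tsum_eq]
  exact tsum_congr fun N => by rw [idx_finIdxCongr]

/-- The zeta functions of the Heisenberg Lie algebra and of a free module, for a ring with a
system of uniformizers. -/
theorem IsUniformizing.idealZeta_eq {hn : ∑ i, f i = n} {π : Fin g → R}
    (h : IsUniformizing hn p π) (hR : Module.finrank ℤ_[p] R = n) (hf : ∀ i, 0 < f i)
    (hn0 : 0 < n) {s : ℂ} (hs : 2 * (n : ℝ) - 1 < s.re) :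
    LSeriesSummable (fun m => (numIdeals ℤ_[p] (heisenberg ℤ_[p] R) m : ℂ)) s ∧
    LSeriesSummable (fun m => (numSubmodules ℤ_[p] (Fin (2 * n) → ℤ_[p]) m : ℂ)) s ∧
    idealZeta ℤ_[p] (heisenberg ℤ_[p] R) s = (∏ i, (1 - ((p : ℂ) ^ (-s)) ^ (2 * f i))) *
      submoduleZeta ℤ_[p] (Fin (2 * n) → ℤ_[p]) s *
      ∑ w : {w : DyckWord // w.semilength = n}, ∑ A ∈ compatible f w.1,
        DwA p n f w.1 A ((p : ℂ) ^ (-s)) := by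
  have ht1 : ‖(p : ℂ) ^ (-s)‖ < 1 := by
    have hp1 : (1 : ℝ) < p := by exact_mod_cast hp.out.one_lt
    have hn1 : (1 : ℝ) ≤ n := by exact_mod_cast hn0
    rw [norm_prime_cpow_neg]
    exact Real.rpow_lt_one_of_one_lt_of_neg hp1 (by linarith)
  obtain ⟨hs1, hs2, hs3⟩ := summable_prod_self (R := R) hR hs
  obtain ⟨h1, h2⟩ := h.summable_and_tsum_ideals hR hf hn0 (pow_mul_norm_cpow_lt_one hn0 hs) hs2
  obtain ⟨h3, h4⟩ := lseries_eq_tsum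
    (fun I : HeisenbergIdeal p R => I.1.toSubmodule.toAddSubgroup.index) (fun I => I.2)
    (fun m hm => by
      have := finite_heisenberg_ideals (p := p) (R := R) hm
      exact finite_of_index_ne_zero
        (fun I : LieIdeal ℤ_[p] (heisenberg ℤ_[p] R) => I.toSubmodule.toAddSubgroup.index) hm)
    (a := numIdeals ℤ_[p] (heisenberg ℤ_[p] R)) (fun m hm => card_of_index_ne_zero
      (fun I : LieIdeal ℤ_[p] (heisenberg ℤ_[p] R) => I.toSubmodule.toAddSubgroup.index) hm) h1
  obtain ⟨h5, h6⟩ := lseries_eq_tsum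
    (fun N : FinIdx p (Fin (2 * n) → ℤ_[p]) => N.idx) (fun N => N.2)
    (fun m hm => by
      have := finite_submodules (p := p) (V := Fin (2 * n) → ℤ_[p]) hm
      exact finite_of_index_ne_zero
        (fun N : Submodule ℤ_[p] (Fin (2 * n) → ℤ_[p]) => N.toAddSubgroup.index) hm)
    (a := numSubmodules ℤ_[p] (Fin (2 * n) → ℤ_[p])) (fun m hm => card_of_index_ne_zero
      (fun N : Submodule ℤ_[p] (Fin (2 * n) → ℤ_[p]) => N.toAddSubgroup.index) hm) hs1
  refine ⟨h3, h5, ?_⟩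
  rw [idealZeta, submoduleZeta, h4, h6, hs3, h2, h.tsum_eq_primitive hf ht1 hs2]

end Integers

end HeisenbergZeta

theorem mainTheorem2 (p : ℕ) [Fact p.Prime] (g n : ℕ) (hg : 0 < g) (f : Fin g → ℕ)
    (hf : ∀ i, 0 < f i) (hn : ∑ i, f i = n) :
    -- the explicit formula for each summand
    (∀ w : DyckWord, w.semilength = n → ∀ A ∈ HeisenbergZeta.compatible f w,
      ∀ t : ℂ, (p : ℝ) ^ (2 * n) * ‖t‖ ^ 3 < 1 →
        (∀ v ∈ HeisenbergZeta.weakOrderings g, HeisenbergZeta.Induces f w v A →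
          Summable fun x : HeisenbergZeta.pairs n f w v => HeisenbergZeta.term p t x.1) ∧
        HeisenbergZeta.DwA p n f w A t =
          (∏ i ∈ Finset.Icc 1 (HeisenbergZeta.numRuns w),
            HeisenbergZeta.gaussBinom
              (HeisenbergZeta.dyckL w i - HeisenbergZeta.dyckM w (i - 1))
              (HeisenbergZeta.dyckL w i - HeisenbergZeta.dyckM w i) (p : ℂ)⁻¹) *
          (∏ k : Fin (HeisenbergZeta.numRuns w),
            HeisenbergZeta.igusaWO (A k).card (HeisenbergZeta.yData p n f w A k t)) *
          (∏ i ∈ Finset.Ico 1 (HeisenbergZeta.numRuns w),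
            HeisenbergZeta.igusaCirc
              (HeisenbergZeta.dyckM w i - HeisenbergZeta.dyckM w (i - 1)) (p : ℂ)⁻¹
              (fun j => HeisenbergZeta.xData p n w i t (HeisenbergZeta.dyckM w (i - 1) + j))) *
          HeisenbergZeta.igusa
            (n - HeisenbergZeta.dyckM w (HeisenbergZeta.numRuns w - 1)) (p : ℂ)⁻¹
            (fun j => HeisenbergZeta.xData p n w (HeisenbergZeta.numRuns w) t
              (HeisenbergZeta.dyckM w (HeisenbergZeta.numRuns w - 1) + j))) ∧
    -- the summands add up to the zeta function
    (∀ (K : Type*) [Field K] [NumberField K] (P : Fin g → Ideal (NumberField.RingOfIntegers K)),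
      (∀ i, (P i).IsPrime) → Function.Injective P →
      Ideal.span {(p : NumberField.RingOfIntegers K)} = ∏ i, P i →
      (∀ i, (P i).inertiaDeg ℤ = f i) →
      ∀ s : ℂ, 2 * (n : ℝ) - 1 < s.re →
        (∀ m : ℕ, m ≠ 0 → Finite {I : LieIdeal ℤ_[p] (HeisenbergZeta.heisenberg ℤ_[p]
          (TensorProduct ℤ ℤ_[p] (NumberField.RingOfIntegers K))) //
            I.toSubmodule.toAddSubgroup.index = m}) ∧
        (∀ m : ℕ, m ≠ 0 → Finite {N : Submodule ℤ_[p] (Fin (2 * n) → ℤ_[p]) //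
            N.toAddSubgroup.index = m}) ∧
        LSeriesSummable (fun m => (HeisenbergZeta.numIdeals ℤ_[p] (HeisenbergZeta.heisenberg ℤ_[p]
          (TensorProduct ℤ ℤ_[p] (NumberField.RingOfIntegers K))) m : ℂ)) s ∧
        LSeriesSummable (fun m =>
          (HeisenbergZeta.numSubmodules ℤ_[p] (Fin (2 * n) → ℤ_[p]) m : ℂ)) s ∧
        HeisenbergZeta.idealZeta ℤ_[p] (HeisenbergZeta.heisenberg ℤ_[p]
          (TensorProduct ℤ ℤ_[p] (NumberField.RingOfIntegers K))) s =
          (∏ i, (1 - ((p : ℂ) ^ (-s)) ^ (2 * f i))) *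
          HeisenbergZeta.submoduleZeta ℤ_[p] (Fin (2 * n) → ℤ_[p]) s *
          ∑ w : {w : DyckWord // w.semilength = n}, ∑ A ∈ HeisenbergZeta.compatible f w.1,
            HeisenbergZeta.DwA p n f w.1 A ((p : ℂ) ^ (-s))) := by
  have hn0 : 0 < n := by
    rw [← hn]
    exact (hf ⟨0, hg⟩).trans_le (Finset.single_le_sum (fun i _ => Nat.zero_le (f i))
      (Finset.mem_univ _))
  refine ⟨fun w hw A hA t ht => ⟨fun v _ hv =>
    HeisenbergZeta.summable_term hf hn hw hn0 hA ht hv,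
    HeisenbergZeta.DwA_eq hf hn hw hn0 hA ht⟩, fun K _ _ P hP hinj hprod hdeg s hs => ?_⟩
  obtain ⟨π, hπ⟩ := HeisenbergZeta.exists_isUniformizing hn hP hinj hprod hdeg
  have hR : Module.finrank ℤ_[p] (TensorProduct ℤ ℤ_[p] (NumberField.RingOfIntegers K)) = n := by
    rw [Module.finrank_baseChange, HeisenbergZeta.finrank_eq_sum hP hprod hdeg, hn]
  exact ⟨fun m hm => HeisenbergZeta.finite_heisenberg_ideals hm,
    fun m hm => HeisenbergZeta.finite_submodules hm, hπ.idealZeta_eq hR hf hn0 hs⟩
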